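/- Conventions. $\mathsf{Cat}$ is the 2-category of small categories, $\mathsf{CAT}$ that of not necessarily small categories; $\mathbb{1}$ is the terminal category, $[1]=(0<1)$, $\square=[1]\times[1]$. A prederivator is a (strict) 2-functor $\mathscr D\colon\mathsf{Cat}^{\mathrm{op}}\to\mathsf{CAT}$ (reversing functors but not natural transformations); morphisms of prederivators are pseudo-natural transformations and 2-morphisms are modifications. Write $u^*=\mathscr D(u)$. A derivator is a prederivator such that (Der1) $\mathscr D(\coprod_i A_i)\to\prod_i\mathscr D(A_i)$ is an equivalence for every small family $(A_i)$; (Der2) a morphism in $\mathscr D(A)$ is an isomorphism iff its restrictions along all $a\colon\mathbb{1}\to A$ are; (Der3) every $u^*$ has a left adjoint $u_!$ and a right adjoint $u_*$; (Der4) for all $u\colon A\to B$ and $b\in B$ the canonical mates $\pi_!p^*\to b^*u_!$ and $b^*u_*\to\pi_*q^*$ of the slice squares of $(u/b)$ and $(b/u)$ are isomorphisms. An object of $\mathscr D(\square)$ is cartesian (cocartesian) if it lies in the essential image of the right (left) Kan extension functor along the inclusion of $\square$ without its initial (final) object. A derivator is stable if $\mathscr D(\mathbb{1})$ has a zero object and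 cartesian and cocartesian squares coincide. A morphism of stable derivators is exact if it preserves initial and terminal objects and cartesian and cocartesian squares. For a small category $B$, $\mathscr D^B$ is $A\mapsto\mathscr D(B\times A)$; this defines a 2-functor $(-)^B$ from the 2-category of stable derivators, exact morphisms and all transformations to the 2-category of derivators (a full sub-2-category of prederivators). Small categories $A,A'$ are strongly stably equivalent if there is a pseudo-natural equivalence $\Phi\colon(-)^A\simeq(-)^{A'}$ between these 2-functors, i.e. a pseudo-natural transformation all of whose components $\Phi_{\mathscr D}\colon\mathscr D^A\to\mathscr D^{A'}$ are equivalences of derivators. Theorem. Let $C$ be a small category, let $n\ge 0$, and let $y_1,\dots,y_n$ be objects of $C$ (not necessarily distinct), regarded as a functor $y\colon n\cdot\mathbb{1}\to C$ from the discrete category on $n$ objects. Let $(n\cdot\mathbb{1})^{\lhd}$ and $(n\cdot\mathbb{1})^{\rhd}$ be obtained from $n\cdot\mathbb{1}$ by adjoining an initial, respectively a terminal, object, and let $C^-$ and $C^+$ be the pushouts in $\mathsf{Cat}$ $$C^-=C\sqcup_{n\cdot\mathbb{1}}(n\cdot\mathbb{1})^{\lhd},\qquad C^+=C\sqcup_{n\cdot\mathbb{1}}(n\cdot\mathbb{1})^{\rhd}$$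 of $y$ along the inclusions. Then $C^-$ and $C^+$ are strongly stably equivalent. -/

import Mathlib

open CategoryTheory Bicategory Limits Opposite
open scoped CategoryTheory.Pseudofunctor.StrongTrans

universe u v w

noncomputable section

namespace Deriv

/-! ### Prederivators -/

/-- A prederivator: a strict 2-functor `Catᵒᵖ → CAT`, where `Catᵒᵖ` reverses the functors but not
the natural transformations.  `Cat.{u, u}` is the 2-category of small categories; the values are
arbitrary (not necessarily small) categories. -/
structure Prederivator where
  /-- the underlying strict 2-functor -/
  toStrict : StrictPseudofunctor Cat.{u, u}ᵒᵖ Cat.{v, w}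

namespace Prederivator

/-- The underlying pseudofunctor of a prederivator. -/
abbrev ps (D : Prederivator.{u, v, w}) : Cat.{u, u}ᵒᵖ ⥤ᵖ Cat.{v, w} :=
  D.toStrict.toPseudofunctor

/-- The 2-category of prederivators: morphisms are pseudo-natural transformations, 2-morphisms are
modifications. -/
instance : Bicategory Prederivator.{u, v, w} where
  Hom D E := D.ps ⟶ E.ps
  id D := 𝟙 D.ps
  comp F G := Pseudofunctor.StrongTrans.vcomp F G
  homCategory D E := inferInstanceAs (Category (D.ps ⟶ E.ps))
  whiskerLeft {D E H} F _ _ η := Bicategory.whiskerLeft (a := D.ps) (b := E.ps) (c := H.ps) F η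
  whiskerRight {D E H} _ _ η G := Bicategory.whiskerRight (a := D.ps) (b := E.ps) (c := H.ps) η G
  associator {D E H K} F G L :=
    Bicategory.associator (a := D.ps) (b := E.ps) (c := H.ps) (d := K.ps) F G L
  leftUnitor {D E} F := Bicategory.leftUnitor (a := D.ps) (b := E.ps) F
  rightUnitor {D E} F := Bicategory.rightUnitor (a := D.ps) (b := E.ps) F
  whiskerLeft_id {D E H} := Bicategory.whiskerLeft_id (a := D.ps) (b := E.ps) (c := H.ps)
  whiskerLeft_comp {D E H} := Bicategory.whiskerLeft_comp (a := D.ps) (b := E.ps) (c := H.ps)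
  id_whiskerLeft {D E} := Bicategory.id_whiskerLeft (a := D.ps) (b := E.ps)
  comp_whiskerLeft {D E H K} :=
    Bicategory.comp_whiskerLeft (a := D.ps) (b := E.ps) (c := H.ps) (d := K.ps)
  id_whiskerRight {D E H} := Bicategory.id_whiskerRight (a := D.ps) (b := E.ps) (c := H.ps)
  comp_whiskerRight {D E H} := Bicategory.comp_whiskerRight (a := D.ps) (b := E.ps) (c := H.ps)
  whiskerRight_id {D E} := Bicategory.whiskerRight_id (a := D.ps) (b := E.ps)
  whiskerRight_comp {D E H K} :=
    Bicategory.whiskerRight_comp (a := D.ps) (b := E.ps) (c := H.ps) (d := K.ps)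
  whisker_assoc {D E H K} :=
    Bicategory.whisker_assoc (a := D.ps) (b := E.ps) (c := H.ps) (d := K.ps)
  whisker_exchange {D E H} := Bicategory.whisker_exchange (a := D.ps) (b := E.ps) (c := H.ps)
  pentagon {D E H K L} :=
    Bicategory.pentagon (a := D.ps) (b := E.ps) (c := H.ps) (d := K.ps) (e := L.ps)
  triangle {D E H} := Bicategory.triangle (a := D.ps) (b := E.ps) (c := H.ps)

section Restriction

variable (D : Prederivator.{u, v, w})

/-- The category `D(A)` of coherent diagrams of shape `A`. -/
abbrev diag (A : Type u) [Category.{u} A] : Cat.{v, w} := D.ps.obj (op (Cat.of A))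

variable {A : Type u} [Category.{u} A] {B : Type u} [Category.{u} B] {C : Type u} [Category.{u} C]
  {I : Type u} [Category.{u} I]

/-- The restriction functor `u^* : D(B) ⥤ D(A)` of `u : A ⥤ B`. -/
def res (u : A ⥤ B) : D.diag B ⥤ D.diag A := (D.ps.map u.toCatHom.op).toFunctor

/-- The natural transformation `u^* ⟶ v^*` induced by `α : u ⟶ v`. -/
def resTrans {u v : A ⥤ B} (α : u ⟶ v) : D.res u ⟶ D.res v :=
  (D.ps.map₂ (Bicategory.Opposite.op2 α.toCatHom₂)).toNatTrans

/-- `(u ⋙ v)^* = v^* ⋙ u^*`, as an isomorphism (it is the identity of an equality, since `D` is a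
strict 2-functor). -/
def resComp (u : A ⥤ B) (v : B ⥤ C) : D.res (u ⋙ v) ≅ D.res v ⋙ D.res u :=
  Cat.Hom.toNatIso (D.ps.mapComp v.toCatHom.op u.toCatHom.op)

/-- The 2-cell `u^* ⋙ p^* ⟶ v^* ⋙ q^*` that `D` assigns to a square `α : p ⋙ u ⟶ q ⋙ v` of small
categories. -/
def resSquare {p : I ⥤ A} {u : A ⥤ C} {q : I ⥤ B} {v : B ⥤ C} (α : p ⋙ u ⟶ q ⋙ v) :
    D.res u ⋙ D.res p ⟶ D.res v ⋙ D.res q :=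
  (D.resComp p u).inv ≫ D.resTrans α ≫ (D.resComp q v).hom

/-- For a square `α : p ⋙ u ⟶ q ⋙ v`, the canonical mate `q_! p^* ⟶ v^* u_!` is invertible
(for all left adjoints `u_!` of `u^*` and `q_!` of `q^*`). -/
def LeftMateIsIso {p : I ⥤ A} {u : A ⥤ C} {q : I ⥤ B} {v : B ⥤ C} (α : p ⋙ u ⟶ q ⋙ v) : Prop :=
  ∀ (u' : D.diag A ⥤ D.diag C) (adjU : u' ⊣ D.res u)
    (q' : D.diag I ⥤ D.diag B) (adjQ : q' ⊣ D.res q),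
    IsIso ((mateEquiv adjU adjQ).symm (TwoSquare.mk _ _ _ _ (D.resSquare α))).natTrans

/-- For a square `α : p ⋙ u ⟶ q ⋙ v`, the canonical mate `u^* v_* ⟶ p_* q^*` is invertible
(for all right adjoints `v_*` of `v^*` and `p_*` of `p^*`). -/
def RightMateIsIso {p : I ⥤ A} {u : A ⥤ C} {q : I ⥤ B} {v : B ⥤ C} (α : p ⋙ u ⟶ q ⋙ v) : Prop :=
  ∀ (v' : D.diag B ⥤ D.diag C) (adjV : D.res v ⊣ v')
    (p' : D.diag I ⥤ D.diag A) (adjP : D.res p ⊣ p'),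
    IsIso (mateEquiv adjV adjP (TwoSquare.mk _ _ _ _ (D.resSquare α))).natTrans

end Restriction

end Prederivator

/-! ### Derivators -/

/-- The terminal category. -/
abbrev One : Type u := Discrete PUnit.{u + 1}

/-- The functor `A ⥤ 1`. -/
abbrev toOne (A : Type u) [Category.{u} A] : A ⥤ One.{u} := (Functor.const A).obj ⟨⟨⟩⟩

/-- The functor `1 ⥤ A` classifying an object. -/
abbrev pt {A : Type u} [Category.{u} A] (a : A) : One.{u} ⥤ A := Functor.fromPUnit.{u} a

/-- The transformation `u ∘ p ⟶ b ∘ π` of the slice square of `(u/b)`. -/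
def overSquare {A B : Type u} [Category.{u} A] [Category.{u} B] (u : A ⥤ B) (b : B) :
    CostructuredArrow.proj u b ⋙ u ⟶ toOne (CostructuredArrow u b) ⋙ pt b where
  app x := x.hom
  naturality _ _ f := (CostructuredArrow.w f).trans (Category.comp_id _).symm

/-- The transformation `b ∘ π ⟶ u ∘ q` of the slice square of `(b/u)`. -/
def underSquare {A B : Type u} [Category.{u} A] [Category.{u} B] (u : A ⥤ B) (b : B) :
    toOne (StructuredArrow b u) ⋙ pt b ⟶ StructuredArrow.proj b u ⋙ u where
  app x := x.hom
  naturality _ _ f := (Category.id_comp _).trans (StructuredArrow.w f).symm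

namespace Prederivator

variable (D : Prederivator.{u, v, w})

/-- Derivators: prederivators satisfying (Der1)-(Der4). -/
structure IsDerivator : Prop where
  der1 : ∀ (I : Type u) (A : I → Type u) [∀ i, Category.{u} (A i)],
    (Functor.pi' (fun i => D.res (Sigma.incl (C := A) i))).IsEquivalence
  der2 : ∀ (A : Type u) [Category.{u} A] {X Y : D.diag A} (f : X ⟶ Y),
    IsIso f ↔ ∀ a : A, IsIso ((D.res (pt a)).map f)
  der3_left : ∀ {A B : Type u} [Category.{u} A] [Category.{u} B] (u : A ⥤ B),
    (D.res u).IsRightAdjoint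
  der3_right : ∀ {A B : Type u} [Category.{u} A] [Category.{u} B] (u : A ⥤ B),
    (D.res u).IsLeftAdjoint
  der4_left : ∀ {A B : Type u} [Category.{u} A] [Category.{u} B] (u : A ⥤ B) (b : B),
    D.LeftMateIsIso (overSquare u b)
  der4_right : ∀ {A B : Type u} [Category.{u} A] [Category.{u} B] (u : A ⥤ B) (b : B),
    D.RightMateIsIso (underSquare u b)

end Prederivator

/-! ### Stability -/

/-- The commutative square `[1] × [1]`, as a poset. -/
abbrev Sq : Type u := ULift.{u} (Fin 2 × Fin 2)

/-- The square without its final object. -/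
abbrev SqUL : Type u := {x : Sq.{u} // x.down ≠ (1, 1)}

/-- The square without its initial object. -/
abbrev SqLR : Type u := {x : Sq.{u} // x.down ≠ (0, 0)}

/-- The inclusion of the square without its final object. -/
def inclUL : SqUL.{u} ⥤ Sq.{u} := Monotone.functor (f := Subtype.val) (fun _ _ h => h)

/-- The inclusion of the square without its initial object. -/
def inclLR : SqLR.{u} ⥤ Sq.{u} := Monotone.functor (f := Subtype.val) (fun _ _ h => h)

namespace Prederivator

variable (D : Prederivator.{u, v, w})

/-- A square is cartesian if it is in the essential image of the right Kan extension from the square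
without its initial object. -/
def IsCartesian (X : D.diag Sq.{u}) : Prop :=
  ∃ (R : D.diag SqLR.{u} ⥤ D.diag Sq.{u}) (_ : D.res inclLR ⊣ R), R.essImage X

/-- A square is cocartesian if it is in the essential image of the left Kan extension from the
square without its final object. -/
def IsCocartesian (X : D.diag Sq.{u}) : Prop :=
  ∃ (L : D.diag SqUL.{u} ⥤ D.diag Sq.{u}) (_ : L ⊣ D.res inclUL), L.essImage X

end Prederivator

/-- A stable derivator: a derivator whose underlying category has a zero object and in which a
square is cartesian if and only if it is cocartesian. -/
structure StableDerivator extends Prederivator.{u, v, w} where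
  isDerivator : toPrederivator.IsDerivator
  hasZeroObject : HasZeroObject (toPrederivator.diag One.{u})
  cartesian_iff : ∀ X, toPrederivator.IsCartesian X ↔ toPrederivator.IsCocartesian X

namespace Prederivator

variable {D E H : Prederivator.{u, v, w}}

/-- The component `D(A) ⥤ E(A)` of a morphism of prederivators. -/
abbrev appF (F : D ⟶ E) (A : Type u) [Category.{u} A] : D.diag A ⥤ E.diag A :=
  (Pseudofunctor.StrongTrans.app (F := D.ps) (G := E.ps) F (op (Cat.of A))).toFunctor

/-- Preservation of initial objects and cocartesian squares. -/
structure IsRightExact (F : D ⟶ E) : Prop where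
  initial : ∀ X : D.diag One.{u}, Nonempty (IsInitial X) →
    Nonempty (IsInitial ((appF F One.{u}).obj X))
  cocartesian : ∀ X : D.diag Sq.{u}, D.IsCocartesian X → E.IsCocartesian ((appF F Sq.{u}).obj X)

/-- Preservation of terminal objects and cartesian squares. -/
structure IsLeftExact (F : D ⟶ E) : Prop where
  terminal : ∀ X : D.diag One.{u}, Nonempty (IsTerminal X) →
    Nonempty (IsTerminal ((appF F One.{u}).obj X))
  cartesian : ∀ X : D.diag Sq.{u}, D.IsCartesian X → E.IsCartesian ((appF F Sq.{u}).obj X)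

/-- Exact morphisms. -/
def IsExact (F : D ⟶ E) : Prop := IsRightExact F ∧ IsLeftExact F

theorem IsExact.id (D : Prederivator.{u, v, w}) : IsExact (𝟙 D) :=
  ⟨⟨fun _ h => h, fun _ h => h⟩, ⟨fun _ h => h, fun _ h => h⟩⟩

theorem IsExact.comp {F : D ⟶ E} {G : E ⟶ H} (hF : IsExact F) (hG : IsExact G) :
    IsExact (F ≫ G) :=
  ⟨⟨fun X h => hG.1.initial _ (hF.1.initial X h),
    fun X h => hG.1.cocartesian _ (hF.1.cocartesian X h)⟩,
   ⟨fun X h => hG.2.terminal _ (hF.2.terminal X h),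
    fun X h => hG.2.cartesian _ (hF.2.cartesian X h)⟩⟩

end Prederivator

namespace StableDerivator

/-- Exact morphisms of stable derivators. -/
structure Hom (D E : StableDerivator.{u, v, w}) where
  /-- the underlying morphism of prederivators -/
  hom : D.toPrederivator ⟶ E.toPrederivator
  exact : Prederivator.IsExact hom

/-- Transformations between exact morphisms: arbitrary modifications. -/
@[ext]
structure Hom₂ {D E : StableDerivator.{u, v, w}} (F G : Hom D E) where
  /-- the underlying modification -/
  hom : F.hom ⟶ G.hom

instance (D E : StableDerivator.{u, v, w}) : Category (Hom D E) where
  Hom F G := Hom₂ F G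
  id F := ⟨𝟙 F.hom⟩
  comp η θ := ⟨η.hom ≫ θ.hom⟩
  id_comp η := Hom₂.ext (Category.id_comp η.hom)
  comp_id η := Hom₂.ext (Category.comp_id η.hom)
  assoc η θ κ := Hom₂.ext (Category.assoc η.hom θ.hom κ.hom)

/-- Invertible transformations between exact morphisms. -/
def isoMk {D E : StableDerivator.{u, v, w}} {F G : Hom D E} (e : F.hom ≅ G.hom) : F ≅ G where
  hom := ⟨e.hom⟩
  inv := ⟨e.inv⟩
  hom_inv_id := Hom₂.ext e.hom_inv_id
  inv_hom_id := Hom₂.ext e.inv_hom_id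

/-- The 2-category of stable derivators, exact morphisms and all transformations. -/
instance : Bicategory StableDerivator.{u, v, w} where
  Hom D E := Hom D E
  id D := ⟨𝟙 D.toPrederivator, .id _⟩
  comp F G := ⟨F.hom ≫ G.hom, F.exact.comp G.exact⟩
  homCategory D E := inferInstanceAs (Category (Hom D E))
  whiskerLeft F _ _ η := ⟨F.hom ◁ η.hom⟩
  whiskerRight η G := ⟨η.hom ▷ G.hom⟩
  associator F G L := isoMk (α_ F.hom G.hom L.hom)
  leftUnitor F := isoMk (λ_ F.hom)
  rightUnitor F := isoMk (ρ_ F.hom)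
  whiskerLeft_id _ _ := Hom₂.ext (Bicategory.whiskerLeft_id _ _)
  whiskerLeft_comp _ _ _ _ _ _ := Hom₂.ext (Bicategory.whiskerLeft_comp _ _ _)
  id_whiskerLeft _ := Hom₂.ext (Bicategory.id_whiskerLeft _)
  comp_whiskerLeft _ _ _ _ _ := Hom₂.ext (Bicategory.comp_whiskerLeft _ _ _)
  id_whiskerRight _ _ := Hom₂.ext (Bicategory.id_whiskerRight _ _)
  comp_whiskerRight _ _ _ := Hom₂.ext (Bicategory.comp_whiskerRight _ _ _)
  whiskerRight_id _ := Hom₂.ext (Bicategory.whiskerRight_id _)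
  whiskerRight_comp _ _ _ := Hom₂.ext (Bicategory.whiskerRight_comp _ _ _)
  whisker_assoc _ _ _ _ _ := Hom₂.ext (Bicategory.whisker_assoc _ _ _)
  whisker_exchange _ _ := Hom₂.ext (Bicategory.whisker_exchange _ _)
  pentagon _ _ _ _ := Hom₂.ext (Bicategory.pentagon _ _ _ _)
  triangle _ _ := Hom₂.ext (Bicategory.triangle _ _)

/-- The inclusion of stable derivators and exact morphisms into prederivators. -/
def forget : StableDerivator.{u, v, w} ⥤ᵖ Prederivator.{u, v, w} where
  obj D := D.toPrederivator
  map F := F.hom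
  map₂ η := η.hom
  map₂_id _ := rfl
  map₂_comp _ _ := rfl
  mapId _ := Iso.refl _
  mapComp _ _ := Iso.refl _
  map₂_whisker_left _ _ _ _ := ((Category.id_comp _).trans (Category.comp_id _)).symm
  map₂_whisker_right _ _ := ((Category.id_comp _).trans (Category.comp_id _)).symm
  map₂_associator F G L := by
    change (α_ F.hom G.hom L.hom).hom = 𝟙 ((F.hom ≫ G.hom) ≫ L.hom) ≫
      𝟙 (F.hom ≫ G.hom) ▷ L.hom ≫ (α_ F.hom G.hom L.hom).hom ≫ F.hom ◁ 𝟙 (G.hom ≫ L.hom) ≫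
      𝟙 (F.hom ≫ G.hom ≫ L.hom)
    simp
  map₂_left_unitor {D E} F := by
    change (λ_ F.hom).hom = 𝟙 (𝟙 D.toPrederivator ≫ F.hom) ≫
      𝟙 (𝟙 D.toPrederivator) ▷ F.hom ≫ (λ_ F.hom).hom
    simp
  map₂_right_unitor {D E} F := by
    change (ρ_ F.hom).hom = 𝟙 (F.hom ≫ 𝟙 E.toPrederivator) ≫
      F.hom ◁ 𝟙 (𝟙 E.toPrederivator) ≫ (ρ_ F.hom).hom
    simp

end StableDerivator

/-! ### Exponentiation -/

/-- The strict 2-functor `A ↦ B × A` on `Catᵒᵖ`. -/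
def prodLeft (B : Cat.{u, u}) : StrictPseudofunctor Cat.{u, u}ᵒᵖ Cat.{u, u}ᵒᵖ :=
  StrictPseudofunctor.mk'
    { obj A := op (Cat.of (B × A.unop))
      map f := ((𝟭 B).prod f.unop.toFunctor).toCatHom.op
      map₂ η := Bicategory.Opposite.op2
        (NatTrans.prod (𝟙 (𝟭 B)) η.unop2.toNatTrans).toCatHom₂
      map₂_id _ := rfl
      map₂_comp _ _ := by
        refine congrArg (fun t => Bicategory.Opposite.op2 (NatTrans.toCatHom₂ t)) ?_
        ext x
        · exact (Category.id_comp _).symm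
        · rfl
      map_id _ := rfl
      map_comp _ _ := rfl
      map₂_whisker_left _ _ _ _ := by
        refine Eq.trans ?_ ((Category.id_comp _).trans (Category.comp_id _)).symm
        rfl
      map₂_whisker_right _ _ := by
        refine Eq.trans ?_ ((Category.id_comp _).trans (Category.comp_id _)).symm
        rfl
      map₂_left_unitor _ := by
        refine Eq.trans ?_ (Category.id_comp _).symm
        rfl
      map₂_right_unitor _ := by
        refine Eq.trans ?_ (Category.id_comp _).symm
        rfl
      map₂_associator _ _ _ := by
        refine Eq.trans ?_ ((Category.id_comp _).trans (Category.comp_id _)).symm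
        rfl }

section Whisker

universe w₁ w₂ w₃ v₁ v₂ v₃ u₁ u₂ u₃

variable {B : Type u₁} [Bicategory.{w₁, v₁} B] {C : Type u₂} [Bicategory.{w₂, v₂} C]
  {D : Type u₃} [Bicategory.{w₃, v₃} D]

/-- Precomposition of a pseudo-natural transformation with a pseudofunctor. -/
def precompTrans (P : B ⥤ᵖ C) {F G : C ⥤ᵖ D} (η : F ⟶ G) : P.comp F ⟶ P.comp G where
  app b := η.app (P.obj b)
  naturality f := η.naturality (P.map f)
  naturality_naturality θ := η.naturality_naturality (P.map₂ θ)
  naturality_id b := by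
    have h₁ := η.naturality_naturality (P.mapId b).hom
    have h₂ := η.naturality_id (P.obj b)
    change (η.naturality (P.map (𝟙 b))).hom ≫
        η.app (P.obj b) ◁ (G.map₂ (P.mapId b).hom ≫ (G.mapId (P.obj b)).hom) =
      (F.map₂ (P.mapId b).hom ≫ (F.mapId (P.obj b)).hom) ▷ η.app (P.obj b) ≫
        (λ_ (η.app (P.obj b))).hom ≫ (ρ_ (η.app (P.obj b))).inv
    rw [Bicategory.whiskerLeft_comp, Bicategory.comp_whiskerRight, Category.assoc, ← h₂,
      reassoc_of% h₁]
  naturality_comp f g := by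
    have h₁ := η.naturality_naturality (P.mapComp f g).hom
    have h₂ := η.naturality_comp (P.map f) (P.map g)
    change (η.naturality (P.map (f ≫ g))).hom ≫
        η.app (P.obj _) ◁ (G.map₂ (P.mapComp f g).hom ≫ (G.mapComp (P.map f) (P.map g)).hom) =
      (F.map₂ (P.mapComp f g).hom ≫ (F.mapComp (P.map f) (P.map g)).hom) ▷ η.app (P.obj _) ≫
        (α_ _ _ _).hom ≫ F.map (P.map f) ◁ (η.naturality (P.map g)).hom ≫
        (α_ _ _ _).inv ≫ (η.naturality (P.map f)).hom ▷ G.map (P.map g) ≫ (α_ _ _ _).hom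
    rw [Bicategory.whiskerLeft_comp, Bicategory.comp_whiskerRight, Category.assoc, ← h₂,
      reassoc_of% h₁]

/-- Precomposition of a modification with a pseudofunctor. -/
def precompMod (P : B ⥤ᵖ C) {F G : C ⥤ᵖ D} {η θ : F ⟶ G} (Γ : η ⟶ θ) :
    precompTrans P η ⟶ precompTrans P θ where
  as := { app b := Γ.as.app (P.obj b)
          naturality f := Γ.as.naturality (P.map f) }

/-- Precomposition with a pseudofunctor, as a pseudofunctor. -/
def precomp (P : B ⥤ᵖ C) : (C ⥤ᵖ D) ⥤ᵖ (B ⥤ᵖ D) where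
  obj F := P.comp F
  map η := precompTrans P η
  map₂ Γ := precompMod P Γ
  map₂_id _ := rfl
  map₂_comp _ _ := rfl
  mapId F := Pseudofunctor.StrongTrans.isoMk (fun _ => Iso.refl _) (fun f => by
    change F.map (P.map f) ◁ 𝟙 _ ≫ ((𝟙 F : F ⟶ F).naturality (P.map f)).hom =
      ((𝟙 F : F ⟶ F).naturality (P.map f)).hom ≫ 𝟙 _ ▷ F.map (P.map f)
    rw [Bicategory.whiskerLeft_id, Bicategory.id_whiskerRight, Category.id_comp,
      Category.comp_id])
  mapComp {F G H} η θ := Pseudofunctor.StrongTrans.isoMk (fun _ => Iso.refl _) (fun f => by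
    change F.map (P.map f) ◁ 𝟙 _ ≫ ((η ≫ θ).naturality (P.map f)).hom =
      ((η ≫ θ).naturality (P.map f)).hom ≫ 𝟙 _ ▷ H.map (P.map f)
    rw [Bicategory.whiskerLeft_id, Bicategory.id_whiskerRight, Category.id_comp,
      Category.comp_id])
  map₂_whisker_left _ _ _ _ := by
    ext b
    exact ((Category.id_comp _).trans (Category.comp_id _)).symm
  map₂_whisker_right _ _ := by
    ext b
    exact ((Category.id_comp _).trans (Category.comp_id _)).symm
  map₂_associator η θ κ := by
    ext b
    change (α_ (η.app (P.obj b)) (θ.app (P.obj b)) (κ.app (P.obj b))).hom = 𝟙 _ ≫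
      𝟙 _ ▷ κ.app (P.obj b) ≫ (α_ (η.app (P.obj b)) (θ.app (P.obj b)) (κ.app (P.obj b))).hom ≫
        η.app (P.obj b) ◁ 𝟙 _ ≫ 𝟙 _
    simp
  map₂_left_unitor {F _} η := by
    ext b
    change (λ_ (η.app (P.obj b))).hom = 𝟙 _ ≫
      𝟙 (𝟙 (F.obj (P.obj b))) ▷ η.app (P.obj b) ≫ (λ_ (η.app (P.obj b))).hom
    simp
  map₂_right_unitor {_ G} η := by
    ext b
    change (ρ_ (η.app (P.obj b))).hom = 𝟙 _ ≫
      η.app (P.obj b) ◁ 𝟙 (𝟙 (G.obj (P.obj b))) ≫ (ρ_ (η.app (P.obj b))).hom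
    simp

end Whisker

namespace Prederivator

/-- The prederivator `D^B : A ↦ D(B × A)` of coherent diagrams of shape `B`. -/
def pow (D : Prederivator.{u, v, w}) (B : Cat.{u, u}) : Prederivator.{u, v, w} :=
  ⟨(prodLeft B).comp D.toStrict⟩

/-- The 2-functor `(-)^B` on prederivators. -/
def powFunctor (B : Cat.{u, u}) : Prederivator.{u, v, w} ⥤ᵖ Prederivator.{u, v, w} where
  obj D := D.pow B
  map F := precompTrans (prodLeft B).toPseudofunctor F
  map₂ Γ := precompMod (prodLeft B).toPseudofunctor Γ
  map₂_id _ := rfl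
  map₂_comp _ _ := rfl
  mapId D := (precomp (prodLeft B).toPseudofunctor).mapId D.ps
  mapComp F G := (precomp (prodLeft B).toPseudofunctor).mapComp (F : _ ⟶ _) G
  map₂_whisker_left _ _ _ _ := (precomp (prodLeft B).toPseudofunctor).map₂_whisker_left _ _
  map₂_whisker_right _ _ := (precomp (prodLeft B).toPseudofunctor).map₂_whisker_right _ _
  map₂_associator _ _ _ := (precomp (prodLeft B).toPseudofunctor).map₂_associator _ _ _
  map₂_left_unitor _ := (precomp (prodLeft B).toPseudofunctor).map₂_left_unitor _
  map₂_right_unitor _ := (precomp (prodLeft B).toPseudofunctor).map₂_right_unitor _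

end Prederivator

/-- The 2-functor `(-)^B` from stable derivators and exact morphisms to prederivators. -/
def stablePow (B : Cat.{u, u}) : StableDerivator.{u, v, w} ⥤ᵖ Prederivator.{u, v, w} :=
  StableDerivator.forget.comp (Prederivator.powFunctor B)

/-- Strong stable equivalence of small categories `A` and `A'`: there is a pseudo-natural
transformation `Φ : (-)^A ⟶ (-)^A'` of 2-functors on stable derivators, exact morphisms and
transformations, each component of which is an equivalence `D^A ≌ D^A'`.  (Derivators form a full
sub-2-category of prederivators, so equivalences in the two 2-categories are the same.) -/
def StronglyStablyEquivalent (A A' : Cat.{u, u}) : Prop :=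
  ∃ Φ : Pseudofunctor.StrongTrans (stablePow.{u, v, w} A) (stablePow.{u, v, w} A'),
    ∀ D : StableDerivator.{u, v, w},
      ∃ e : (stablePow.{u, v, w} A).obj D ≌ (stablePow.{u, v, w} A').obj D, e.hom = Φ.app D

/-! ### Attaching a source or a sink -/

/-- The discrete category on `n` objects. -/
abbrev Disc (n : ℕ) : Type u := Discrete (ULift.{u} (Fin n))

/-- The functor from the discrete category classifying a list of objects. -/
def listFunctor {C : Cat.{u, u}} {n : ℕ} (y : Fin n → C) : Cat.of (Disc.{u} n) ⟶ C where
  toFunctor := Discrete.functor (fun i => y i.down)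

/-- The source of valence `n`: the discrete category with an initial object adjoined. -/
abbrev source (n : ℕ) : Cat.{u, u} := Cat.of (WithInitial (Disc.{u} n))

/-- The sink of valence `n`: the discrete category with a terminal object adjoined. -/
abbrev sink (n : ℕ) : Cat.{u, u} := Cat.of (WithTerminal (Disc.{u} n))

/-- The inclusion of the discrete category into the source. -/
def toSource (n : ℕ) : Cat.of (Disc.{u} n) ⟶ source.{u} n := WithInitial.incl.toCatHom

/-- The inclusion of the discrete category into the sink. -/
def toSink (n : ℕ) : Cat.of (Disc.{u} n) ⟶ sink.{u} n := WithTerminal.incl.toCatHom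

end Deriv
end

/-!
Attaching a source and attaching a sink to the objects `y i` of `C` give strongly stably equivalent
categories, because in a stable derivator a coherent diagram on either category is the trace of one
and the same kind of larger diagram.

The larger shape is the bridge category `Deriv.Bridge y`. It has two copies `lo c` and `hi c` of
every object of `C`, an object `o`, and a square with corners `sq (i, j)`. Its full subcategory on
the objects `lo c` and `sq (1, 1)` is `C` with a sink attached (`Deriv.Bridge.isPushout_sinkEnd`),
the one on the objects `hi c` and `sq (0, 0)` is `C` with a source attached
(`Deriv.Bridge.isPushout_sourceEnd`), and the two are joined through `sq (0, 1)`, which has an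
arrow from each `lo (y i)` and an arrow to each `hi (y i)`. The composite `lo (y i) ⟶ hi (y j)` is
the identity of `y i` if `i = j`, and otherwise factors through `o`.

A bridge diagram (`Deriv.Prederivator.IsBridge`) vanishes at `o` and at `sq (1, 0)`, has invertible
arrows `lo c ⟶ hi c`, the product of the values at the `hi (y i)` at `sq (0, 1)`, and a cartesian
square. So a map `⨁ X (y i) ⟶ S` out of the sum is traded for the map `F ⟶ ⨁ X (y i)` from its
fibre, and conversely. These conditions are self-dual. The value at `sq (0, 1)` is equally the
coproduct of the values at the `lo (y i)`, as the matrix of composites `lo (y i) ⟶ hi (y j)` is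
diagonal with invertible diagonal entries and finite products are biproducts
(`Deriv.StableDerivator.isCoproductFamily_iff_isProductFamily`, which rests on
`Deriv.StableDerivator.hasBinaryBiproducts`); and the square is equally cocartesian by stability.

Starting from the sink end, a bridge diagram is therefore built by a right Kan extension adding the
zero object `o`, a left Kan extension adding the objects `hi c`, the sum and the zero corner, and a
right Kan extension adding the fibre (`Deriv.StableDerivator.isBridge_iff_sink`); starting from the
source end, it is built by the dual sequence (`Deriv.StableDerivator.isBridge_iff_source`). All
these extensions are along fully faithful functors, so that restriction of bridge diagrams to
either end is an equivalence (`Deriv.isEquivalence_bridge_sink`,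
`Deriv.isEquivalence_bridge_source`). That the extensions have the stated values is the slice
formula (`Deriv.Prederivator.IsDerivator.isLKan_iff` and its dual), where the slices are replaced
by smaller final families (`Deriv.Prederivator.IsDerivator.isColim_overSquare_iff` and its dual).

Diagrams with parameters in `A` are treated pointwise
(`Deriv.Prederivator.IsDerivator.isLKan_prod_iff`). As the bridge condition is stable under exact
morphisms and under change of parameters (`Deriv.bridgeProperty`), the bridge diagrams form a
2-functor of the stable derivator, and the restrictions to both ends are pseudo-natural. A
pseudo-natural transformation whose components are equivalences is an equivalence, so the two
restrictions combine to the required one (`Deriv.stronglyStablyEquivalent_of_restriction`).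
-/

noncomputable section

/-! ### Inverting pseudo-natural transformations -/

namespace CategoryTheory.Bicategory

universe w₁ v₁ u₁

variable {B : Type u₁} [Bicategory.{w₁, v₁} B]

/-- The adjunction underlying an adjoint equivalence. -/
def Equivalence.toAdjunction {a b : B} (e : a ≌ b) : Adjunction e.hom e.inv where
  unit := e.unit.hom
  counit := e.counit.hom
  left_triangle := e.left_triangle_hom
  right_triangle := e.right_triangle_hom

/-- Equivalences compose. -/
def Equivalence.trans {a b c : B} (e : a ≌ b) (e' : b ≌ c) : a ≌ c :=
  .mkOfAdjointifyCounit (f := e.hom ≫ e'.hom) (g := e'.inv ≫ e.inv)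
    (e.unit ≪≫ whiskerLeftIso e.hom ((λ_ _).symm ≪≫ whiskerRightIso e'.unit e.inv ≪≫ α_ _ _ _) ≪≫
      (α_ _ _ _).symm)
    (α_ _ _ _ ≪≫ whiskerLeftIso e'.inv ((α_ _ _ _).symm ≪≫ whiskerRightIso e.counit e'.hom ≪≫
      λ_ _) ≪≫ e'.counit)

/-- The inverse of an equivalence. -/
def Equivalence.symm {a b : B} (e : a ≌ b) : b ≌ a :=
  .mkOfAdjointifyCounit (f := e.inv) (g := e.hom) e.counit.symm e.unit.symm

/-! The naturality of mates in the outer sides of the square, and their compatibility with units and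
counits, turn each axiom for a pseudo-natural transformation into the same axiom for its inverse. -/

section Mate

variable {c d e f : B} {g g' : c ⟶ e} {h h' : d ⟶ f} {l₁ : c ⟶ d} {r₁ : d ⟶ c} {l₂ : e ⟶ f}
  {r₂ : f ⟶ e} (adj₁ : Adjunction l₁ r₁) (adj₂ : Adjunction l₂ r₂)

theorem mateEquiv_whiskerRight_comp (u : g' ⟶ g) (α : g ≫ l₂ ⟶ l₁ ≫ h) :
    mateEquiv adj₁ adj₂ (u ▷ l₂ ≫ α) = r₁ ◁ u ≫ mateEquiv adj₁ adj₂ α := by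
  simp only [mateEquiv_apply']
  calc
    _ = 𝟙 _ ⊗≫ r₁ ◁ (g' ◁ adj₂.unit ≫ u ▷ (l₂ ≫ r₂)) ⊗≫ r₁ ◁ α ▷ r₂ ⊗≫
        adj₁.counit ▷ h ▷ r₂ ⊗≫ 𝟙 _ := by bicategory
    _ = _ := by rw [whisker_exchange]; bicategory

theorem mateEquiv_comp_whiskerLeft (α : g ≫ l₂ ⟶ l₁ ≫ h) (u : h ⟶ h') :
    mateEquiv adj₁ adj₂ (α ≫ l₁ ◁ u) = mateEquiv adj₁ adj₂ α ≫ u ▷ r₂ := by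
  simp only [mateEquiv_apply']
  calc
    _ = 𝟙 _ ⊗≫ r₁ ◁ g ◁ adj₂.unit ⊗≫ r₁ ◁ α ▷ r₂ ⊗≫ ((r₁ ≫ l₁) ◁ u ≫
        adj₁.counit ▷ h') ▷ r₂ ⊗≫ 𝟙 _ := by bicategory
    _ = _ := by rw [whisker_exchange]; bicategory

/-- Taking mates preserves identity squares, up to unitors. -/
theorem mateEquiv_unitors :
    mateEquiv adj₁ adj₁ ((λ_ l₁).hom ≫ (ρ_ l₁).inv) = (ρ_ r₁).hom ≫ (λ_ r₁).inv := by
  rw [mateEquiv_apply', ← adj₁.right_triangle]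
  bicategory

theorem unit_comp_mateEquiv (α : g ≫ l₂ ⟶ l₁ ≫ h) :
    (λ_ g).inv ≫ adj₁.unit ▷ g ≫ (α_ _ _ _).hom ≫ l₁ ◁ mateEquiv adj₁ adj₂ α =
      (ρ_ g).inv ≫ g ◁ adj₂.unit ≫ (α_ _ _ _).inv ≫ α ▷ r₂ ≫ (α_ _ _ _).hom := by
  have := (mateEquiv_eq_iff adj₁ adj₂ α _).mp rfl
  rw [Adjunction.homEquiv₁_symm_apply, Adjunction.homEquiv₂_apply] at this
  simpa using this

theorem mateEquiv_comp_counit (α : g ≫ l₂ ⟶ l₁ ≫ h) :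
    mateEquiv adj₁ adj₂ α ▷ l₂ ≫ (α_ _ _ _).hom ≫ h ◁ adj₂.counit ≫ (ρ_ h).hom =
      (α_ _ _ _).hom ≫ r₁ ◁ α ≫ (α_ _ _ _).inv ≫ adj₁.counit ▷ h ≫ (λ_ h).hom := by
  have h1 : mateEquiv adj₁ adj₂ α =
      adj₂.homEquiv₂ ((α_ _ _ _).hom ≫ adj₁.homEquiv₁ α) := by
    rw [mateEquiv_apply', Adjunction.homEquiv₁_apply, Adjunction.homEquiv₂_apply]
    bicategory
  have := (Equiv.symm_apply_eq _).mpr h1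
  rw [Adjunction.homEquiv₂_symm_apply, Adjunction.homEquiv₁_apply] at this
  simpa using this

end Mate

/-- If the two adjunctions are adjoint equivalences, the mate of an invertible 2-morphism is
invertible. -/
theorem isIso_mateEquiv {c d e f : B} {g : c ⟶ e} {h : d ⟶ f} {l₁ : c ⟶ d} {r₁ : d ⟶ c}
    {l₂ : e ⟶ f} {r₂ : f ⟶ e} (adj₁ : Adjunction l₁ r₁) (adj₂ : Adjunction l₂ r₂)
    [IsIso adj₁.counit] [IsIso adj₂.unit] (α : g ≫ l₂ ⟶ l₁ ≫ h) [IsIso α] :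
    IsIso (mateEquiv adj₁ adj₂ α) := by
  rw [mateEquiv_apply']
  simp only [bicategoricalComp]
  infer_instance

end CategoryTheory.Bicategory

namespace CategoryTheory.Pseudofunctor.StrongTrans

universe w₁ w₂ v₁ v₂ u₁ u₂

variable {B : Type u₁} [Bicategory.{w₁, v₁} B] {C : Type u₂} [Bicategory.{w₂, v₂} C]
  {F G : B ⥤ᵖ C}

section Inverse

variable (η : F ⟶ G) (inv : ∀ b, G.obj b ⟶ F.obj b)
  (adj : ∀ b, Bicategory.Adjunction (η.app b) (inv b))
  [∀ b, IsIso (adj b).unit] [∀ b, IsIso (adj b).counit]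

/-- The naturality isomorphisms of the inverse of a pointwise equivalence: the inverses of the
mates of the naturality isomorphisms. -/
def inverseNaturality {a b : B} (f : a ⟶ b) : G.map f ≫ inv b ≅ inv a ≫ F.map f :=
  haveI := isIso_mateEquiv (adj a) (adj b) (η.naturality f).hom
  (asIso (Bicategory.mateEquiv (adj a) (adj b) (η.naturality f).hom)).symm

theorem inverseNaturality_inv {a b : B} (f : a ⟶ b) :
    (inverseNaturality η inv adj f).inv =
      Bicategory.mateEquiv (adj a) (adj b) (η.naturality f).hom := rfl

/-- The pseudo-natural transformation formed by the inverses of a pointwise equivalence. -/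
def inverse : G ⟶ F where
  app := inv
  naturality f := inverseNaturality η inv adj f
  naturality_naturality {a b f g} τ := by
    rw [← Iso.inv_comp_eq, ← Category.assoc, ← Iso.eq_comp_inv, inverseNaturality_inv,
      inverseNaturality_inv, ← mateEquiv_comp_whiskerLeft, ← mateEquiv_whiskerRight_comp,
      η.naturality_naturality]
  naturality_id a := by
    rw [← Iso.eq_inv_comp, inverseNaturality_inv]
    have h : Bicategory.mateEquiv (adj a) (adj a) (η.naturality (𝟙 a)).hom ≫
        (G.mapId a).hom ▷ inv a =
        inv a ◁ (F.mapId a).hom ≫ (ρ_ _).hom ≫ (λ_ _).inv := by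
      rw [← mateEquiv_comp_whiskerLeft, η.naturality_id, mateEquiv_whiskerRight_comp,
        mateEquiv_unitors]
    rw [reassoc_of% h]
    simp
  naturality_comp {a b c} f g := by
    rw [← Iso.eq_inv_comp, inverseNaturality_inv]
    have h : Bicategory.mateEquiv (adj a) (adj c) (η.naturality (f ≫ g)).hom ≫
        (G.mapComp f g).hom ▷ inv c =
        inv a ◁ (F.mapComp f g).hom ≫ rightAdjointSquare.vcomp
          (Bicategory.mateEquiv (adj a) (adj b) (η.naturality f).hom)
          (Bicategory.mateEquiv (adj b) (adj c) (η.naturality g).hom) := by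
      rw [← mateEquiv_comp_whiskerLeft, η.naturality_comp, mateEquiv_whiskerRight_comp,
        ← Bicategory.mateEquiv_vcomp]
      rfl
    rw [reassoc_of% h, ← inverseNaturality_inv, ← inverseNaturality_inv]
    simp [rightAdjointSquare.vcomp]

/-- The unit of the inverse of a pointwise equivalence. -/
def inverseUnit : 𝟙 F ≅ η ≫ inverse η inv adj :=
  isoMk (fun b => (asIso (adj b).unit : 𝟙 (F.obj b) ≅ η.app b ≫ inv b)) (fun {a b} f => by
    have h := unit_comp_mateEquiv (adj a) (adj b) (η.naturality f).hom
    rw [← inverseNaturality_inv] at h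
    have h2 : (λ_ (F.map f)).inv ≫ (adj a).unit ▷ F.map f ≫ (α_ _ _ _).hom =
        ((ρ_ (F.map f)).inv ≫ F.map f ◁ (adj b).unit ≫ (α_ _ _ _).inv ≫
          (η.naturality f).hom ▷ inv b ≫ (α_ _ _ _).hom) ≫
          η.app a ◁ (inverseNaturality η inv adj f).hom := by
      rw [← h]
      simp
    change F.map f ◁ (adj b).unit ≫ (α_ _ _ _).inv ≫ (η.naturality f).hom ▷ inv b ≫
      (α_ _ _ _).hom ≫ η.app a ◁ (inverseNaturality η inv adj f).hom ≫ (α_ _ _ _).inv =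
      ((ρ_ (F.map f)).hom ≫ (λ_ (F.map f)).inv) ≫ (adj a).unit ▷ F.map f
    rw [← cancel_epi (ρ_ (F.map f)).inv, ← cancel_mono (α_ _ _ _).hom]
    simp only [Category.assoc] at h2 ⊢
    simp [h2])

/-- The counit of the inverse of a pointwise equivalence. -/
def inverseCounit : inverse η inv adj ≫ η ≅ 𝟙 G :=
  isoMk (fun b => (asIso (adj b).counit : inv b ≫ η.app b ≅ 𝟙 (G.obj b))) (fun {a b} f => by
    have h := mateEquiv_comp_counit (adj a) (adj b) (η.naturality f).hom
    rw [← inverseNaturality_inv] at h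
    change G.map f ◁ (adj b).counit ≫ (ρ_ (G.map f)).hom ≫ (λ_ (G.map f)).inv =
      ((α_ _ _ _).inv ≫ (inverseNaturality η inv adj f).hom ▷ η.app b ≫
      (α_ _ _ _).hom ≫ inv a ◁ (η.naturality f).hom ≫ (α_ _ _ _).inv) ≫
      (adj a).counit ▷ G.map f
    rw [← cancel_mono (λ_ (G.map f)).hom]
    simp only [Category.assoc]
    rw [← cancel_epi ((inverseNaturality η inv adj f).inv ▷ η.app b ≫ (α_ _ _ _).hom)]
    simp only [Category.assoc, Iso.inv_hom_id, Category.comp_id]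
    rw [h]
    simp)

end Inverse

/-- A pseudo-natural transformation whose components are equivalences is an equivalence. -/
theorem exists_equivalence (η : F ⟶ G) (h : ∀ b, ∃ e : F.obj b ≌ G.obj b, e.hom = η.app b) :
    ∃ e : F ≌ G, e.hom = η := by
  have h' : ∀ b, ∃ (g : G.obj b ⟶ F.obj b) (adj : Bicategory.Adjunction (η.app b) g),
      IsIso adj.unit ∧ IsIso adj.counit := fun b => by
    obtain ⟨e, he⟩ := h b
    rw [← he]
    exact ⟨e.inv, e.toAdjunction, inferInstanceAs (IsIso e.unit.hom),
      inferInstanceAs (IsIso e.counit.hom)⟩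
  choose inv adj h₁ h₂ using h'
  exact ⟨.mkOfAdjointifyCounit (inverseUnit η inv adj) (inverseCounit η inv adj), rfl⟩

/-- The components of an isomorphism of pseudo-natural transformations. -/
def isoApp {η θ : F ⟶ G} (e : η ≅ θ) (b : B) : η.app b ≅ θ.app b where
  hom := e.hom.as.app b
  inv := e.inv.as.app b
  hom_inv_id := congrArg (fun t : η ⟶ η => t.as.app b) e.hom_inv_id
  inv_hom_id := congrArg (fun t : θ ⟶ θ => t.as.app b) e.inv_hom_id

/-- The components of an equivalence of pseudofunctors. -/
def equivalenceApp (e : F ≌ G) (b : B) : F.obj b ≌ G.obj b :=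
  .mkOfAdjointifyCounit (f := e.hom.app b) (g := e.inv.app b) (isoApp e.unit b) (isoApp e.counit b)

end CategoryTheory.Pseudofunctor.StrongTrans

/-! ### Full subfunctors of pseudofunctors to categories -/

namespace CategoryTheory.Pseudofunctor

universe w₁ v₁ u₁

variable {B : Type u₁} [Bicategory.{w₁, v₁} B] {F G H : B ⥤ᵖ Cat.{v, w}}

/-- A property of the objects of the values of `F` that is stable under the functors `F.map f`. -/
structure StableProperty (F : B ⥤ᵖ Cat.{v, w}) where
  /-- the property of the objects of `F.obj b` -/
  prop (b : B) : ObjectProperty (F.obj b)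
  map {a b : B} (f : a ⟶ b) (X : F.obj a) : prop a X → prop b ((F.map f).toFunctor.obj X)

namespace StableProperty

/-- The lift of a natural transformation to full subcategories. -/
def liftHom {C D : Cat.{v, w}} {P : ObjectProperty C} {Q : ObjectProperty D} {f g : C ⟶ D}
    (hf : ∀ X, P X → Q (f.toFunctor.obj X)) (hg : ∀ X, P X → Q (g.toFunctor.obj X)) (η : f ⟶ g) :
    (Q.lift (P.ι ⋙ f.toFunctor) fun X => hf _ X.2) ⟶
      (Q.lift (P.ι ⋙ g.toFunctor) fun X => hg _ X.2) where
  app X := ObjectProperty.homMk (η.toNatTrans.app X.obj)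
  naturality _ _ k := ObjectProperty.hom_ext _ (η.toNatTrans.naturality k.hom)

theorem hom₂_ext {C D : Cat.{v, w}} {P : ObjectProperty D} {f g : C ⟶ Cat.of P.FullSubcategory}
    {η θ : f ⟶ g} (h : ∀ X, (η.toNatTrans.app X).hom = (θ.toNatTrans.app X).hom) : η = θ :=
  Cat.Hom₂.ext (NatTrans.ext (funext fun X => ObjectProperty.hom_ext _ (h X)))

/-- The lift of a natural isomorphism to full subcategories. -/
def liftIso {C D : Cat.{v, w}} {P : ObjectProperty C} {Q : ObjectProperty D} {f g : C ⟶ D}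
    (hf : ∀ X, P X → Q (f.toFunctor.obj X)) (hg : ∀ X, P X → Q (g.toFunctor.obj X)) (η : f ≅ g) :
    (Q.lift (P.ι ⋙ f.toFunctor) fun X => hf _ X.2).toCatHom ≅
      (Q.lift (P.ι ⋙ g.toFunctor) fun X => hg _ X.2).toCatHom where
  hom := (liftHom hf hg η.hom).toCatHom₂
  inv := (liftHom hg hf η.inv).toCatHom₂
  hom_inv_id := hom₂_ext fun X => Cat.Hom.hom_inv_id_toNatTrans_app η X.obj
  inv_hom_id := hom₂_ext fun X => Cat.Hom.inv_hom_id_toNatTrans_app η X.obj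

variable (P : StableProperty F) (Q : StableProperty G)

/-- The underlying data of the full subfunctor. -/
def toFunctor : B ⥤ᵖ Cat.{v, w} where
  obj b := Cat.of (P.prop b).FullSubcategory
  map f := ((P.prop _).lift ((P.prop _).ι ⋙ (F.map f).toFunctor)
    fun X => P.map f _ X.2).toCatHom
  map₂ η := (liftHom (P.map _) (P.map _) (F.map₂ η)).toCatHom₂
  map₂_id f := hom₂_ext fun X =>
    congrArg (fun t => t.toNatTrans.app X.obj) (F.map₂_id f)
  map₂_comp η θ := hom₂_ext fun X =>
    congrArg (fun t => t.toNatTrans.app X.obj) (F.map₂_comp η θ)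
  mapId b := liftIso (P := P.prop b) (P.map (𝟙 b)) (fun _ h => h) (F.mapId b)
  mapComp {a _ c} f g := liftIso (P := P.prop a) (Q := P.prop c) (P.map (f ≫ g))
    (fun X h => P.map g _ (P.map f X h)) (F.mapComp f g)
  map₂_whisker_left f _ _ η := hom₂_ext fun X =>
    congrArg (fun t => t.toNatTrans.app X.obj) (F.map₂_whisker_left f η)
  map₂_whisker_right η f := hom₂_ext fun X =>
    congrArg (fun t => t.toNatTrans.app X.obj) (F.map₂_whisker_right η f)
  map₂_associator f g h := hom₂_ext fun X =>
    congrArg (fun t => t.toNatTrans.app X.obj) (F.map₂_associator f g h)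
  map₂_left_unitor f := hom₂_ext fun X =>
    congrArg (fun t => t.toNatTrans.app X.obj) (F.map₂_left_unitor f)
  map₂_right_unitor f := hom₂_ext fun X =>
    congrArg (fun t => t.toNatTrans.app X.obj) (F.map₂_right_unitor f)

/-- The inclusion of a full subfunctor. -/
def ι : P.toFunctor ⟶ F where
  app b := (P.prop b).ι.toCatHom
  naturality f := Iso.refl ((P.prop _).ι.toCatHom ≫ F.map f)
  naturality_naturality η := by
    refine (Category.comp_id _).trans (Eq.trans ?_ (Category.id_comp _).symm)
    rfl
  naturality_id b := by
    refine (Category.id_comp _).trans ?_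
    ext X
    exact ((congrArg ((F.mapId b).hom.toNatTrans.app X.obj ≫ ·) (Category.comp_id (𝟙 _))).trans
      (Category.comp_id _)).symm
  naturality_comp f g := by
    refine (Category.id_comp _).trans ?_
    ext X
    change _ = (F.mapComp f g).hom.toNatTrans.app X.obj ≫ 𝟙 _ ≫ 𝟙 _ ≫ 𝟙 _ ≫
      (F.map g).toFunctor.map (𝟙 _) ≫ 𝟙 _
    rw [CategoryTheory.Functor.map_id]
    erw [Category.comp_id, Category.comp_id, Category.comp_id, Category.comp_id, Category.comp_id]
    rfl

variable {P Q}

/-- The restriction of a transformation to full subfunctors. -/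
def lift (η : F ⟶ G) (h : ∀ b X, P.prop b X → Q.prop b ((η.app b).toFunctor.obj X)) :
    P.toFunctor ⟶ Q.toFunctor where
  app b := ((Q.prop b).lift ((P.prop b).ι ⋙ (η.app b).toFunctor) fun X => h b _ X.2).toCatHom
  naturality {a b} f := liftIso (P := P.prop a) (Q := Q.prop b)
    (fun X hX => h _ _ (P.map f X hX)) (fun X hX => Q.map f _ (h _ X hX)) (η.naturality f)
  naturality_naturality θ := hom₂_ext fun X =>
    congrArg (fun t => t.toNatTrans.app X.obj) (η.naturality_naturality θ)
  naturality_id b := hom₂_ext fun X =>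
    congrArg (fun t => t.toNatTrans.app X.obj) (η.naturality_id b)
  naturality_comp f g := hom₂_ext fun X =>
    congrArg (fun t => t.toNatTrans.app X.obj) (η.naturality_comp f g)

/-- The restriction of a modification to full subfunctors. -/
def liftMod {η θ : F ⟶ G} (hη : ∀ b X, P.prop b X → Q.prop b ((η.app b).toFunctor.obj X))
    (hθ : ∀ b X, P.prop b X → Q.prop b ((θ.app b).toFunctor.obj X)) (Γ : η ⟶ θ) :
    lift η hη ⟶ lift θ hθ where
  as := {
    app b := (liftHom (hη b) (hθ b) (Γ.as.app b)).toCatHom₂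
    naturality f := hom₂_ext fun X =>
      congrArg (fun t => t.toNatTrans.app X.obj) (Γ.as.naturality f) }

end StableProperty

theorem StableProperty.lift_eq {C D : Cat.{v, w}} {P : ObjectProperty C} {Q : ObjectProperty D}
    {f g : C ⟶ D} (hf : ∀ X, P X → Q (f.toFunctor.obj X)) (hg : ∀ X, P X → Q (g.toFunctor.obj X))
    (e : f = g) : (Q.lift (P.ι ⋙ f.toFunctor) fun X => hf _ X.2) =
      (Q.lift (P.ι ⋙ g.toFunctor) fun X => hg _ X.2) := by
  subst e; rfl

theorem StableProperty.liftIso_eqToIso {C D : Cat.{v, w}} {P : ObjectProperty C}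
    {Q : ObjectProperty D} {f g : C ⟶ D} (hf : ∀ X, P X → Q (f.toFunctor.obj X))
    (hg : ∀ X, P X → Q (g.toFunctor.obj X)) (e : f = g) :
    liftIso hf hg (eqToIso e) = eqToIso (congrArg Functor.toCatHom (lift_eq hf hg e)) := by
  subst e; rfl

end CategoryTheory.Pseudofunctor

open CategoryTheory.Pseudofunctor in
/-- The full subfunctor of a strict 2-functor is strict. -/
def CategoryTheory.StrictPseudofunctor.fullSub {B : Type*} [Bicategory B]
    (F : StrictPseudofunctor B Cat.{v, w}) (P : F.toPseudofunctor.StableProperty) :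
    StrictPseudofunctor B Cat.{v, w} where
  toPseudofunctor := P.toFunctor
  map_id b := congrArg Functor.toCatHom
    (StableProperty.lift_eq (P.map (𝟙 b)) (fun _ h => h) (F.map_id b))
  mapId_eq_eqToIso b := by
    refine Eq.trans ?_ (StableProperty.liftIso_eqToIso (P.map (𝟙 b)) (fun _ h => h) (F.map_id b))
    rw [← F.mapId_eq_eqToIso]
    rfl
  map_comp {a b c} f g := congrArg Functor.toCatHom
    (StableProperty.lift_eq (P := P.prop a) (Q := P.prop c) (P.map (f ≫ g))
      (fun X h => P.map g _ (P.map f X h)) (F.map_comp f g))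
  mapComp_eq_eqToIso {a b c} f g := by
    refine Eq.trans ?_ (StableProperty.liftIso_eqToIso (P := P.prop a) (Q := P.prop c)
      (P.map (f ≫ g)) (fun X h => P.map g _ (P.map f X h)) (F.map_comp f g))
    rw [← F.mapComp_eq_eqToIso]
    rfl

/-! ### Full subprederivators of a family -/

namespace Deriv.Prederivator

open CategoryTheory.Pseudofunctor

universe w₁ v₁ u₁

variable {B : Type u₁} [Bicategory.{w₁, v₁} B] {R : B ⥤ᵖ Prederivator.{u, v, w}}

/-- A property of the coherent diagrams in the prederivators `R.obj b` that is stable under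
restriction and under the morphisms `R.map f`. -/
structure FamilyProperty (R : B ⥤ᵖ Prederivator.{u, v, w}) where
  /-- the property of the coherent diagrams in `R.obj b` -/
  prop (b : B) : (R.obj b).ps.StableProperty
  map {a b : B} (f : a ⟶ b) (A : Cat.{u, u}ᵒᵖ) (X : (R.obj a).ps.obj A) : (prop a).prop A X →
    (prop b).prop A ((Pseudofunctor.StrongTrans.app (F := (R.obj a).ps) (G := (R.obj b).ps)
      (R.map f) A).toFunctor.obj X)

namespace FamilyProperty

variable (P : FamilyProperty R)

/-- The morphism induced by `R.map f` on the full subprederivators. -/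
def map₁ {a b : B} (f : a ⟶ b) : (P.prop a).toFunctor ⟶ (P.prop b).toFunctor :=
  StableProperty.lift (F := (R.obj a).ps) (G := (R.obj b).ps) (R.map f) (P.map f)

/-- Modifications into a full subprederivator are equal if the underlying morphisms are. -/
theorem fullSub_hom₂_ext {D E : Prederivator.{u, v, w}} {Q : E.ps.StableProperty}
    {F G : D ⟶ (⟨E.toStrict.fullSub Q⟩ : Prederivator)} {Γ Γ' : F ⟶ G}
    (h : ∀ A X, (((Γ : StrongTrans.Hom _ _).as.app A).toNatTrans.app X).hom =
      (((Γ' : StrongTrans.Hom _ _).as.app A).toNatTrans.app X).hom) : Γ = Γ' :=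
  StrongTrans.homCategory.ext (F := D.ps) (G := Q.toFunctor) (m := Γ) (n := Γ')
    fun A => StableProperty.hom₂_ext (h A)

theorem hom₂_congr {D E : Prederivator.{u, v, w}} {F G : D ⟶ E} {Γ Γ' : F ⟶ G} (h : Γ = Γ')
    (A : Cat.{u, u}ᵒᵖ) (X : D.ps.obj A) :
    ((Γ : StrongTrans.Hom _ _).as.app A).toNatTrans.app X =
      ((Γ' : StrongTrans.Hom _ _).as.app A).toNatTrans.app X := by
  rw [h]

/-- Isomorphisms of morphisms of full subprederivators. -/
def liftIso₂ {D E : Prederivator.{u, v, w}} {P : D.ps.StableProperty} {Q : E.ps.StableProperty}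
    {F G : D ⟶ E} (hF : ∀ A X, P.prop A X → Q.prop A ((Pseudofunctor.StrongTrans.app (F := D.ps)
      (G := E.ps) F A).toFunctor.obj X))
    (hG : ∀ A X, P.prop A X → Q.prop A ((Pseudofunctor.StrongTrans.app (F := D.ps)
      (G := E.ps) G A).toFunctor.obj X)) (e : F ≅ G) :
    StableProperty.lift (F := D.ps) (G := E.ps) F hF ≅
      StableProperty.lift (F := D.ps) (G := E.ps) G hG where
  hom := StableProperty.liftMod hF hG e.hom
  inv := StableProperty.liftMod hG hF e.inv
  hom_inv_id := fullSub_hom₂_ext (D := ⟨D.toStrict.fullSub P⟩) fun A X =>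
    hom₂_congr (D := D) (E := E) e.hom_inv_id A X.obj
  inv_hom_id := fullSub_hom₂_ext (D := ⟨D.toStrict.fullSub P⟩) fun A X =>
    hom₂_congr (D := D) (E := E) e.inv_hom_id A X.obj

/-- The full subprederivators of the `R.obj b` formed by the coherent diagrams with the given
property. -/
def toFunctor : B ⥤ᵖ Prederivator.{u, v, w} where
  obj b := ⟨(R.obj b).toStrict.fullSub (P.prop b)⟩
  map f := P.map₁ f
  map₂ {_ _ f g} η := StableProperty.liftMod (P.map f) (P.map g) (R.map₂ η)
  map₂_id {a b} f :=
    fullSub_hom₂_ext (D := ⟨(R.obj a).toStrict.fullSub (P.prop a)⟩) fun A X =>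
      hom₂_congr (D := R.obj a) (E := R.obj b) (R.map₂_id f) A X.obj
  map₂_comp {a b _ _ _} η θ :=
    fullSub_hom₂_ext (D := ⟨(R.obj a).toStrict.fullSub (P.prop a)⟩) fun A X =>
      hom₂_congr (D := R.obj a) (E := R.obj b) (R.map₂_comp η θ) A X.obj
  mapId b := liftIso₂ (P := P.prop b) (Q := P.prop b) (P.map (𝟙 b)) (fun _ _ h => h) (R.mapId b)
  mapComp {a _ c} f g := liftIso₂ (P := P.prop a) (Q := P.prop c) (P.map (f ≫ g))
    (fun _ _ h => P.map g _ _ (P.map f _ _ h)) (R.mapComp f g)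
  map₂_whisker_left {a _ b} f _ _ η :=
    fullSub_hom₂_ext (D := ⟨(R.obj a).toStrict.fullSub (P.prop a)⟩) fun A X =>
      hom₂_congr (D := R.obj a) (E := R.obj b) (R.map₂_whisker_left f η) A X.obj
  map₂_whisker_right {a _ b _ _} η f :=
    fullSub_hom₂_ext (D := ⟨(R.obj a).toStrict.fullSub (P.prop a)⟩) fun A X =>
      hom₂_congr (D := R.obj a) (E := R.obj b) (R.map₂_whisker_right η f) A X.obj
  map₂_associator {a _ _ b} f g h :=
    fullSub_hom₂_ext (D := ⟨(R.obj a).toStrict.fullSub (P.prop a)⟩) fun A X =>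
      hom₂_congr (D := R.obj a) (E := R.obj b) (R.map₂_associator f g h) A X.obj
  map₂_left_unitor {a b} f :=
    fullSub_hom₂_ext (D := ⟨(R.obj a).toStrict.fullSub (P.prop a)⟩) fun A X =>
      hom₂_congr (D := R.obj a) (E := R.obj b) (R.map₂_left_unitor f) A X.obj
  map₂_right_unitor {a b} f :=
    fullSub_hom₂_ext (D := ⟨(R.obj a).toStrict.fullSub (P.prop a)⟩) fun A X =>
      hom₂_congr (D := R.obj a) (E := R.obj b) (R.map₂_right_unitor f) A X.obj

/-- The inclusion of the full subprederivators. -/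
def ι : P.toFunctor ⟶ R where
  app b := (P.prop b).ι
  naturality {a b} f := StrongTrans.isoMk (F := (P.prop a).toFunctor) (G := (R.obj b).ps)
    (fun A => Iso.refl (((P.prop a).prop A).ι.toCatHom ≫
      StrongTrans.app (F := (R.obj a).ps) (G := (R.obj b).ps) (R.map f) A)) (by
      intro A A' g
      ext X
      let F := StrongTrans.app (F := (R.obj a).ps) (G := (R.obj b).ps) (R.map f) A
      let F' := StrongTrans.app (F := (R.obj a).ps) (G := (R.obj b).ps) (R.map f) A'
      let n := (StrongTrans.naturality (F := (R.obj a).ps) (G := (R.obj b).ps)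
        (R.map f) g).hom.toNatTrans.app X.obj
      change 𝟙 (F'.toFunctor.obj (((R.obj a).ps.map g).toFunctor.obj X.obj)) ≫ 𝟙 _ ≫
          F'.toFunctor.map (𝟙 _) ≫ 𝟙 _ ≫ n ≫ 𝟙 _ =
        (𝟙 _ ≫ n ≫ 𝟙 _ ≫ 𝟙 _ ≫ 𝟙 _) ≫ ((R.obj b).ps.map g).toFunctor.map (𝟙 _)
      simp only [CategoryTheory.Functor.map_id, Category.id_comp, Category.comp_id]
      exact (Category.comp_id _).symm)
  naturality_naturality {a b f g} η := by
    apply StrongTrans.homCategory.ext (F := (P.prop a).toFunctor) (G := (R.obj b).ps)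
    intro A
    refine (Category.comp_id _).trans (Eq.trans ?_ (Category.id_comp _).symm)
    rfl
  naturality_id b := by
    apply StrongTrans.homCategory.ext (F := (P.prop b).toFunctor) (G := (R.obj b).ps)
    intro A
    refine (Category.id_comp _).trans ?_
    ext X
    let t := ((R.mapId b).hom : StrongTrans.Hom (F := (R.obj b).ps) (G := (R.obj b).ps)
      _ _).as.app A |>.toNatTrans.app X.obj
    exact (by simp : t = t ≫ 𝟙 _ ≫ 𝟙 _)
  naturality_comp {a b c} f g := by
    apply StrongTrans.homCategory.ext (F := (P.prop a).toFunctor) (G := (R.obj c).ps)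
    intro A
    refine (Category.id_comp _).trans ?_
    ext X
    let t := ((R.mapComp f g).hom : StrongTrans.Hom (F := (R.obj a).ps) (G := (R.obj c).ps)
      _ _).as.app A |>.toNatTrans.app X.obj
    let G := (StrongTrans.app (F := (R.obj b).ps) (G := (R.obj c).ps) (R.map g) A).toFunctor
    let F := (StrongTrans.app (F := (R.obj a).ps) (G := (R.obj b).ps) (R.map f) A).toFunctor
    let t' : _ ⟶ G.obj (F.obj X.obj) := t
    exact (by simp : t' = t' ≫ 𝟙 _ ≫ 𝟙 _ ≫ 𝟙 _ ≫ G.map (𝟙 _) ≫ 𝟙 _)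

end FamilyProperty
end Deriv.Prederivator

/-! ### Restriction along functors of exponents -/

namespace CategoryTheory.Bicategory

universe w₁ v₁ u₁

section

variable {B : Type u₁} [Bicategory.{w₁, v₁} B]

/-- If `k` factors both as `f ≫ g` and as `f' ≫ g'`, the naturality 2-isomorphisms of these four
morphisms satisfy the following exchange identity. For a morphism of prederivators this is the
compatibility of its components with `D^B ⟶ D^B'`. -/
theorem square_of_naturality_comp {a b b' c : B} {a₁ b₁ b₁' c₁ : B} {Fa : a ⟶ a₁} {Fb : b ⟶ b₁}
    {Fb' : b' ⟶ b₁'} {Fc : c ⟶ c₁} {k : a ⟶ c} {f : a ⟶ b} {g : b ⟶ c} {f' : a ⟶ b'} {g' : b' ⟶ c}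
    {k₁ : a₁ ⟶ c₁} {f₁ : a₁ ⟶ b₁} {g₁ : b₁ ⟶ c₁} {f₁' : a₁ ⟶ b₁'} {g₁' : b₁' ⟶ c₁}
    (nk : k ≫ Fc ≅ Fa ≫ k₁) (nf : f ≫ Fb ≅ Fa ≫ f₁) (ng : g ≫ Fc ≅ Fb ≫ g₁)
    (nf' : f' ≫ Fb' ≅ Fa ≫ f₁') (ng' : g' ≫ Fc ≅ Fb' ≫ g₁') (p : k ≅ f ≫ g) (p' : k ≅ f' ≫ g')
    (q : k₁ ≅ f₁ ≫ g₁) (q' : k₁ ≅ f₁' ≫ g₁')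
    (h : nk.hom ≫ Fa ◁ q.hom = p.hom ▷ Fc ≫ (α_ _ _ _).hom ≫ f ◁ ng.hom ≫ (α_ _ _ _).inv ≫
      nf.hom ▷ g₁ ≫ (α_ _ _ _).hom)
    (h' : nk.hom ≫ Fa ◁ q'.hom = p'.hom ▷ Fc ≫ (α_ _ _ _).hom ≫ f' ◁ ng'.hom ≫
      (α_ _ _ _).inv ≫ nf'.hom ▷ g₁' ≫ (α_ _ _ _).hom) :
    f ◁ ng.inv ≫ (α_ _ _ _).inv ≫ (p.symm ≪≫ p').hom ▷ Fc ≫ (α_ _ _ _).hom ≫ f' ◁ ng'.hom ≫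
      (α_ _ _ _).inv = ((α_ _ _ _).inv ≫ nf.hom ▷ g₁ ≫ (α_ _ _ _).hom ≫
        Fa ◁ (q.symm ≪≫ q').hom ≫ (α_ _ _ _).inv) ≫ nf'.inv ▷ g₁' := by
  have h₁ : nf.hom ▷ g₁ ≫ (α_ _ _ _).hom = (α_ _ _ _).hom ≫ f ◁ ng.inv ≫ (α_ _ _ _).inv ≫
      p.inv ▷ Fc ≫ nk.hom ≫ Fa ◁ q.hom := by
    rw [h]; simp
  have h₂ : (α_ _ _ _).hom ≫ f' ◁ ng'.hom ≫ (α_ _ _ _).inv = p'.inv ▷ Fc ≫ nk.hom ≫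
      Fa ◁ q'.hom ≫ (α_ _ _ _).inv ≫ nf'.inv ▷ g₁' := by
    rw [reassoc_of% h']; simp
  simp only [Iso.trans_hom, Iso.symm_hom, comp_whiskerRight, Category.assoc, h₂]
  simp only [reassoc_of% h₁]
  simp

end

variable {B : Type u₁} [Bicategory.{w₁, v₁} B] [Strict B] {x y z x' y' z' : B}

/-- In a strict bicategory, squares filled by an equality satisfy the unit axiom of a
pseudo-natural transformation. -/
theorem eqToHom_square_id {f : x ⟶ x} {g : y ⟶ y} {m : x ⟶ y} (hf : f = 𝟙 x) (hg : g = 𝟙 y)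
    (h : f ≫ m = m ≫ g) :
    eqToHom h ≫ m ◁ eqToHom hg = eqToHom hf ▷ m ≫ (λ_ m).hom ≫ (ρ_ m).inv := by
  subst hf hg
  simp [Strict.leftUnitor_eqToIso, Strict.rightUnitor_eqToIso]

/-- In a strict bicategory, squares filled by equalities satisfy the composition axiom of a
pseudo-natural transformation. -/
theorem eqToHom_square_comp {f : x ⟶ y} {g : y ⟶ z} {k : x ⟶ z} {f' : x' ⟶ y'} {g' : y' ⟶ z'}
    {k' : x' ⟶ z'} {m₁ : x ⟶ x'} {m₂ : y ⟶ y'} {m₃ : z ⟶ z'} (hk : k = f ≫ g) (hk' : k' = f' ≫ g')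
    (h : k ≫ m₃ = m₁ ≫ k') (h₁ : f ≫ m₂ = m₁ ≫ f') (h₂ : g ≫ m₃ = m₂ ≫ g') :
    eqToHom h ≫ m₁ ◁ eqToHom hk' = eqToHom hk ▷ m₃ ≫ (α_ f g m₃).hom ≫ f ◁ eqToHom h₂ ≫
      (α_ f m₂ g').inv ≫ eqToHom h₁ ▷ g' ≫ (α_ m₁ f' g').hom := by
  subst hk hk'
  simp [Strict.associator_eqToIso, whiskerLeft_eqToHom, eqToHom_whiskerRight]

end CategoryTheory.Bicategory

theorem CategoryTheory.comp_symm_trans_hom {C : Type*} [Category C] {x₁ x₂ y₁ y₂ z₁ z₂ : C}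
    (p₁ : x₁ ≅ y₁) (q₁ : x₁ ≅ z₁) (p₂ : x₂ ≅ y₂) (q₂ : x₂ ≅ z₂) (s : y₁ ⟶ y₂) (t : z₁ ⟶ z₂)
    (h : p₁.hom ≫ s ≫ p₂.inv = q₁.hom ≫ t ≫ q₂.inv) :
    s ≫ (p₂.symm ≪≫ q₂).hom = (p₁.symm ≪≫ q₁).hom ≫ t := by
  rw [← cancel_epi p₁.hom, ← cancel_mono q₂.inv]
  simpa using h

namespace Deriv

open CategoryTheory.Pseudofunctor

variable {B B' : Cat.{u, u}} (a : (B' : Type u) ⥤ (B : Type u))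

/-- The functor `B' × A ⥤ B × A` induced by `a : B' ⥤ B`, as a morphism of `Catᵒᵖ`. -/
def prodLeftMap (A : Cat.{u, u}ᵒᵖ) : (prodLeft B).obj A ⟶ (prodLeft B').obj A :=
  (a.prod (𝟭 A.unop)).toCatHom.op

namespace Prederivator

variable (D : Prederivator.{u, v, w})

/-- The naturality isomorphisms of the restriction `D^B ⟶ D^B'`. -/
def powResIso {A A' : Cat.{u, u}ᵒᵖ} (f : A ⟶ A') :
    D.ps.map ((prodLeft B).map f) ≫ D.ps.map (prodLeftMap a A') ≅
      D.ps.map (prodLeftMap a A) ≫ D.ps.map ((prodLeft B').map f) :=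
  (D.ps.mapComp ((prodLeft B).map f) (prodLeftMap a A')).symm ≪≫
    D.ps.mapComp (prodLeftMap a A) ((prodLeft B').map f)

/-- The naturality isomorphisms of the restriction are equalities, since prederivators are strict.
-/
theorem powResIso_eq {A A' : Cat.{u, u}ᵒᵖ} (f : A ⟶ A') :
    ∃ h, D.powResIso a f = eqToIso h := by
  have h₁ := (D.toStrict.map_comp ((prodLeft B).map f) (prodLeftMap a A')).symm
  have h₂ := D.toStrict.map_comp (prodLeftMap a A) ((prodLeft B').map f)
  refine ⟨h₁.trans h₂, ?_⟩
  unfold powResIso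
  rw [D.toStrict.mapComp_eq_eqToIso, D.toStrict.mapComp_eq_eqToIso]
  exact eqToIso_trans h₁ h₂

theorem map₂_powResIso {A A' : Cat.{u, u}ᵒᵖ} {f g : A ⟶ A'} (η : f ⟶ g) :
    D.ps.map₂ ((prodLeft B).map₂ η) ▷ D.ps.map (prodLeftMap a A') ≫ (D.powResIso a g).hom =
      (D.powResIso a f).hom ≫ D.ps.map (prodLeftMap a A) ◁ D.ps.map₂ ((prodLeft B').map₂ η) := by
  have h₁ := D.ps.map₂_whisker_right ((prodLeft B).map₂ η) (prodLeftMap a A')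
  have h₂ := D.ps.map₂_whisker_left (prodLeftMap a A) ((prodLeft B').map₂ η)
  have h₃ : (prodLeft B).map₂ η ▷ prodLeftMap a A' = prodLeftMap a A ◁ (prodLeft B').map₂ η := by
    refine congrArg (fun t => Bicategory.Opposite.op2 (NatTrans.toCatHom₂ t)) ?_
    refine NatTrans.ext (funext fun x => ?_)
    exact Prod.ext (a.map_id x.1).symm rfl
  have h₅ := h₁.symm.trans ((congrArg (fun t => D.ps.map₂ t) h₃).trans h₂)
  exact comp_symm_trans_hom _ _ _ _ _ _ h₅

/-- The restriction `D^B ⟶ D^B'` along `a : B' ⥤ B`. -/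
def powRes : D.pow B ⟶ D.pow B' where
  app A := D.ps.map (prodLeftMap a A)
  naturality f := D.powResIso a f
  naturality_naturality η := D.map₂_powResIso a η
  naturality_id A := by
    obtain ⟨h, e⟩ := D.powResIso_eq a (𝟙 A)
    rw [e, (D.pow B).toStrict.mapId_eq_eqToIso, (D.pow B').toStrict.mapId_eq_eqToIso]
    exact eqToHom_square_id ((D.pow B).toStrict.map_id A) ((D.pow B').toStrict.map_id A) h
  naturality_comp f g := by
    obtain ⟨h, e⟩ := D.powResIso_eq a (f ≫ g)
    obtain ⟨h₁, e₁⟩ := D.powResIso_eq a f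
    obtain ⟨h₂, e₂⟩ := D.powResIso_eq a g
    rw [e, e₁, e₂, (D.pow B).toStrict.mapComp_eq_eqToIso, (D.pow B').toStrict.mapComp_eq_eqToIso]
    exact eqToHom_square_comp ((D.pow B).toStrict.map_comp f g)
      ((D.pow B').toStrict.map_comp f g) h h₁ h₂

end Prederivator

/-- The restriction `(-)^B ⟶ (-)^B'` along `a : B' ⥤ B`. -/
def stablePowRes : stablePow.{u, v, w} B ⟶ stablePow.{u, v, w} B' where
  app D := D.toPrederivator.powRes a
  naturality {D E} F := Pseudofunctor.StrongTrans.isoMk (F := (D.toPrederivator.pow B).ps)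
    (G := (E.toPrederivator.pow B').ps)
    (fun A => (StrongTrans.naturality (F := D.ps) (G := E.ps) F.hom (prodLeftMap a A)).symm) (by
      intro A A' f
      exact square_of_naturality_comp _ _ _ _ _ _ _ _ _
        (StrongTrans.naturality_comp (F := D.ps) (G := E.ps) F.hom ((prodLeft B).map f)
          (prodLeftMap a A'))
        (StrongTrans.naturality_comp (F := D.ps) (G := E.ps) F.hom (prodLeftMap a A)
          ((prodLeft B').map f)))
  naturality_naturality {D E F G} η := by
    apply StrongTrans.homCategory.ext (F := (D.toPrederivator.pow B).ps)
      (G := (E.toPrederivator.pow B').ps)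
    intro A
    have h := StrongTrans.Modification.naturality (F := D.ps) (G := E.ps) η.hom.as
      (prodLeftMap a A)
    rw [← Iso.inv_comp_eq, ← Category.assoc, ← Iso.eq_comp_inv] at h
    exact h.symm
  naturality_id D := by
    apply StrongTrans.homCategory.ext (F := (D.toPrederivator.pow B).ps)
      (G := (D.toPrederivator.pow B').ps)
    intro A
    change ((ρ_ (D.ps.map (prodLeftMap a A))) ≪≫ (λ_ (D.ps.map (prodLeftMap a A))).symm).inv ≫
        D.ps.map (prodLeftMap a A) ◁ (𝟙 (𝟙 _) ≫ 𝟙 (𝟙 _)) = (𝟙 (𝟙 _) ≫ 𝟙 (𝟙 _)) ▷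
          D.ps.map (prodLeftMap a A) ≫ (λ_ (D.ps.map (prodLeftMap a A))).hom ≫
            (ρ_ (D.ps.map (prodLeftMap a A))).inv
    simp
  naturality_comp {D E H} F G := by
    apply StrongTrans.homCategory.ext (F := (D.toPrederivator.pow B).ps)
      (G := (H.toPrederivator.pow B').ps)
    intro A
    let m₁ := D.ps.map (prodLeftMap a A)
    let m₂ := E.ps.map (prodLeftMap a A)
    let m₃ := H.ps.map (prodLeftMap a A)
    let f := StrongTrans.app (F := D.ps) (G := E.ps) F.hom ((prodLeft B).obj A)
    let f' := StrongTrans.app (F := D.ps) (G := E.ps) F.hom ((prodLeft B').obj A)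
    let g := StrongTrans.app (F := E.ps) (G := H.ps) G.hom ((prodLeft B).obj A)
    let g' := StrongTrans.app (F := E.ps) (G := H.ps) G.hom ((prodLeft B').obj A)
    let n₁ : m₁ ≫ f' ≅ f ≫ m₂ :=
      StrongTrans.naturality (F := D.ps) (G := E.ps) F.hom (prodLeftMap a A)
    let n₂ : m₂ ≫ g' ≅ g ≫ m₃ :=
      StrongTrans.naturality (F := E.ps) (G := H.ps) G.hom (prodLeftMap a A)
    change ((α_ m₁ f' g').symm ≪≫ whiskerRightIso n₁ g' ≪≫ α_ f m₂ g' ≪≫ whiskerLeftIso f n₂ ≪≫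
        (α_ f g m₃).symm).inv ≫ m₁ ◁ (𝟙 (f' ≫ g') ≫ 𝟙 (f' ≫ g')) =
      (𝟙 (f ≫ g) ≫ 𝟙 (f ≫ g)) ▷ m₃ ≫ (α_ f g m₃).hom ≫ f ◁ n₂.inv ≫ (α_ f m₂ g').inv ≫
        n₁.inv ▷ g' ≫ (α_ m₁ f' g').hom
    simp

end Deriv

/-! ### Equivalences from restriction -/

namespace Deriv

open CategoryTheory.Pseudofunctor

/-- A morphism of prederivators is an equivalence if its components are. -/
theorem Prederivator.exists_equivalence {D E : Prederivator.{u, v, w}} (F : D ⟶ E)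
    (h : ∀ A : Cat.{u, u}ᵒᵖ, (StrongTrans.app (F := D.ps) (G := E.ps)
      F A).toFunctor.IsEquivalence) :
    ∃ e : D ≌ E, e.hom = F := by
  obtain ⟨e, he⟩ := StrongTrans.exists_equivalence (F := D.ps) (G := E.ps) F fun A => by
    let e := (StrongTrans.app (F := D.ps) (G := E.ps) F A).toFunctor.asEquivalence
    exact ⟨.mkOfAdjointifyCounit (f := StrongTrans.app (F := D.ps) (G := E.ps) F A)
      (g := e.inverse.toCatHom) (Cat.Hom.isoMk e.unitIso) (Cat.Hom.isoMk e.counitIso), rfl⟩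
  exact ⟨.mkOfAdjointifyCounit (a := D) (b := E) (f := e.hom) (g := e.inv) e.unit e.counit, he⟩

/-- Two exponents are strongly stably equivalent if both arise by restriction from the same full
subprederivators of coherent diagrams of a larger shape. -/
theorem stronglyStablyEquivalent_of_restriction {M B B' : Cat.{u, u}}
    (P : Prederivator.FamilyProperty (stablePow.{u, v, w} M))
    (a : (B : Type u) ⥤ (M : Type u)) (b : (B' : Type u) ⥤ (M : Type u))
    (ha : ∀ (D : StableDerivator.{u, v, w}) (A : Type u) [Category.{u} A],
      (((P.prop D).prop (op (Cat.of A))).ι ⋙ D.res (a.prod (𝟭 A))).IsEquivalence)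
    (hb : ∀ (D : StableDerivator.{u, v, w}) (A : Type u) [Category.{u} A],
      (((P.prop D).prop (op (Cat.of A))).ι ⋙ D.res (b.prod (𝟭 A))).IsEquivalence) :
    StronglyStablyEquivalent.{u, v, w} B B' := by
  have key : ∀ {B : Cat.{u, u}} (a : (B : Type u) ⥤ (M : Type u)),
      (∀ (D : StableDerivator.{u, v, w}) (A : Type u) [Category.{u} A],
        (((P.prop D).prop (op (Cat.of A))).ι ⋙ D.res (a.prod (𝟭 A))).IsEquivalence) →
      Nonempty (P.toFunctor ≌ stablePow.{u, v, w} B) := by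
    intro B a ha
    obtain ⟨e, -⟩ := StrongTrans.exists_equivalence (P.ι ≫ stablePowRes a) fun D =>
      Prederivator.exists_equivalence _ fun A => ha D A.unop
    exact ⟨e⟩
  obtain ⟨e⟩ := key a ha
  obtain ⟨e'⟩ := key b hb
  exact ⟨(e.symm.trans e').hom, fun D => ⟨StrongTrans.equivalenceApp (e.symm.trans e') D, rfl⟩⟩

end Deriv

namespace Deriv.Prederivator

/-! ### Calculus of restriction functors -/

variable (D : Prederivator.{u, v, w}) {A : Type u} [Category.{u} A] {B : Type u} [Category.{u} B]
  {C : Type u} [Category.{u} C] {I : Type u} [Category.{u} I]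

theorem res_comp (f : A ⥤ B) (g : B ⥤ C) : D.res (f ⋙ g) = D.res g ⋙ D.res f :=
  congrArg Cat.Hom.toFunctor (D.toStrict.map_comp g.toCatHom.op f.toCatHom.op)

theorem res_id (A : Type u) [Category.{u} A] : D.res (𝟭 A) = 𝟭 _ :=
  congrArg Cat.Hom.toFunctor (D.toStrict.map_id (op (Cat.of A)))

theorem resComp_hom_app (f : A ⥤ B) (g : B ⥤ C) (X : D.diag C) :
    (D.resComp f g).hom.app X = eqToHom (by rw [res_comp]) := by
  change (D.ps.mapComp g.toCatHom.op f.toCatHom.op).hom.toNatTrans.app X = _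
  rw [D.toStrict.mapComp_eq_eqToIso]
  exact Cat.eqToHom_app _ _ (D.toStrict.map_comp g.toCatHom.op f.toCatHom.op) X

theorem resComp_inv_app (f : A ⥤ B) (g : B ⥤ C) (X : D.diag C) :
    (D.resComp f g).inv.app X = eqToHom (by rw [res_comp]) := by
  change (D.ps.mapComp g.toCatHom.op f.toCatHom.op).inv.toNatTrans.app X = _
  rw [D.toStrict.mapComp_eq_eqToIso]
  exact Cat.eqToHom_app _ _ (D.toStrict.map_comp g.toCatHom.op f.toCatHom.op).symm X

/-- `𝟭^* = 𝟭`, as an isomorphism. -/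
def resId (A : Type u) [Category.{u} A] : D.res (𝟭 A) ≅ 𝟭 _ := eqToIso (D.res_id A)

theorem resTrans_id (f : A ⥤ B) : D.resTrans (𝟙 f) = 𝟙 _ :=
  congrArg Cat.Hom₂.toNatTrans (D.ps.map₂_id f.toCatHom.op)

theorem resTrans_comp {f g h : A ⥤ B} (α : f ⟶ g) (β : g ⟶ h) :
    D.resTrans (α ≫ β) = D.resTrans α ≫ D.resTrans β :=
  congrArg Cat.Hom₂.toNatTrans (D.ps.map₂_comp (Bicategory.Opposite.op2 α.toCatHom₂)
    (Bicategory.Opposite.op2 β.toCatHom₂))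

theorem resTrans_whiskerLeft (f : I ⥤ A) {g h : A ⥤ B} (α : g ⟶ h) :
    D.resTrans (Functor.whiskerLeft f α) = (D.resComp f g).hom ≫
      Functor.whiskerRight (D.resTrans α) (D.res f) ≫ (D.resComp f h).inv :=
  congrArg Cat.Hom₂.toNatTrans (D.ps.map₂_whisker_right
    (Bicategory.Opposite.op2 α.toCatHom₂) f.toCatHom.op)

theorem resTrans_whiskerRight {f g : I ⥤ A} (α : f ⟶ g) (h : A ⥤ B) :
    D.resTrans (Functor.whiskerRight α h) = (D.resComp f h).hom ≫
      Functor.whiskerLeft (D.res h) (D.resTrans α) ≫ (D.resComp g h).inv :=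
  congrArg Cat.Hom₂.toNatTrans (D.ps.map₂_whisker_left h.toCatHom.op
    (Bicategory.Opposite.op2 α.toCatHom₂))

/-- The isomorphism of restriction functors induced by an isomorphism of functors. -/
@[simps]
def resIso {f g : A ⥤ B} (α : f ≅ g) : D.res f ≅ D.res g where
  hom := D.resTrans α.hom
  inv := D.resTrans α.inv
  hom_inv_id := by rw [← resTrans_comp, α.hom_inv_id, resTrans_id]
  inv_hom_id := by rw [← resTrans_comp, α.inv_hom_id, resTrans_id]

instance {f g : A ⥤ B} (α : f ⟶ g) [IsIso α] : IsIso (D.resTrans α) :=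
  (D.resIso (asIso α)).isIso_hom

theorem map_resTrans_app (f : I ⥤ A) {g h : A ⥤ B} (α : g ⟶ h) (X : D.diag B) :
    (D.res f).map ((D.resTrans α).app X) = (D.resComp f g).inv.app X ≫
      (D.resTrans (Functor.whiskerLeft f α)).app X ≫ (D.resComp f h).hom.app X := by
  simp [resTrans_whiskerLeft]

theorem resTrans_app_res_obj {f g : I ⥤ A} (α : f ⟶ g) (h : A ⥤ B) (X : D.diag B) :
    (D.resTrans α).app ((D.res h).obj X) = (D.resComp f h).inv.app X ≫
      (D.resTrans (Functor.whiskerRight α h)).app X ≫ (D.resComp g h).hom.app X := by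
  simp [resTrans_whiskerRight]

theorem resId_hom_app (X : D.diag A) : (D.resId A).hom.app X = eqToHom (by rw [res_id]) := by
  simp [resId, eqToHom_app]

theorem resId_inv_app (X : D.diag A) : (D.resId A).inv.app X = eqToHom (by rw [res_id]) := by
  simp [resId, eqToHom_app]

/-- An adjunction `l ⊣ k` of functors induces an adjunction `k^* ⊣ l^*`. -/
def resAdjunction {l : A ⥤ B} {k : B ⥤ A} (adj : CategoryTheory.Adjunction l k) :
    CategoryTheory.Adjunction (D.res k) (D.res l) :=
  CategoryTheory.Adjunction.mkOfUnitCounit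
   { unit := (D.resId A).inv ≫ D.resTrans adj.unit ≫ (D.resComp l k).hom
     counit := (D.resComp k l).inv ≫ D.resTrans adj.counit ≫ (D.resId B).hom
     left_triangle := by
      ext X
      have h : Functor.whiskerLeft k adj.unit ≫ Functor.whiskerRight adj.counit k = 𝟙 k := by
        ext; simp
      have hid := congrArg (fun t => t.app X) (D.resTrans_id k)
      have h' := (congrArg (fun t => (D.resTrans t).app X) h).trans hid
      simpa [resComp_hom_app, resComp_inv_app, resId_hom_app, resId_inv_app, map_resTrans_app,
        resTrans_app_res_obj, eqToHom_map, resTrans_comp] using h'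
     right_triangle := by
      ext X
      have h : Functor.whiskerRight adj.unit l ≫ Functor.whiskerLeft l adj.counit = 𝟙 l := by
        ext; simp
      have hid := congrArg (fun t => t.app X) (D.resTrans_id l)
      have h' := (congrArg (fun t => (D.resTrans t).app X) h).trans hid
      simpa [resComp_hom_app, resComp_inv_app, resId_hom_app, resId_inv_app, map_resTrans_app,
        resTrans_app_res_obj, eqToHom_map, resTrans_comp] using h' }

end Deriv.Prederivator

/-! ### Universal arrows -/

namespace CategoryTheory.Functor

universe v₁ v₂ u₁ u₂

variable {C : Type u₁} [Category.{v₁} C] {E : Type u₂} [Category.{v₂} E] (R : C ⥤ E)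

/-- An arrow `g : V ⟶ R Z` is universal if every arrow `V ⟶ R Y` factors uniquely through it. -/
def IsUniversalFrom {V : E} {Z : C} (g : V ⟶ R.obj Z) : Prop :=
  ∀ Y : C, Function.Bijective fun f : Z ⟶ Y => g ≫ R.map f

/-- An arrow `g : R Z ⟶ V` is universal if every arrow `R Y ⟶ V` factors uniquely through it. -/
def IsUniversalTo {V : E} {Z : C} (g : R.obj Z ⟶ V) : Prop :=
  ∀ Y : C, Function.Bijective fun f : Y ⟶ Z => R.map f ≫ g

variable {R}

theorem IsUniversalFrom.congr {V V' : E} {Z Z' : C} {g : V ⟶ R.obj Z} {g' : V' ⟶ R.obj Z'}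
    (h : R.IsUniversalFrom g) (e : V ≅ V') (e' : Z ≅ Z') (w : g ≫ R.map e'.hom = e.hom ≫ g') :
    R.IsUniversalFrom g' := by
  intro Y
  have h₁ : (fun f : Z' ⟶ Y => g' ≫ R.map f) =
      ((e.homFromEquiv (Z := R.obj Y)) ∘ fun f : Z ⟶ Y => g ≫ R.map f) ∘
        (e'.homFromEquiv (Z := Y)).symm := by
    ext f
    simp [reassoc_of% w]
  rw [h₁]
  exact ((Equiv.bijective _).comp (h Y)).comp (Equiv.bijective _)

theorem isUniversalFrom_congr {V V' : E} {Z Z' : C} {g : V ⟶ R.obj Z} {g' : V' ⟶ R.obj Z'}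
    (e : V ≅ V') (e' : Z ≅ Z') (w : g ≫ R.map e'.hom = e.hom ≫ g') :
    R.IsUniversalFrom g ↔ R.IsUniversalFrom g' :=
  ⟨fun h => h.congr e e' w, fun h => h.congr e.symm e'.symm (by
    rw [Iso.symm_hom, Iso.symm_hom, Iso.eq_inv_comp, ← reassoc_of% w, ← R.map_comp,
      Iso.hom_inv_id, R.map_id, Category.comp_id])⟩

theorem IsUniversalTo.congr {V V' : E} {Z Z' : C} {g : R.obj Z ⟶ V} {g' : R.obj Z' ⟶ V'}
    (h : R.IsUniversalTo g) (e : V ≅ V') (e' : Z ≅ Z') (w : g ≫ e.hom = R.map e'.hom ≫ g') :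
    R.IsUniversalTo g' := by
  intro Y
  have h₁ : (fun f : Y ⟶ Z' => R.map f ≫ g') =
      ((e.homToEquiv (Z := R.obj Y)) ∘ fun f : Y ⟶ Z => R.map f ≫ g) ∘
        (e'.homToEquiv (Z := Y)).symm := by
    ext f
    rw [Function.comp_apply, Function.comp_apply, Iso.homToEquiv_apply,
      Iso.homToEquiv_symm_apply, R.map_comp, Category.assoc, Category.assoc, w,
      ← R.map_comp_assoc e'.inv, e'.inv_hom_id, R.map_id, Category.id_comp]
  rw [h₁]
  exact ((Equiv.bijective _).comp (h Y)).comp (Equiv.bijective _)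

theorem isUniversalTo_congr {V V' : E} {Z Z' : C} {g : R.obj Z ⟶ V} {g' : R.obj Z' ⟶ V'}
    (e : V ≅ V') (e' : Z ≅ Z') (w : g ≫ e.hom = R.map e'.hom ≫ g') :
    R.IsUniversalTo g ↔ R.IsUniversalTo g' :=
  ⟨fun h => h.congr e e' w, fun h => h.congr e.symm e'.symm (by
    rw [Iso.symm_hom, Iso.symm_hom, Iso.comp_inv_eq, Category.assoc, w, ← R.map_comp_assoc,
      Iso.inv_hom_id, R.map_id, Category.id_comp])⟩

/-- Universal arrows are unique: the arrows factoring through a universal arrow that are universal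
themselves are the ones with invertible factor. -/
theorem isUniversalFrom_comp_iff {V : E} {Z Z' : C} {g : V ⟶ R.obj Z} (hg : R.IsUniversalFrom g)
    (f : Z ⟶ Z') : R.IsUniversalFrom (g ≫ R.map f) ↔ IsIso f := by
  have h₁ (Y : C) : (fun t : Z' ⟶ Y => (g ≫ R.map f) ≫ R.map t) =
      (fun t : Z ⟶ Y => g ≫ R.map t) ∘ fun t => f ≫ t := by
    ext t; simp
  constructor
  · intro h
    rw [isIso_iff_coyoneda_map_bijective]
    intro Y
    have := h Y
    rw [h₁] at this
    exact (Function.Bijective.of_comp_iff' (hg Y) _).1 this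
  · intro h Y
    rw [h₁]
    exact (hg Y).comp ((isIso_iff_coyoneda_map_bijective f).1 h Y)

theorem isUniversalTo_comp_iff {V : E} {Z Z' : C} {g : R.obj Z ⟶ V} (hg : R.IsUniversalTo g)
    (f : Z' ⟶ Z) : R.IsUniversalTo (R.map f ≫ g) ↔ IsIso f := by
  have h₁ (Y : C) : (fun t : Y ⟶ Z' => R.map t ≫ R.map f ≫ g) =
      (fun t : Y ⟶ Z => R.map t ≫ g) ∘ fun t => t ≫ f := by
    ext t; simp
  constructor
  · intro h
    rw [isIso_iff_yoneda_map_bijective]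
    intro Y
    have := h Y
    rw [h₁] at this
    exact (Function.Bijective.of_comp_iff' (hg Y) _).1 this
  · intro h Y
    rw [h₁]
    exact (hg Y).comp ((isIso_iff_yoneda_map_bijective f).1 h Y)

end CategoryTheory.Functor

namespace CategoryTheory.Adjunction

universe v₁ v₂ u₁ u₂

variable {C : Type u₁} [Category.{v₁} C] {E : Type u₂} [Category.{v₂} E] {L : E ⥤ C} {R : C ⥤ E}

theorem isUniversalFrom_unit (adj : L ⊣ R) (V : E) : R.IsUniversalFrom (adj.unit.app V) :=
  fun Y => by simpa [adj.homEquiv_unit] using! (adj.homEquiv V Y).bijective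

theorem isUniversalTo_counit (adj : L ⊣ R) (V : C) : L.IsUniversalTo (adj.counit.app V) :=
  fun Y => by simpa [adj.homEquiv_counit] using! (adj.homEquiv Y V).symm.bijective

/-- The counit of `L ⊣ R` is invertible at `X` if and only if `R` is fully faithful on the arrows
out of `X`. -/
theorem bijective_map_iff_isIso_counit (adj : L ⊣ R) (X : C) :
    (∀ Y, Function.Bijective (R.map : (X ⟶ Y) → (R.obj X ⟶ R.obj Y))) ↔
      IsIso (adj.counit.app X) := by
  rw [isIso_iff_coyoneda_map_bijective]
  refine forall_congr' fun Y => ?_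
  rw [← Function.Bijective.of_comp_iff' (adj.homEquiv (R.obj X) Y).bijective]
  refine iff_of_eq (congrArg _ ?_)
  ext f
  simp [adj.homEquiv_unit]

/-- The unit of `L ⊣ R` is invertible at `X` if and only if `L` is fully faithful on the arrows
into `X`. -/
theorem bijective_map_iff_isIso_unit (adj : L ⊣ R) (X : E) :
    (∀ Y, Function.Bijective (L.map : (Y ⟶ X) → (L.obj Y ⟶ L.obj X))) ↔
      IsIso (adj.unit.app X) := by
  rw [isIso_iff_yoneda_map_bijective]
  refine forall_congr' fun Y => ?_
  rw [← Function.Bijective.of_comp_iff' (adj.homEquiv Y (L.obj X)).symm.bijective]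
  refine iff_of_eq (congrArg _ ?_)
  ext f
  simp [adj.homEquiv_counit]

end CategoryTheory.Adjunction

namespace CategoryTheory.Functor

universe v₁ v₂ v₃ u₁ u₂ u₃

variable {C : Type u₁} [Category.{v₁} C] {E : Type u₂} [Category.{v₂} E] {E' : Type u₃}
  [Category.{v₃} E'] {R R' : C ⥤ E}

theorem isUniversalFrom_iff_of_iso (i : R ≅ R') {V : E} {Z : C} (g : V ⟶ R.obj Z) :
    R.IsUniversalFrom g ↔ R'.IsUniversalFrom (g ≫ i.hom.app Z) := by
  refine forall_congr' fun Y => ?_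
  have : (fun f : Z ⟶ Y => (g ≫ i.hom.app Z) ≫ R'.map f) =
      ((i.app Y).homToEquiv (Z := V)) ∘ fun f : Z ⟶ Y => g ≫ R.map f := by
    ext f; simp
  rw [this, Function.Bijective.of_comp_iff' (Equiv.bijective _)]

theorem isUniversalTo_iff_of_iso (i : R ≅ R') {V : E} {Z : C} (g : R.obj Z ⟶ V) :
    R.IsUniversalTo g ↔ R'.IsUniversalTo (i.inv.app Z ≫ g) := by
  refine forall_congr' fun Y => ?_
  have : (fun f : Y ⟶ Z => R'.map f ≫ i.inv.app Z ≫ g) =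
      ((i.app Y).homFromEquiv (Z := V)) ∘ fun f : Y ⟶ Z => R.map f ≫ g := by
    ext f; simp
  rw [this, Function.Bijective.of_comp_iff' (Equiv.bijective _)]

/-- A functor that is fully faithful on the arrows from `V` to the image of `R` preserves and
reflects universality. -/
theorem isUniversalFrom_iff_map (T : E ⥤ E') {V : E}
    (hT : ∀ Y, Function.Bijective (T.map : (V ⟶ R.obj Y) → _)) {Z : C} (g : V ⟶ R.obj Z) :
    R.IsUniversalFrom g ↔ (R ⋙ T).IsUniversalFrom (T.map g) := by
  refine forall_congr' fun Y => ?_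
  have : (fun f : Z ⟶ Y => T.map g ≫ (R ⋙ T).map f) =
      T.map ∘ fun f : Z ⟶ Y => g ≫ R.map f := by
    ext f; simp
  rw [this, Function.Bijective.of_comp_iff' (hT Y)]

/-- A functor that is fully faithful on the arrows from the image of `R` to `V` preserves and
reflects universality. -/
theorem isUniversalTo_iff_map (T : E ⥤ E') {V : E}
    (hT : ∀ Y, Function.Bijective (T.map : (R.obj Y ⟶ V) → _)) {Z : C} (g : R.obj Z ⟶ V) :
    R.IsUniversalTo g ↔ (R ⋙ T).IsUniversalTo (T.map g) := by
  refine forall_congr' fun Y => ?_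
  have : (fun f : Y ⟶ Z => (R ⋙ T).map f ≫ T.map g) =
      T.map ∘ fun f : Y ⟶ Z => R.map f ≫ g := by
    ext f; simp
  rw [this, Function.Bijective.of_comp_iff' (hT Y)]

end CategoryTheory.Functor

namespace Deriv.Prederivator

variable (D : Prederivator.{u, v, w}) {A : Type u} [Category.{u} A] {B : Type u} [Category.{u} B]
  {K : Type u} [Category.{u} K] {K' : Type u} [Category.{u} K']

/-! ### Underlying diagrams -/

/-- The transformation between functors `1 ⥤ A` given by an arrow. -/
def ptMap {a b : A} (f : a ⟶ b) : pt a ⟶ pt b where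
  app _ := f
  naturality _ _ _ := by simp

/-- A functor sends the point `a` to the point `u a`. -/
def ptComp (a : A) (f : A ⥤ B) : pt a ⋙ f ≅ pt (f.obj a) :=
  NatIso.ofComponents (fun _ => Iso.refl _)

/-- The underlying diagram of a coherent diagram. -/
@[simps]
def underlying (X : D.diag A) : A ⥤ D.diag One.{u} where
  obj a := (D.res (pt a)).obj X
  map f := (D.resTrans (ptMap f)).app X
  map_id a := congrArg (fun t => t.app X) (D.resTrans_id (pt a))
  map_comp f g := congrArg (fun t => t.app X) (D.resTrans_comp (ptMap f) (ptMap g))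

/-- The underlying diagram of a restriction. -/
def underlyingRes (f : A ⥤ B) (X : D.diag B) :
    D.underlying ((D.res f).obj X) ≅ f ⋙ D.underlying X :=
  NatIso.ofComponents
    (fun a => (D.resComp (pt a) f).symm.app X ≪≫ (D.resIso (ptComp a f)).app X) (by
      intro a b g
      have h : Functor.whiskerRight (ptMap g) f ≫ (ptComp b f).hom =
        (ptComp a f).hom ≫ ptMap (f.map g) := by
        ext; simp [ptMap, ptComp]
      have h' := congrArg (fun t => (D.resTrans t).app X) h
      simp only [resTrans_comp, NatTrans.comp_app] at h'
      change (D.resTrans (ptMap g)).app ((D.res f).obj X) ≫ (D.resComp (pt b) f).inv.app X ≫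
        (D.resTrans (ptComp b f).hom).app X = ((D.resComp (pt a) f).inv.app X ≫
          (D.resTrans (ptComp a f).hom).app X) ≫ (D.resTrans (ptMap (f.map g))).app X
      simp [resTrans_app_res_obj, h'])

/-- The underlying diagrams of isomorphic coherent diagrams. -/
def underlyingMapIso {X Y : D.diag A} (e : X ≅ Y) : D.underlying X ≅ D.underlying Y :=
  NatIso.ofComponents (fun a => (D.res (pt a)).mapIso e)
    (fun f => ((D.resTrans (ptMap f)).naturality e.hom).symm)

/-! ### Colimiting cocones and limiting cones -/

/-- The coherent cocone obtained from a coherent diagram `X` on `B`, a functor `q : K ⥤ B` and a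
transformation from `q` to a constant functor. -/
def coconeMap {q : K ⥤ B} {b : B} (α : q ⟶ toOne K ⋙ pt b) (X : D.diag B) :
    (D.res q).obj X ⟶ (D.res (toOne K)).obj ((D.res (pt b)).obj X) :=
  (D.resTrans α).app X ≫ (D.resComp (toOne K) (pt b)).hom.app X

/-- The coherent cone obtained from a coherent diagram `X` on `B`, a functor `q : K ⥤ B` and a
transformation from a constant functor to `q`. -/
def coneMap {q : K ⥤ B} {b : B} (α : toOne K ⋙ pt b ⟶ q) (X : D.diag B) :
    (D.res (toOne K)).obj ((D.res (pt b)).obj X) ⟶ (D.res q).obj X :=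
  (D.resComp (toOne K) (pt b)).inv.app X ≫ (D.resTrans α).app X

/-- The value of `X` at `b` is the (homotopy) colimit of `q^* X`. -/
def IsColim {q : K ⥤ B} {b : B} (α : q ⟶ toOne K ⋙ pt b) (X : D.diag B) : Prop :=
  (D.res (toOne K)).IsUniversalFrom (D.coconeMap α X)

/-- The value of `X` at `b` is the (homotopy) limit of `q^* X`. -/
def IsLim {q : K ⥤ B} {b : B} (α : toOne K ⋙ pt b ⟶ q) (X : D.diag B) : Prop :=
  (D.res (toOne K)).IsUniversalTo (D.coneMap α X)

variable {D}

/-- A cocone in `f^* X` is colimiting if and only if its image under `f` is colimiting in `X`. The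
hypothesis on components, rather than an equality of transformations, accommodates the two
spellings of the constant functor. -/
theorem isColim_res_iff {q : K ⥤ A} {a : A} (α : q ⟶ toOne K ⋙ pt a) (f : A ⥤ B)
    (α' : q ⋙ f ⟶ toOne K ⋙ pt (f.obj a)) (hα : ∀ k, α'.app k = f.map (α.app k)) (X : D.diag B) :
    D.IsColim α ((D.res f).obj X) ↔ D.IsColim α' X := by
  refine Functor.isUniversalFrom_congr ((D.resComp q f).symm.app X)
    ((D.resComp (pt a) f).symm.app X ≪≫ (D.resIso (ptComp a f)).app X) ?_
  have h : Functor.whiskerRight α f ≫ Functor.whiskerLeft (toOne K) (ptComp a f).hom = α' := by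
    ext; simp [ptComp, hα]
  have h' := congrArg (fun t => (D.resTrans t).app X) h
  simp only [resTrans_comp] at h'
  simp [coconeMap, resComp_hom_app, resComp_inv_app, map_resTrans_app, resTrans_app_res_obj,
    eqToHom_map]
  exact (congrArg (eqToHom _ ≫ ·) (Category.assoc _ _ _).symm).trans
    (congrArg (fun t => eqToHom _ ≫ t ≫ eqToHom _) h')

/-- A cone in `f^* X` is limiting if and only if its image under `f` is limiting in `X`. -/
theorem isLim_res_iff {q : K ⥤ A} {a : A} (α : toOne K ⋙ pt a ⟶ q) (f : A ⥤ B)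
    (α' : toOne K ⋙ pt (f.obj a) ⟶ q ⋙ f) (hα : ∀ k, α'.app k = f.map (α.app k)) (X : D.diag B) :
    D.IsLim α ((D.res f).obj X) ↔ D.IsLim α' X := by
  refine Functor.isUniversalTo_congr ((D.resComp q f).symm.app X)
    ((D.resComp (pt a) f).symm.app X ≪≫ (D.resIso (ptComp a f)).app X) ?_
  have h : Functor.whiskerRight α f = Functor.whiskerLeft (toOne K) (ptComp a f).hom ≫ α' := by
    ext; simp [ptComp, hα]
  have h' := congrArg (fun t => (D.resTrans t).app X) h
  simp only [resTrans_comp] at h'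
  simp [coneMap, resComp_hom_app, resComp_inv_app, map_resTrans_app, resTrans_app_res_obj,
    eqToHom_map]
  exact congrArg (fun t => eqToHom _ ≫ t) h'

/-- Reindexing a cocone along `k` does not change whether it is colimiting, provided `k` is final
in the sense that `k^*` is fully faithful on the arrows to constant diagrams. -/
theorem isColim_whiskerLeft_iff (k : K ⥤ K') {q : K' ⥤ B} {b : B} (α : q ⟶ toOne K' ⋙ pt b)
    (X : D.diag B) (hk : ∀ Y, Function.Bijective ((D.res k).map :
      ((D.res q).obj X ⟶ (D.res (toOne K')).obj Y) → _)) :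
    D.IsColim (q := k ⋙ q) (b := b) (Functor.whiskerLeft k α) X ↔ D.IsColim α X := by
  refine Iff.trans ?_ (Functor.isUniversalFrom_iff_map (D.res k) hk _).symm
  refine (Functor.isUniversalFrom_iff_of_iso (D.resComp k (toOne K')) _).trans ?_
  refine Functor.isUniversalFrom_congr ((D.resComp k q).app X) (Iso.refl _) ?_
  simp [coconeMap, resComp_hom_app, resComp_inv_app, map_resTrans_app, eqToHom_map]

/-- Reindexing a cone along `k` does not change whether it is limiting, provided `k` is initial in
the sense that `k^*` is fully faithful on the arrows from constant diagrams. -/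
theorem isLim_whiskerLeft_iff (k : K ⥤ K') {q : K' ⥤ B} {b : B} (α : toOne K' ⋙ pt b ⟶ q)
    (X : D.diag B) (hk : ∀ Y, Function.Bijective ((D.res k).map :
      ((D.res (toOne K')).obj Y ⟶ (D.res q).obj X) → _)) :
    D.IsLim (q := k ⋙ q) (b := b) (Functor.whiskerLeft k α) X ↔ D.IsLim α X := by
  refine Iff.trans ?_ (Functor.isUniversalTo_iff_map (D.res k) hk _).symm
  refine (Functor.isUniversalTo_iff_of_iso (D.resComp k (toOne K')) _).trans ?_
  refine Functor.isUniversalTo_congr ((D.resComp k q).app X) (Iso.refl _) ?_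
  simp [coneMap, resComp_hom_app, resComp_inv_app, map_resTrans_app, eqToHom_map]

/-- Right adjoints are final. -/
theorem bijective_res_map_toOne_of_isRightAdjoint (k : K ⥤ K') [k.IsRightAdjoint]
    (V : D.diag K') (Y : D.diag One) :
    Function.Bijective ((D.res k).map : (V ⟶ (D.res (toOne K')).obj Y) → _) := by
  let adj := D.resAdjunction (Adjunction.ofIsRightAdjoint k)
  have h : IsIso (adj.unit.app ((D.res (toOne K')).obj Y)) := by
    let η := Functor.whiskerRight (Adjunction.ofIsRightAdjoint k).unit (toOne K')
    have : IsIso η := NatIso.isIso_of_isIso_app η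
    have h' : IsIso ((D.resTrans η).app Y) := inferInstance
    simp only [adj, resAdjunction, Adjunction.mkOfUnitCounit_unit, NatTrans.comp_app,
      resTrans_app_res_obj]
    infer_instance
  exact (adj.bijective_map_iff_isIso_unit _).2 h V

/-- Left adjoints are initial. -/
theorem bijective_res_map_toOne_of_isLeftAdjoint (k : K ⥤ K') [k.IsLeftAdjoint]
    (V : D.diag K') (Y : D.diag One) :
    Function.Bijective ((D.res k).map : ((D.res (toOne K')).obj Y ⟶ V) → _) := by
  let adj := D.resAdjunction (Adjunction.ofIsLeftAdjoint k)
  have h : IsIso (adj.counit.app ((D.res (toOne K')).obj Y)) := by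
    let η := Functor.whiskerRight (Adjunction.ofIsLeftAdjoint k).counit (toOne K')
    have : IsIso η := NatIso.isIso_of_isIso_app η
    have h' : IsIso ((D.resTrans η).app Y) := inferInstance
    simp only [adj, resAdjunction, Adjunction.mkOfUnitCounit_counit, NatTrans.comp_app,
      resTrans_app_res_obj]
    infer_instance
  exact (adj.bijective_map_iff_isIso_counit _).2 h V

end Deriv.Prederivator

namespace Deriv

/-! ### Final families -/

section Final

variable {A : Type u} [Category.{u} A] {B : Type u} [Category.{u} B]
  {K : Type u} [Category.{u} K]

/-- The slice `(f/b)` is computed by the diagram `q` of shape `K`: every object of the slice has a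
universal arrow to an object of `K`. -/
def IsFinalCocone (f : A ⥤ B) {b : B} {q : K ⥤ A} (α : q ⋙ f ⟶ toOne K ⋙ pt b) : Prop :=
  ∀ (a : A) (g : f.obj a ⟶ b), ∃ (r : K) (η : a ⟶ q.obj r), f.map η ≫ α.app r = g ∧
    ∀ (r' : K) (η' : a ⟶ q.obj r'), f.map η' ≫ α.app r' = g → ∃! h : r ⟶ r', η ≫ q.map h = η'

/-- The slice `(b/f)` is computed by the diagram `q` of shape `K`: every object of the slice has a
universal arrow from an object of `K`. -/
def IsInitialCone (f : A ⥤ B) {b : B} {q : K ⥤ A} (α : toOne K ⋙ pt b ⟶ q ⋙ f) : Prop :=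
  ∀ (a : A) (g : b ⟶ f.obj a), ∃ (r : K) (η : q.obj r ⟶ a), α.app r ≫ f.map η = g ∧
    ∀ (r' : K) (η' : q.obj r' ⟶ a), α.app r' ≫ f.map η' = g → ∃! h : r' ⟶ r, q.map h ≫ η = η'

/-- The functor from the shape of a cocone to the slice. -/
def toOver (f : A ⥤ B) {b : B} {q : K ⥤ A} (α : q ⋙ f ⟶ toOne K ⋙ pt b) :
    K ⥤ CostructuredArrow f b where
  obj r := CostructuredArrow.mk (Y := q.obj r) (α.app r)
  map h := CostructuredArrow.homMk (q.map h) ((α.naturality h).trans (Category.comp_id _))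

/-- The functor from the shape of a cone to the slice. -/
def toUnder (f : A ⥤ B) {b : B} {q : K ⥤ A} (α : toOne K ⋙ pt b ⟶ q ⋙ f) :
    K ⥤ StructuredArrow b f where
  obj r := StructuredArrow.mk (Y := q.obj r) (α.app r)
  map h := StructuredArrow.homMk (q.map h) ((α.naturality h).symm.trans (Category.id_comp _))

/-- A final family is a right adjoint into the slice: the universal arrows are the units. -/
theorem IsFinalCocone.isRightAdjoint {f : A ⥤ B} {b : B} {q : K ⥤ A}
    {α : q ⋙ f ⟶ toOne K ⋙ pt b} (h : IsFinalCocone f α) : (toOver f α).IsRightAdjoint := by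
  have : ∀ x, HasInitial (StructuredArrow x (toOver f α)) := by
    intro x
    obtain ⟨r, η, hη, hr⟩ := h x.left x.hom
    refine IsInitial.hasInitial (X := StructuredArrow.mk (Y := r) (S := x)
      (CostructuredArrow.homMk η hη)) ?_
    have key (y : StructuredArrow x (toOver f α)) :
        ∃! t : r ⟶ y.right, η ≫ q.map t = y.hom.left :=
      hr y.right y.hom.left (CostructuredArrow.w y.hom)
    exact IsInitial.ofUniqueHom
      (fun y => StructuredArrow.homMk (key y).choose
        (CostructuredArrow.hom_ext _ _ (key y).choose_spec.1))
      (fun y t => StructuredArrow.hom_ext _ _ ((key y).choose_spec.2 t.right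
        (congrArg CommaMorphism.left (StructuredArrow.w t))))
  exact isRightAdjointOfStructuredArrowInitials _

/-- An initial family is a left adjoint into the slice: the universal arrows are the counits. -/
theorem IsInitialCone.isLeftAdjoint {f : A ⥤ B} {b : B} {q : K ⥤ A}
    {α : toOne K ⋙ pt b ⟶ q ⋙ f} (h : IsInitialCone f α) : (toUnder f α).IsLeftAdjoint := by
  have : ∀ x, HasTerminal (CostructuredArrow (toUnder f α) x) := by
    intro x
    obtain ⟨r, η, hη, hr⟩ := h x.right x.hom
    refine IsTerminal.hasTerminal (X := CostructuredArrow.mk (Y := r) (T := x)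
      (StructuredArrow.homMk η hη)) ?_
    have key (y : CostructuredArrow (toUnder f α) x) :
        ∃! t : y.left ⟶ r, q.map t ≫ η = y.hom.right :=
      hr y.left y.hom.right (StructuredArrow.w y.hom)
    exact IsTerminal.ofUniqueHom
      (fun y => CostructuredArrow.homMk (key y).choose
        (StructuredArrow.hom_ext _ _ (key y).choose_spec.1))
      (fun y t => CostructuredArrow.hom_ext _ _ ((key y).choose_spec.2 t.left
        (congrArg CommaMorphism.right (CostructuredArrow.w t))))
  exact isLeftAdjoint_of_costructuredArrowTerminals _

end Final

namespace Prederivator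

variable (D : Prederivator.{u, v, w}) {A : Type u} [Category.{u} A] {B : Type u} [Category.{u} B]
  {C : Type u} [Category.{u} C] {K : Type u} [Category.{u} K]

/-! ### Kan extensions -/

/-- The coherent diagram `X` is the left Kan extension of its restriction along `f`. -/
def IsLKan (f : A ⥤ B) (X : D.diag B) : Prop :=
  ∀ Y, Function.Bijective ((D.res f).map : (X ⟶ Y) → _)

/-- The coherent diagram `X` is the right Kan extension of its restriction along `f`. -/
def IsRKan (f : A ⥤ B) (X : D.diag B) : Prop :=
  ∀ Y, Function.Bijective ((D.res f).map : (Y ⟶ X) → _)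

variable {D}

/-- The colimit formula for the values of left Kan extensions. -/
theorem IsDerivator.isUniversalFrom_unit_resSquare (hD : D.IsDerivator) (f : A ⥤ B) (b : B)
    {L : D.diag A ⥤ D.diag B} (adj : CategoryTheory.Adjunction L (D.res f)) (W : D.diag A) :
    (D.res (toOne (CostructuredArrow f b))).IsUniversalFrom
      ((D.res (CostructuredArrow.proj f b)).map (adj.unit.app W) ≫
        (D.resSquare (overSquare f b)).app (L.obj W)) := by
  let π := toOne (CostructuredArrow f b)
  have := hD.der3_left π
  let adj' := Adjunction.ofIsRightAdjoint (D.res π)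
  let β := TwoSquare.mk _ _ _ _ (D.resSquare (overSquare f b))
  have h₁ : IsIso ((CategoryTheory.mateEquiv adj adj').symm β).natTrans :=
    hD.der4_left f b _ adj _ adj'
  have h₂ := unit_mateEquiv_symm adj adj' β W
  have h₃ := (Functor.isUniversalFrom_comp_iff (adj'.isUniversalFrom_unit _)
    (((CategoryTheory.mateEquiv adj adj').symm β).natTrans.app W)).2 (NatIso.isIso_app_of_isIso _ _)
  exact h₂ ▸ h₃

/-- The values of a left Kan extension are the colimits over the slices. -/
theorem IsDerivator.isLKan_iff (hD : D.IsDerivator) (f : A ⥤ B) (X : D.diag B) :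
    D.IsLKan f X ↔ ∀ b, D.IsColim (overSquare f b) X := by
  have := hD.der3_left f
  let adj := Adjunction.ofIsRightAdjoint (D.res f)
  rw [IsLKan, adj.bijective_map_iff_isIso_counit, hD.der2]
  refine forall_congr' fun b => ?_
  let p := CostructuredArrow.proj f b
  have h₃ := hD.isUniversalFrom_unit_resSquare f b adj ((D.res f).obj X)
  refine (Functor.isUniversalFrom_comp_iff h₃ ((D.res (pt b)).map (adj.counit.app X))).symm.trans ?_
  refine Functor.isUniversalFrom_congr ((D.resComp p f).symm.app X) (Iso.refl _) ?_
  have h₄ : (D.resSquare (overSquare f b)).app ((D.res f).leftAdjoint.obj ((D.res f).obj X)) ≫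
      (D.res (toOne _)).map ((D.res (pt b)).map (adj.counit.app X)) =
      (D.res p).map ((D.res f).map (adj.counit.app X)) ≫
        (D.resSquare (overSquare f b)).app X :=
    ((D.resSquare (overSquare f b)).naturality (adj.counit.app X)).symm
  rw [Iso.refl_hom, CategoryTheory.Functor.map_id, Category.comp_id, Category.assoc, h₄,
    ← CategoryTheory.Functor.map_comp_assoc, adj.right_triangle_components]
  exact (congrArg (· ≫ _) (CategoryTheory.Functor.map_id (D.res p) _)).trans (Category.id_comp _)

/-- The limit formula for the values of right Kan extensions. -/
theorem IsDerivator.isUniversalTo_resSquare_counit (hD : D.IsDerivator) (f : A ⥤ B) (b : B)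
    {R : D.diag A ⥤ D.diag B} (adj : CategoryTheory.Adjunction (D.res f) R) (W : D.diag A) :
    (D.res (toOne (StructuredArrow b f))).IsUniversalTo
      ((D.resSquare (underSquare f b)).app (R.obj W) ≫
        (D.res (StructuredArrow.proj b f)).map (adj.counit.app W)) := by
  let π := toOne (StructuredArrow b f)
  have := hD.der3_right π
  let adj' := Adjunction.ofIsLeftAdjoint (D.res π)
  let β := TwoSquare.mk _ _ _ _ (D.resSquare (underSquare f b))
  have h₁ : IsIso (CategoryTheory.mateEquiv adj adj' β).natTrans :=
    hD.der4_right f b _ adj _ adj'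
  have h₂ := mateEquiv_counit adj adj' β W
  have h₃ := (Functor.isUniversalTo_comp_iff (adj'.isUniversalTo_counit _)
    ((CategoryTheory.mateEquiv adj adj' β).natTrans.app W)).2 (NatIso.isIso_app_of_isIso _ _)
  exact h₂ ▸ h₃

/-- The values of a right Kan extension are the limits over the slices. -/
theorem IsDerivator.isRKan_iff (hD : D.IsDerivator) (f : A ⥤ B) (X : D.diag B) :
    D.IsRKan f X ↔ ∀ b, D.IsLim (underSquare f b) X := by
  have := hD.der3_right f
  let adj := Adjunction.ofIsLeftAdjoint (D.res f)
  rw [IsRKan, adj.bijective_map_iff_isIso_unit, hD.der2]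
  refine forall_congr' fun b => ?_
  let p := StructuredArrow.proj b f
  have h₃ := hD.isUniversalTo_resSquare_counit f b adj ((D.res f).obj X)
  refine (Functor.isUniversalTo_comp_iff h₃ ((D.res (pt b)).map (adj.unit.app X))).symm.trans ?_
  refine Functor.isUniversalTo_congr ((D.resComp p f).symm.app X) (Iso.refl _) ?_
  have h₄ : (D.res (toOne _)).map ((D.res (pt b)).map (adj.unit.app X)) ≫
      (D.resSquare (underSquare f b)).app ((D.res f).rightAdjoint.obj ((D.res f).obj X)) =
      (D.resSquare (underSquare f b)).app X ≫
        (D.res p).map ((D.res f).map (adj.unit.app X)) :=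
    (D.resSquare (underSquare f b)).naturality (adj.unit.app X)
  rw [Iso.refl_hom, CategoryTheory.Functor.map_id, Category.id_comp, reassoc_of% h₄,
    ← CategoryTheory.Functor.map_comp, adj.left_triangle_components,
    CategoryTheory.Functor.map_id, Category.comp_id]
  simp [resSquare, coneMap, p]

/-- The colimit over the slice `(f/b)` can be computed on a final family. -/
theorem IsDerivator.isColim_overSquare_iff {f : A ⥤ B} {b : B} {q : K ⥤ A}
    {α : q ⋙ f ⟶ toOne K ⋙ pt b} (h : IsFinalCocone f α) (X : D.diag B) :
    D.IsColim (overSquare f b) X ↔ D.IsColim α X := by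
  have := h.isRightAdjoint
  exact (isColim_whiskerLeft_iff (toOver f α) (overSquare f b) X fun Y =>
    bijective_res_map_toOne_of_isRightAdjoint _ _ Y).symm

/-- The limit over the slice `(b/f)` can be computed on an initial family. -/
theorem IsDerivator.isLim_underSquare_iff {f : A ⥤ B} {b : B} {q : K ⥤ A}
    {α : toOne K ⋙ pt b ⟶ q ⋙ f} (h : IsInitialCone f α) (X : D.diag B) :
    D.IsLim (underSquare f b) X ↔ D.IsLim α X := by
  have := h.isLeftAdjoint
  exact (isLim_whiskerLeft_iff (toUnder f α) (underSquare f b) X fun Y =>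
    bijective_res_map_toOne_of_isLeftAdjoint _ _ Y).symm

end Prederivator

end Deriv

/-! ### Pointwise Kan extensions -/

namespace CategoryTheory.Functor

universe v₁ v₂ u₁ u₂

variable {C : Type u₁} [Category.{v₁} C] {E : Type u₂} [Category.{v₂} E] {R : C ⥤ E}
  [R.IsEquivalence]

theorem isUniversalFrom_iff_isIso {V : E} {Z : C} (g : V ⟶ R.obj Z) :
    R.IsUniversalFrom g ↔ IsIso g := by
  let i : V ≅ R.obj (R.inv.obj V) := R.asEquivalence.counitIso.symm.app V
  have h₁ : R.IsUniversalFrom i.hom :=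
    R.asEquivalence.symm.toAdjunction.isUniversalFrom_unit V
  have h₂ : g = i.hom ≫ R.map (R.preimage (i.inv ≫ g)) := by
    rw [R.map_preimage, Iso.hom_inv_id_assoc]
  constructor
  · intro h
    rw [h₂] at h
    have := (isUniversalFrom_comp_iff h₁ _).1 h
    rw [h₂]
    infer_instance
  · intro h Y
    have : (fun f : Z ⟶ Y => g ≫ R.map f) = ((asIso g).homFromEquiv (Z := R.obj Y)).symm ∘
        R.map := by
      ext f; simp
    rw [this]
    exact (Equiv.bijective _).comp ⟨R.map_injective, R.map_surjective⟩

theorem isUniversalTo_iff_isIso {V : E} {Z : C} (g : R.obj Z ⟶ V) :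
    R.IsUniversalTo g ↔ IsIso g := by
  let i : R.obj (R.inv.obj V) ≅ V := R.asEquivalence.counitIso.app V
  have h₁ : R.IsUniversalTo i.hom := R.asEquivalence.toAdjunction.isUniversalTo_counit V
  have h₂ : g = R.map (R.preimage (g ≫ i.inv)) ≫ i.hom := by
    rw [R.map_preimage, Category.assoc, Iso.inv_hom_id, Category.comp_id]
  constructor
  · intro h
    rw [h₂] at h
    have := (isUniversalTo_comp_iff h₁ _).1 h
    rw [h₂]
    infer_instance
  · intro h Y
    have : (fun f : Y ⟶ Z => R.map f ≫ g) = ((asIso g).homToEquiv (Z := R.obj Y)) ∘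
        R.map := by
      ext f; simp
    rw [this]
    exact (Equiv.bijective _).comp ⟨R.map_injective, R.map_surjective⟩

end CategoryTheory.Functor

namespace Deriv

/-- The inclusion of an object in the image of a fully faithful functor is final in its slice. -/
theorem isFinalCocone_pt {A : Type u} [Category.{u} A] {B : Type u} [Category.{u} B]
    (f : A ⥤ B) [f.Full] [f.Faithful] (a : A) :
    IsFinalCocone f (b := f.obj a) (q := pt a) (K := One.{u}) (Prederivator.ptComp a f).hom := by
  intro a' g
  refine ⟨⟨⟨⟩⟩, f.preimage g, (Category.comp_id _).trans (f.map_preimage g), ?_⟩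
  rintro ⟨⟨⟩⟩ η' h
  have h' : f.preimage g = η' := f.map_injective ((f.map_preimage g).trans
    (h.symm.trans (Category.comp_id _)))
  exact ⟨𝟙 _, (Category.comp_id _).trans h', fun _ _ => Subsingleton.elim _ _⟩

/-- The inclusion of an object in the image of a fully faithful functor is initial in its slice.
-/
theorem isInitialCone_pt {A : Type u} [Category.{u} A] {B : Type u} [Category.{u} B]
    (f : A ⥤ B) [f.Full] [f.Faithful] (a : A) :
    IsInitialCone f (b := f.obj a) (q := pt a) (K := One.{u}) (Prederivator.ptComp a f).inv := by
  intro a' g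
  refine ⟨⟨⟨⟩⟩, f.preimage g, (Category.id_comp _).trans (f.map_preimage g), ?_⟩
  rintro ⟨⟨⟩⟩ η' h
  have h' : f.preimage g = η' := f.map_injective ((f.map_preimage g).trans
    (h.symm.trans (Category.id_comp _)))
  exact ⟨𝟙 _, (Category.id_comp _).trans h', fun _ _ => Subsingleton.elim _ _⟩

namespace Prederivator

variable (D : Prederivator.{u, v, w}) {A : Type u} [Category.{u} A] {B : Type u} [Category.{u} B]
  {C : Type u} [Category.{u} C] {K : Type u} [Category.{u} K] {I : Type u} [Category.{u} I]

/-- Restriction along an equivalence is an equivalence. -/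
theorem isEquivalence_res (f : A ⥤ B) [f.IsEquivalence] : (D.res f).IsEquivalence := by
  let adj := D.resAdjunction f.asEquivalence.symm.toAdjunction
  have h₁ : ∀ X, IsIso (adj.unit.app X) := fun X => by
    have : IsIso (D.resTrans f.asEquivalence.symm.toAdjunction.unit) := inferInstance
    simp only [adj, resAdjunction, Adjunction.mkOfUnitCounit_unit, NatTrans.comp_app]
    infer_instance
  have h₂ : ∀ X, IsIso (adj.counit.app X) := fun X => by
    have : IsIso (D.resTrans f.asEquivalence.symm.toAdjunction.counit) := inferInstance
    simp only [adj, resAdjunction, Adjunction.mkOfUnitCounit_counit, NatTrans.comp_app]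
    infer_instance
  have := NatIso.isIso_of_isIso_app adj.unit
  have := NatIso.isIso_of_isIso_app adj.counit
  exact adj.toEquivalence.isEquivalence_functor

instance : (D.res (toOne One.{u})).IsEquivalence :=
  have : (toOne One.{u}).IsEquivalence :=
    { faithful := ⟨fun _ => Subsingleton.elim _ _⟩
      full := ⟨fun _ => ⟨Discrete.eqToHom (Subsingleton.elim _ _), Subsingleton.elim _ _⟩⟩
      essSurj := ⟨fun _ => ⟨⟨⟨⟩⟩, ⟨Iso.refl _⟩⟩⟩ }
  D.isEquivalence_res _

variable {D}

theorem isColim_of_isIso {b : B} {q : One.{u} ⥤ B} (α : q ⟶ toOne One.{u} ⋙ pt b) [IsIso α]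
    (X : D.diag B) : D.IsColim α X :=
  (Functor.isUniversalFrom_iff_isIso _).2 (by rw [coconeMap]; infer_instance)

theorem isLim_of_isIso {b : B} {q : One.{u} ⥤ B} (α : toOne One.{u} ⋙ pt b ⟶ q) [IsIso α]
    (X : D.diag B) : D.IsLim α X :=
  (Functor.isUniversalTo_iff_isIso _).2 (by rw [coneMap]; infer_instance)

/-- For fully faithful `f` the colimit formula is automatic at the objects in the image of `f`. -/
theorem isColim_overSquare_obj (f : A ⥤ B) [f.Full] [f.Faithful] (a : A) (X : D.diag B) :
    D.IsColim (overSquare f (f.obj a)) X :=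
  (IsDerivator.isColim_overSquare_iff (isFinalCocone_pt f a) X).2
    (have : IsIso (ptComp a f).hom := inferInstance
     isColim_of_isIso (b := f.obj a) (ptComp a f).hom X)

/-- For fully faithful `f` the limit formula is automatic at the objects in the image of `f`. -/
theorem isLim_underSquare_obj (f : A ⥤ B) [f.Full] [f.Faithful] (a : A) (X : D.diag B) :
    D.IsLim (underSquare f (f.obj a)) X :=
  (IsDerivator.isLim_underSquare_iff (isInitialCone_pt f a) X).2
    (have : IsIso (ptComp a f).inv := inferInstance
     isLim_of_isIso (b := f.obj a) (ptComp a f).inv X)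

theorem IsLKan.of_iso {f : A ⥤ B} {X Y : D.diag B} (h : D.IsLKan f X) (e : X ≅ Y) :
    D.IsLKan f Y := by
  intro Z
  have : ((D.res f).map : (Y ⟶ Z) → _) = (((D.res f).mapIso e).homFromEquiv
      (Z := (D.res f).obj Z)) ∘ (D.res f).map ∘ (e.homFromEquiv (Z := Z)).symm := by
    ext t; simp
  rw [this]
  exact (Equiv.bijective _).comp ((h Z).comp (Equiv.bijective _))

theorem IsRKan.of_iso {f : A ⥤ B} {X Y : D.diag B} (h : D.IsRKan f X) (e : X ≅ Y) :
    D.IsRKan f Y := by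
  intro Z
  have : ((D.res f).map : (Z ⟶ Y) → _) = (((D.res f).mapIso e).homToEquiv
      (Z := (D.res f).obj Z)) ∘ (D.res f).map ∘ (e.homToEquiv (Z := Z)).symm := by
    ext t; simp
  rw [this]
  exact (Equiv.bijective _).comp ((h Z).comp (Equiv.bijective _))

theorem bijective_res_comp_map_iff (f : A ⥤ B) (g : B ⥤ C) (X Y : D.diag C) :
    Function.Bijective ((D.res (f ⋙ g)).map : (X ⟶ Y) → _) ↔
      Function.Bijective fun t : X ⟶ Y => (D.res f).map ((D.res g).map t) := by
  rw [res_comp]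
  rfl

/-- Left Kan extension in stages. -/
theorem IsLKan.comp_iff {f : A ⥤ B} {g : B ⥤ C} {X : D.diag C}
    (h : D.IsLKan f ((D.res g).obj X)) : D.IsLKan (f ⋙ g) X ↔ D.IsLKan g X :=
  forall_congr' fun Y => (bijective_res_comp_map_iff f g X Y).trans
    (Function.Bijective.of_comp_iff' (h ((D.res g).obj Y)) _)

/-- Right Kan extension in stages. -/
theorem IsRKan.comp_iff {f : A ⥤ B} {g : B ⥤ C} {X : D.diag C}
    (h : D.IsRKan f ((D.res g).obj X)) : D.IsRKan (f ⋙ g) X ↔ D.IsRKan g X :=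
  forall_congr' fun Y => (bijective_res_comp_map_iff f g Y X).trans
    (Function.Bijective.of_comp_iff' (h ((D.res g).obj Y)) _)

/-- Left Kan extensions in `D^I` are formed pointwise: the slice of `f × I` over `(b, i)` contains
the slice of `f` over `b` as a final subcategory. -/
theorem IsDerivator.isLKan_prod_iff (hD : D.IsDerivator) (f : A ⥤ B) (X : D.diag (B × I)) :
    D.IsLKan (f.prod (𝟭 I)) X ↔ ∀ i, D.IsLKan f ((D.res (Prod.sectL B i)).obj X) := by
  simp only [hD.isLKan_iff]
  rw [Prod.forall, forall_comm]
  refine forall_congr' fun i => forall_congr' fun b => ?_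
  let q : CostructuredArrow f b ⥤ A × I := CostructuredArrow.proj f b ⋙ Prod.sectL A i
  let α : q ⋙ f.prod (𝟭 I) ⟶ toOne _ ⋙ pt (b, i) :=
    { app x := Prod.mkHom (x.hom) (𝟙 i)
      naturality _ _ g := Prod.ext ((overSquare f b).naturality g) rfl }
  have hα : IsFinalCocone (f.prod (𝟭 I)) α := by
    rintro ⟨a, j⟩ ⟨g, t⟩
    refine ⟨CostructuredArrow.mk g, Prod.mkHom (𝟙 a) (t), ?_, ?_⟩
    · exact Prod.ext ((congrArg (· ≫ g) (f.map_id a)).trans (Category.id_comp g))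
        (Category.comp_id t)
    · rintro x ⟨η, s⟩ h
      obtain ⟨h₁, h₂⟩ := Prod.ext_iff.1 h
      refine ⟨CostructuredArrow.homMk η h₁, ?_, ?_⟩
      · refine Prod.ext (Category.id_comp _) ?_
        exact (Category.comp_id _).trans (h₂.symm.trans (Category.comp_id _))
      · intro y hy
        exact CostructuredArrow.hom_ext _ _ ((Category.id_comp _).symm.trans
          (congrArg Prod.fst hy))
  rw [isColim_overSquare_iff hα]
  exact (isColim_res_iff (overSquare f b) (Prod.sectL B i) α (fun _ => rfl) X).symm

/-- Right Kan extensions in `D^I` are formed pointwise. -/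
theorem IsDerivator.isRKan_prod_iff (hD : D.IsDerivator) (f : A ⥤ B) (X : D.diag (B × I)) :
    D.IsRKan (f.prod (𝟭 I)) X ↔ ∀ i, D.IsRKan f ((D.res (Prod.sectL B i)).obj X) := by
  simp only [hD.isRKan_iff]
  rw [Prod.forall, forall_comm]
  refine forall_congr' fun i => forall_congr' fun b => ?_
  let q : StructuredArrow b f ⥤ A × I := StructuredArrow.proj b f ⋙ Prod.sectL A i
  let α : toOne _ ⋙ pt (b, i) ⟶ q ⋙ f.prod (𝟭 I) :=
    { app x := Prod.mkHom (x.hom) (𝟙 i)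
      naturality _ _ g := Prod.ext ((underSquare f b).naturality g) rfl }
  have hα : IsInitialCone (f.prod (𝟭 I)) α := by
    rintro ⟨a, j⟩ ⟨g, t⟩
    refine ⟨StructuredArrow.mk g, Prod.mkHom (𝟙 a) (t), ?_, ?_⟩
    · exact Prod.ext ((congrArg (g ≫ ·) (f.map_id a)).trans (Category.comp_id g))
        (Category.id_comp t)
    · rintro x ⟨η, s⟩ h
      obtain ⟨h₁, h₂⟩ := Prod.ext_iff.1 h
      refine ⟨StructuredArrow.homMk η h₁, ?_, ?_⟩
      · refine Prod.ext (Category.comp_id _) ?_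
        exact (Category.id_comp _).trans (h₂.symm.trans (Category.id_comp _))
      · intro y hy
        exact StructuredArrow.hom_ext _ _ ((Category.comp_id _).symm.trans
          (congrArg Prod.fst hy))
  rw [isLim_underSquare_iff hα]
  exact (isLim_res_iff (underSquare f b) (Prod.sectL B i) α (fun _ => rfl) X).symm

end Prederivator

end Deriv

/-! ### Kan extensions along fully faithful functors -/

namespace Deriv.Prederivator

variable {D : Prederivator.{u, v, w}} {A : Type u} [Category.{u} A] {B : Type u} [Category.{u} B]
  {C : Type u} [Category.{u} C] {K : Type u} [Category.{u} K]

/-- Left Kan extension along a fully faithful functor does not change the given values. -/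
theorem IsDerivator.isIso_unit (hD : D.IsDerivator) (f : A ⥤ B) [f.Full] [f.Faithful]
    {L : D.diag A ⥤ D.diag B} (adj : CategoryTheory.Adjunction L (D.res f)) (W : D.diag A) :
    IsIso (adj.unit.app W) := by
  rw [hD.der2]
  intro a
  let k := toOver f (ptComp a f).hom
  have := (isFinalCocone_pt f a).isRightAdjoint
  have h₁ := hD.isUniversalFrom_unit_resSquare f (f.obj a) adj W
  rw [Functor.isUniversalFrom_iff_map (D.res k)
      (fun Y => bijective_res_map_toOne_of_isRightAdjoint k _ Y)] at h₁
  have : (D.res (k ⋙ toOne _)).IsEquivalence :=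
    inferInstanceAs (D.res (toOne One.{u})).IsEquivalence
  have : (D.res (toOne _) ⋙ D.res k).IsEquivalence :=
    Functor.isEquivalence_of_iso (D.resComp k (toOne (CostructuredArrow f (f.obj a))))
  rw [Functor.isUniversalFrom_iff_isIso, CategoryTheory.Functor.map_comp] at h₁
  have h₂ : IsIso ((D.res k).map ((D.resSquare (overSquare f (f.obj a))).app (L.obj W))) := by
    have : IsIso (D.resTrans (Functor.whiskerLeft k (overSquare f (f.obj a)))) :=
      have : IsIso (ptComp a f).hom := inferInstance
      inferInstanceAs (IsIso (D.resTrans (ptComp a f).hom))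
    simp only [resSquare, NatTrans.comp_app, CategoryTheory.Functor.map_comp, map_resTrans_app]
    infer_instance
  have h₃ := @IsIso.of_isIso_comp_right _ _ _ _ _ _ _ h₂ h₁
  exact (NatIso.isIso_map_iff (D.resComp k (CostructuredArrow.proj f (f.obj a)))
    (adj.unit.app W)).2 h₃

/-- Right Kan extension along a fully faithful functor does not change the given values. -/
theorem IsDerivator.isIso_counit (hD : D.IsDerivator) (f : A ⥤ B) [f.Full] [f.Faithful]
    {R : D.diag A ⥤ D.diag B} (adj : CategoryTheory.Adjunction (D.res f) R) (W : D.diag A) :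
    IsIso (adj.counit.app W) := by
  rw [hD.der2]
  intro a
  let k := toUnder f (ptComp a f).inv
  have := (isInitialCone_pt f a).isLeftAdjoint
  have h₁ := hD.isUniversalTo_resSquare_counit f (f.obj a) adj W
  rw [Functor.isUniversalTo_iff_map (D.res k)
      (fun Y => bijective_res_map_toOne_of_isLeftAdjoint k _ Y)] at h₁
  have : (D.res (k ⋙ toOne _)).IsEquivalence :=
    inferInstanceAs (D.res (toOne One.{u})).IsEquivalence
  have : (D.res (toOne _) ⋙ D.res k).IsEquivalence :=
    Functor.isEquivalence_of_iso (D.resComp k (toOne (StructuredArrow (f.obj a) f)))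
  rw [Functor.isUniversalTo_iff_isIso, CategoryTheory.Functor.map_comp] at h₁
  have h₂ : IsIso ((D.res k).map ((D.resSquare (underSquare f (f.obj a))).app (R.obj W))) := by
    have : IsIso (D.resTrans (Functor.whiskerLeft k (underSquare f (f.obj a)))) :=
      have : IsIso (ptComp a f).inv := inferInstance
      inferInstanceAs (IsIso (D.resTrans (ptComp a f).inv))
    simp only [resSquare, NatTrans.comp_app, CategoryTheory.Functor.map_comp, map_resTrans_app]
    infer_instance
  have h₃ := @IsIso.of_isIso_comp_left _ _ _ _ _ _ _ h₂ h₁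
  exact (NatIso.isIso_map_iff (D.resComp k (StructuredArrow.proj (f.obj a) f))
    (adj.counit.app W)).2 h₃

/-- Every diagram extends along a fully faithful functor to a diagram that is a left Kan
extension. -/
theorem IsDerivator.exists_isLKan (hD : D.IsDerivator) (f : A ⥤ B) [f.Full] [f.Faithful]
    (W : D.diag A) : ∃ X, D.IsLKan f X ∧ Nonempty ((D.res f).obj X ≅ W) := by
  have := hD.der3_left f
  let adj := Adjunction.ofIsRightAdjoint (D.res f)
  have h := hD.isIso_unit f adj
  refine ⟨(D.res f).leftAdjoint.obj W, (adj.bijective_map_iff_isIso_counit _).2 ?_,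
    ⟨(asIso (adj.unit.app W)).symm⟩⟩
  rw [(IsIso.eq_inv_of_hom_inv_id (adj.left_triangle_components W))]
  infer_instance

/-- Every diagram extends along a fully faithful functor to a diagram that is a right Kan
extension. -/
theorem IsDerivator.exists_isRKan (hD : D.IsDerivator) (f : A ⥤ B) [f.Full] [f.Faithful]
    (W : D.diag A) : ∃ X, D.IsRKan f X ∧ Nonempty ((D.res f).obj X ≅ W) := by
  have := hD.der3_right f
  let adj := Adjunction.ofIsLeftAdjoint (D.res f)
  have h := hD.isIso_counit f adj
  refine ⟨(D.res f).rightAdjoint.obj W, (adj.bijective_map_iff_isIso_unit _).2 ?_,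
    ⟨asIso (adj.counit.app W)⟩⟩
  rw [(IsIso.eq_inv_of_inv_hom_id (adj.right_triangle_components W))]
  infer_instance

/-! ### Cartesian and cocartesian squares -/

instance : inclUL.{u}.Full := ⟨fun g => ⟨⟨⟨g.down.down⟩⟩, rfl⟩⟩
instance : inclUL.{u}.Faithful := ⟨fun _ => Subsingleton.elim _ _⟩
instance : inclLR.{u}.Full := ⟨fun g => ⟨⟨⟨g.down.down⟩⟩, rfl⟩⟩
instance : inclLR.{u}.Faithful := ⟨fun _ => Subsingleton.elim _ _⟩

/-- Since the inclusion of the span is fully faithful, the essential image of left Kan extension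
consists of the diagrams that are left Kan extended from their own restriction. -/
theorem IsDerivator.isCocartesian_iff (hD : D.IsDerivator) (X : D.diag Sq.{u}) :
    D.IsCocartesian X ↔ D.IsLKan inclUL X := by
  constructor
  · rintro ⟨L, adj, W, ⟨e⟩⟩
    have := hD.isIso_unit inclUL adj
    refine IsLKan.of_iso ((adj.bijective_map_iff_isIso_counit _).2 ?_) e
    rw [(IsIso.eq_inv_of_hom_inv_id (adj.left_triangle_components W))]
    infer_instance
  · intro h
    have := hD.der3_left inclUL.{u}
    let adj := Adjunction.ofIsRightAdjoint (D.res inclUL)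
    have := (adj.bijective_map_iff_isIso_counit X).1 h
    exact ⟨_, adj, _, ⟨asIso (adj.counit.app X)⟩⟩

/-- Since the inclusion of the cospan is fully faithful, the essential image of right Kan
extension consists of the diagrams that are right Kan extended from their own restriction. -/
theorem IsDerivator.isCartesian_iff (hD : D.IsDerivator) (X : D.diag Sq.{u}) :
    D.IsCartesian X ↔ D.IsRKan inclLR X := by
  constructor
  · rintro ⟨R, adj, W, ⟨e⟩⟩
    have := hD.isIso_counit inclLR adj
    refine IsRKan.of_iso ((adj.bijective_map_iff_isIso_unit _).2 ?_) e
    rw [(IsIso.eq_inv_of_inv_hom_id (adj.right_triangle_components W))]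
    infer_instance
  · intro h
    have := hD.der3_right inclLR.{u}
    let adj := Adjunction.ofIsLeftAdjoint (D.res inclLR)
    have := (adj.bijective_map_iff_isIso_unit X).1 h
    exact ⟨_, adj, _, ⟨(asIso (adj.unit.app X)).symm⟩⟩

/-- The final object of the square under the rest of the square. -/
def ulCocone (σ : Sq.{u} ⥤ B) : inclUL ⋙ σ ⟶ toOne SqUL ⋙ pt (σ.obj ⟨(1, 1)⟩) where
  app s := σ.map ⟨⟨show s.1.down ≤ (1, 1) from ⟨Fin.le_last _, Fin.le_last _⟩⟩⟩
  naturality _ _ g := by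
    refine Eq.trans ?_ (Category.comp_id _).symm
    rw [Functor.comp_map, ← σ.map_comp]
    rfl

/-- The initial object of the square over the rest of the square. -/
def lrCone (σ : Sq.{u} ⥤ B) : toOne SqLR ⋙ pt (σ.obj ⟨(0, 0)⟩) ⟶ inclLR ⋙ σ where
  app s := σ.map ⟨⟨show (0, 0) ≤ s.1.down from ⟨Fin.zero_le _, Fin.zero_le _⟩⟩⟩
  naturality _ _ g := by
    refine (Category.id_comp _).trans ?_
    rw [Functor.comp_map, ← σ.map_comp]
    rfl

/-- A square in a larger diagram is cocartesian if and only if its final corner is the colimit of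
the rest of the square. -/
theorem IsDerivator.isColim_ulCocone_iff (hD : D.IsDerivator) (σ : Sq.{u} ⥤ B) (X : D.diag B) :
    D.IsColim (ulCocone σ) X ↔ D.IsCocartesian ((D.res σ).obj X) := by
  have h : IsFinalCocone inclUL (K := SqUL) (b := ⟨(1, 1)⟩) (q := 𝟭 SqUL) (ulCocone (𝟭 Sq)) := by
    intro a g
    exact ⟨a, 𝟙 a, Subsingleton.elim _ _, fun r η _ => ⟨η, Subsingleton.elim _ _,
      fun _ _ => Subsingleton.elim _ _⟩⟩
  rw [hD.isCocartesian_iff, hD.isLKan_iff,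
    ← isColim_res_iff (ulCocone (𝟭 Sq)) σ (ulCocone σ) (fun _ => rfl) X]
  constructor
  · rintro h₁ ⟨b⟩
    by_cases hb : b = (1, 1)
    · subst hb
      exact (isColim_overSquare_iff h _).2 h₁
    · exact isColim_overSquare_obj inclUL ⟨⟨b⟩, hb⟩ _
  · exact fun h₁ => (isColim_overSquare_iff h _).1 (h₁ ⟨(1, 1)⟩)

/-- A square in a larger diagram is cartesian if and only if its initial corner is the limit of
the rest of the square. -/
theorem IsDerivator.isLim_lrCone_iff (hD : D.IsDerivator) (σ : Sq.{u} ⥤ B) (X : D.diag B) :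
    D.IsLim (lrCone σ) X ↔ D.IsCartesian ((D.res σ).obj X) := by
  have h : IsInitialCone inclLR (K := SqLR) (b := ⟨(0, 0)⟩) (q := 𝟭 SqLR) (lrCone (𝟭 Sq)) := by
    intro a g
    exact ⟨a, 𝟙 a, Subsingleton.elim _ _, fun r η _ => ⟨η, Subsingleton.elim _ _,
      fun _ _ => Subsingleton.elim _ _⟩⟩
  rw [hD.isCartesian_iff, hD.isRKan_iff,
    ← isLim_res_iff (lrCone (𝟭 Sq)) σ (lrCone σ) (fun _ => rfl) X]
  constructor
  · rintro h₁ ⟨b⟩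
    by_cases hb : b = (0, 0)
    · subst hb
      exact (isLim_underSquare_iff h _).2 h₁
    · exact isLim_underSquare_obj inclLR ⟨⟨b⟩, hb⟩ _
  · exact fun h₁ => (isLim_underSquare_iff h _).1 (h₁ ⟨(0, 0)⟩)

end Deriv.Prederivator

/-! ### Coproduct and product families -/

namespace CategoryTheory

universe v₁ u₁ v₂ u₂ w₁

variable {C : Type u₁} [Category.{v₁} C] {J : Type w₁} {X X' : J → C} {Z Z' : C}

/-- A family of arrows that exhibits its target as a coproduct. -/
def IsCoproductFamily (g : ∀ j, X j ⟶ Z) : Prop :=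
  ∀ Y : C, Function.Bijective fun (f : Z ⟶ Y) j => g j ≫ f

/-- A family of arrows that exhibits its source as a product. -/
def IsProductFamily (g : ∀ j, Z ⟶ X j) : Prop :=
  ∀ Y : C, Function.Bijective fun (f : Y ⟶ Z) j => f ≫ g j

theorem IsCoproductFamily.congr {g : ∀ j, X j ⟶ Z} {g' : ∀ j, X' j ⟶ Z'}
    (h : IsCoproductFamily g) (e : ∀ j, X j ≅ X' j) (e' : Z ≅ Z')
    (w : ∀ j, g j ≫ e'.hom = (e j).hom ≫ g' j) : IsCoproductFamily g' := by
  intro Y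
  have : (fun (f : Z' ⟶ Y) j => g' j ≫ f) = (Equiv.piCongrRight fun j =>
      ((e j).homFromEquiv (Z := Y))) ∘ (fun (f : Z ⟶ Y) j => g j ≫ f) ∘
        (e'.homFromEquiv (Z := Y)).symm := by
    ext f j
    simp [reassoc_of% w]
  rw [this]
  exact (Equiv.bijective _).comp ((h Y).comp (Equiv.bijective _))

theorem IsProductFamily.congr {g : ∀ j, Z ⟶ X j} {g' : ∀ j, Z' ⟶ X' j}
    (h : IsProductFamily g) (e : ∀ j, X j ≅ X' j) (e' : Z ≅ Z')
    (w : ∀ j, g j ≫ (e j).hom = e'.hom ≫ g' j) : IsProductFamily g' := by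
  intro Y
  have : (fun (f : Y ⟶ Z') j => f ≫ g' j) = (Equiv.piCongrRight fun j =>
      ((e j).homToEquiv (Z := Y))) ∘ (fun (f : Y ⟶ Z) j => f ≫ g j) ∘
        (e'.homToEquiv (Z := Y)).symm := by
    ext f j
    simp [w]
  rw [this]
  exact (Equiv.bijective _).comp ((h Y).comp (Equiv.bijective _))

theorem isProductFamily_iff_isLimit (g : ∀ j, Z ⟶ X j) :
    IsProductFamily g ↔ Nonempty (IsLimit (Fan.mk Z g)) := by
  constructor
  · intro h
    exact ⟨Fan.IsLimit.mk _ (fun t => ((h t.pt).2 t.proj).choose)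
      (fun t j => congrFun ((h t.pt).2 t.proj).choose_spec j)
      (fun t m hm => (h t.pt).1 ((funext hm).trans ((h t.pt).2 t.proj).choose_spec.symm))⟩
  · rintro ⟨h⟩ Y
    exact ⟨fun f f' hf => Fan.IsLimit.hom_ext h _ _ fun j => congrFun hf j,
      fun t => ⟨Fan.IsLimit.lift h t, funext fun j => Fan.IsLimit.fac h t j⟩⟩

theorem isCoproductFamily_iff_isInitial [IsEmpty J] (g : ∀ j, X j ⟶ Z) :
    IsCoproductFamily g ↔ Nonempty (IsInitial Z) := by
  constructor
  · intro h
    exact ⟨IsInitial.ofUniqueHom (fun Y => ((h Y).2 isEmptyElim).choose)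
      (fun Y m => (h Y).1 (Subsingleton.elim _ _))⟩
  · rintro ⟨h⟩ Y
    exact ⟨fun f f' _ => h.hom_ext _ _, fun t => ⟨h.to Y, Subsingleton.elim _ _⟩⟩

theorem isProductFamily_iff_isTerminal [IsEmpty J] (g : ∀ j, Z ⟶ X j) :
    IsProductFamily g ↔ Nonempty (IsTerminal Z) := by
  constructor
  · intro h
    exact ⟨IsTerminal.ofUniqueHom (fun Y => ((h Y).2 isEmptyElim).choose)
      (fun Y m => (h Y).1 (Subsingleton.elim _ _))⟩
  · rintro ⟨h⟩ Y
    exact ⟨fun f f' _ => h.hom_ext _ _, fun t => ⟨h.from Y, Subsingleton.elim _ _⟩⟩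

/-- Initial summands can be omitted. -/
theorem isCoproductFamily_iff_isIso (g : ∀ j, X j ⟶ Z) (j₀ : J)
    (h : ∀ j, j ≠ j₀ → Nonempty (IsInitial (X j))) : IsCoproductFamily g ↔ IsIso (g j₀) := by
  classical
  rw [isIso_iff_coyoneda_map_bijective]
  refine forall_congr' fun Y => ?_
  have h' : Function.Bijective fun t : (∀ j, X j ⟶ Y) => t j₀ := by
    constructor
    · intro t t' htt'
      funext j
      by_cases hj : j = j₀
      · subst hj; exact htt'
      · obtain ⟨hi⟩ := h j hj
        exact hi.hom_ext _ _
    · intro t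
      refine ⟨fun j => if hj : j = j₀ then eqToHom (by rw [hj]) ≫ t else (h j hj).some.to Y, ?_⟩
      simp
  rw [← Function.Bijective.of_comp_iff' h']
  rfl

/-- Terminal factors can be omitted. -/
theorem isProductFamily_iff_isIso (g : ∀ j, Z ⟶ X j) (j₀ : J)
    (h : ∀ j, j ≠ j₀ → Nonempty (IsTerminal (X j))) : IsProductFamily g ↔ IsIso (g j₀) := by
  classical
  rw [isIso_iff_yoneda_map_bijective]
  refine forall_congr' fun Y => ?_
  have h' : Function.Bijective fun t : (∀ j, Y ⟶ X j) => t j₀ := by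
    constructor
    · intro t t' htt'
      funext j
      by_cases hj : j = j₀
      · subst hj; exact htt'
      · obtain ⟨hi⟩ := h j hj
        exact hi.hom_ext _ _
    · intro t
      refine ⟨fun j => if hj : j = j₀ then t ≫ eqToHom (by rw [hj]) else (h j hj).some.from Y, ?_⟩
      simp
  rw [← Function.Bijective.of_comp_iff' h']
  rfl

end CategoryTheory

namespace Deriv.Prederivator

variable {D : Prederivator.{u, v, w}} {A : Type u} [Category.{u} A] {B : Type u} [Category.{u} B]
  {K : Type u} [Category.{u} K] {J : Type u}

/-! ### Diagrams of discrete shape -/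

/-- The comparison of the disjoint union of points with the discrete category. -/
def sigmaToDiscrete (J : Type u) : (Σ _ : J, One.{u}) ⥤ Discrete J :=
  Sigma.desc fun j => pt (Discrete.mk j)

instance (J : Type u) : (sigmaToDiscrete J).IsEquivalence where
  faithful := ⟨by
    rintro ⟨i, x⟩ ⟨_, y⟩ ⟨f⟩ ⟨g⟩ _
    exact congrArg Sigma.SigmaHom.mk (Subsingleton.elim _ _)⟩
  full := ⟨by
    rintro ⟨i, ⟨⟨⟩⟩⟩ ⟨j, ⟨⟨⟩⟩⟩ ⟨⟨h⟩⟩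
    have h' : i = j := h
    subst h'
    exact ⟨𝟙 _, Subsingleton.elim _ _⟩⟩
  essSurj := ⟨fun j => ⟨⟨j.as, ⟨⟨⟩⟩⟩, ⟨Iso.refl _⟩⟩⟩

/-- A coherent diagram of discrete shape is the same as the family of its values. -/
theorem IsDerivator.isEquivalence_discrete (hD : D.IsDerivator) (J : Type u) :
    (Functor.pi' fun j : J => D.res (pt (Discrete.mk j))).IsEquivalence := by
  have h : (Functor.pi' fun j : J => D.res (pt (Discrete.mk j))) = D.res (sigmaToDiscrete J) ⋙
      Functor.pi' fun j : J => D.res (Sigma.incl (C := fun _ => One.{u}) j) := by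
    change _ = Functor.pi' fun j : J => D.res (sigmaToDiscrete J) ⋙
      D.res (Sigma.incl (C := fun _ => One.{u}) j)
    refine congrArg Functor.pi' (funext fun j => ?_)
    exact D.res_comp (Sigma.incl (C := fun _ : J => One.{u}) j) (sigmaToDiscrete J)
  have h₁ := hD.der1 J (fun _ => One.{u})
  have h₂ := D.isEquivalence_res (sigmaToDiscrete J)
  rw [h]
  infer_instance

/-- The evaluation at a point of a constant diagram. -/
def constEval (D : Prederivator.{u, v, w}) (k : K) :
    D.res (toOne K) ⋙ D.res (pt k) ≅ 𝟭 (D.diag One.{u}) :=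
  (D.resComp (pt k) (toOne K)).symm ≪≫ D.resIso (NatIso.ofComponents (fun _ => Iso.refl _)) ≪≫
    D.resId One

/-- The transformation from a discrete diagram to a constant one given by a family of arrows. -/
def discCocone {t : J → B} {b : B} (g : ∀ j, t j ⟶ b) :
    Discrete.functor t ⟶ toOne (Discrete J) ⋙ pt b :=
  Discrete.natTrans fun j => g j.as

/-- The transformation from a constant diagram to a discrete one given by a family of arrows. -/
def discCone {t : J → B} {b : B} (g : ∀ j, b ⟶ t j) :
    toOne (Discrete J) ⋙ pt b ⟶ Discrete.functor t :=
  Discrete.natTrans fun j => g j.as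

/-- The components of the coherent cocone are the arrows of the underlying diagram. -/
theorem map_pt_coconeMap {q : K ⥤ B} {b : B} (α : q ⟶ toOne K ⋙ pt b) (X : D.diag B) (k : K) :
    (D.res (pt k)).map (D.coconeMap α X) ≫ (D.constEval k).hom.app _ =
      ((D.resComp (pt k) q).symm.app X ≪≫ (D.resIso (ptComp k q)).app X).hom ≫
        (D.underlying X).map (α.app k) := by
  have h : Functor.whiskerLeft (pt k) α ≫ Functor.whiskerRight
      (NatIso.ofComponents (fun _ => Iso.refl _) : pt k ⋙ toOne K ≅ 𝟭 _).hom (pt b) =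
      (ptComp k q).hom ≫ ptMap (α.app k) := by
    ext; simp [ptComp, ptMap]
  have h' := congrArg (fun t => (D.resTrans t).app X) h
  simp only [resTrans_comp] at h'
  simp [constEval, coconeMap, resComp_hom_app, resComp_inv_app, map_resTrans_app,
    resTrans_app_res_obj, eqToHom_map, resId_hom_app]
  exact (congrArg (eqToHom _ ≫ ·) h').trans (Category.assoc _ _ _).symm

/-- The components of the coherent cone are the arrows of the underlying diagram. -/
theorem coneMap_map_pt {q : K ⥤ B} {b : B} (α : toOne K ⋙ pt b ⟶ q) (X : D.diag B) (k : K) :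
    (D.res (pt k)).map (D.coneMap α X) ≫
        ((D.resComp (pt k) q).symm.app X ≪≫ (D.resIso (ptComp k q)).app X).hom =
      (D.constEval k).hom.app _ ≫ (D.underlying X).map (α.app k) := by
  have h : Functor.whiskerLeft (pt k) α ≫ (ptComp k q).hom = Functor.whiskerRight
      (NatIso.ofComponents (fun _ => Iso.refl _) : pt k ⋙ toOne K ≅ 𝟭 _).hom (pt b) ≫
        ptMap (α.app k) := by
    ext; simp [ptComp, ptMap]
  have h' := congrArg (fun t => (D.resTrans t).app X) h
  simp only [resTrans_comp] at h'
  simp [constEval, coneMap, resComp_hom_app, resComp_inv_app, map_resTrans_app,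
    resTrans_app_res_obj, eqToHom_map, resId_hom_app]
  exact (congrArg (eqToHom _ ≫ ·) h').trans (Category.assoc _ _ _).symm

/-- Colimits of discrete shape are coproducts of the underlying diagram. -/
theorem IsDerivator.isColim_discCocone_iff (hD : D.IsDerivator) {t : J → B} {b : B}
    (g : ∀ j, t j ⟶ b) (X : D.diag B) :
    D.IsColim (discCocone g) X ↔ IsCoproductFamily fun j => (D.underlying X).map (g j) := by
  have := hD.isEquivalence_discrete J
  let P := Functor.pi' fun j : J => D.res (pt (Discrete.mk j))
  refine forall_congr' fun Y => ?_
  let E := Equiv.piCongrRight fun j : J => (((D.resComp (pt (Discrete.mk j)) _).symm.app X ≪≫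
    (D.resIso (ptComp (Discrete.mk j) (Discrete.functor t))).app X).homFromEquiv.trans
      (((D.constEval (Discrete.mk j)).app Y).homToEquiv))
  have h₁ : Function.Bijective (P.map :
    ((D.res (Discrete.functor t)).obj X ⟶ (D.res (toOne (Discrete J))).obj Y) → _) :=
      ⟨P.map_injective, P.map_surjective⟩
  refine (Function.Bijective.of_comp_iff' h₁ _).symm.trans
    ((Function.Bijective.of_comp_iff' E.bijective (P.map ∘ _)).symm.trans
      (iff_of_eq (congrArg _ ?_)))
  funext f j
  have h₂ := map_pt_coconeMap (discCocone g) X (Discrete.mk j)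
  have h₃ : (D.res (pt (Discrete.mk j))).map ((D.res (toOne (Discrete J))).map f) ≫
      (D.constEval (Discrete.mk j)).hom.app Y = (D.constEval (Discrete.mk j)).hom.app _ ≫ f :=
    (D.constEval (Discrete.mk j)).hom.naturality f
  refine (Category.assoc _ _ _).trans ((Iso.inv_comp_eq ((D.resComp (pt (Discrete.mk j)) _).symm.app
    X ≪≫ (D.resIso (ptComp (Discrete.mk j) (Discrete.functor t))).app X)).2 ?_)
  change (D.res (pt (Discrete.mk j))).map (D.coconeMap (discCocone g) X ≫
    (D.res (toOne (Discrete J))).map f) ≫ (D.constEval (Discrete.mk j)).hom.app Y = _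
  rw [CategoryTheory.Functor.map_comp, Category.assoc, h₃, reassoc_of% h₂]
  exact Category.assoc _ _ _

/-- Limits of discrete shape are products of the underlying diagram. -/
theorem IsDerivator.isLim_discCone_iff (hD : D.IsDerivator) {t : J → B} {b : B}
    (g : ∀ j, b ⟶ t j) (X : D.diag B) :
    D.IsLim (discCone g) X ↔ IsProductFamily fun j => (D.underlying X).map (g j) := by
  have := hD.isEquivalence_discrete J
  let P := Functor.pi' fun j : J => D.res (pt (Discrete.mk j))
  refine forall_congr' fun Y => ?_
  let E := Equiv.piCongrRight fun j : J => (((D.constEval (Discrete.mk j)).app Y).homFromEquiv.trans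
    (((D.resComp (pt (Discrete.mk j)) _).symm.app X ≪≫
      (D.resIso (ptComp (Discrete.mk j) (Discrete.functor t))).app X).homToEquiv))
  have h₁ : Function.Bijective (P.map :
    ((D.res (toOne (Discrete J))).obj Y ⟶ (D.res (Discrete.functor t)).obj X) → _) :=
      ⟨P.map_injective, P.map_surjective⟩
  refine (Function.Bijective.of_comp_iff' h₁ _).symm.trans
    ((Function.Bijective.of_comp_iff' E.bijective (P.map ∘ _)).symm.trans
      (iff_of_eq (congrArg _ ?_)))
  funext f j
  have h₂ := coneMap_map_pt (discCone g) X (Discrete.mk j)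
  have h₃ : (D.res (pt (Discrete.mk j))).map ((D.res (toOne (Discrete J))).map f) ≫
      (D.constEval (Discrete.mk j)).hom.app _ = (D.constEval (Discrete.mk j)).hom.app Y ≫ f :=
    (D.constEval (Discrete.mk j)).hom.naturality f
  refine (Category.assoc _ _ _).trans ((Iso.inv_comp_eq ((D.constEval (Discrete.mk j)).app Y)).2 ?_)
  change (D.res (pt (Discrete.mk j))).map ((D.res (toOne (Discrete J))).map f ≫
    D.coneMap (discCone g) X) ≫ _ = (D.constEval (Discrete.mk j)).hom.app Y ≫ _
  rw [CategoryTheory.Functor.map_comp, Category.assoc, h₂]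
  exact (Category.assoc _ _ _).symm.trans
    ((congrArg (· ≫ (D.underlying X).map (g j)) h₃).trans (Category.assoc _ _ _))

end Deriv.Prederivator

/-! ### Finite biproducts -/

namespace CategoryTheory

open SemiadditiveOfBinaryBiproducts

universe v₁ u₁ w₁

attribute [local instance] addCommMonoidHomOfHasBinaryBiproducts

variable {C : Type u₁} [Category.{v₁} C] [HasZeroMorphisms C] [HasBinaryBiproducts C]
  {J : Type w₁} [Finite J] {X : J → C} {Z : C}

theorem SemiadditiveOfBinaryBiproducts.comp_sum {ι : Type*} {A B Y : C} (f : A ⟶ B)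
    (s : Finset ι) (g : ι → (B ⟶ Y)) : f ≫ ∑ j ∈ s, g j = ∑ j ∈ s, f ≫ g j := by
  classical
  induction s using Finset.induction_on with
  | empty => exact comp_zero
  | insert a s ha ih => rw [Finset.sum_insert ha, Finset.sum_insert ha, comp_add, ih]

theorem SemiadditiveOfBinaryBiproducts.sum_comp {ι : Type*} {A B Y : C} (f : B ⟶ Y)
    (s : Finset ι) (g : ι → (A ⟶ B)) : (∑ j ∈ s, g j) ≫ f = ∑ j ∈ s, g j ≫ f := by
  classical
  induction s using Finset.induction_on with
  | empty => exact zero_comp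
  | insert a s ha ih => rw [Finset.sum_insert ha, Finset.sum_insert ha, add_comp, ih]

/-- A finite orthogonal family of retracts is a coproduct if and only if it is a product: both
mean that the sum of the idempotents is the identity. -/
theorem isCoproductFamily_iff_isProductFamily (i : ∀ j, X j ⟶ Z) (p : ∀ j, Z ⟶ X j)
    (h₁ : ∀ j, i j ≫ p j = 𝟙 _) (h₀ : ∀ j k, j ≠ k → i j ≫ p k = 0) :
    IsCoproductFamily i ↔ IsProductFamily p := by
  classical
  cases nonempty_fintype J
  have hi (k : J) (Y : C) (t : ∀ j, X j ⟶ Y) : i k ≫ ∑ j, p j ≫ t j = t k := by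
    rw [comp_sum, Finset.sum_eq_single k]
    · rw [reassoc_of% h₁]
    · intro j _ hj
      rw [← Category.assoc, h₀ k j hj.symm, zero_comp]
    · simp
  have hp (k : J) (Y : C) (t : ∀ j, Y ⟶ X j) : (∑ j, t j ≫ i j) ≫ p k = t k := by
    rw [sum_comp, Finset.sum_eq_single k]
    · rw [Category.assoc, h₁, Category.comp_id]
    · intro j _ hj
      rw [Category.assoc, h₀ j k hj, comp_zero]
    · simp
  have hc : IsCoproductFamily i ↔ ∑ j, p j ≫ i j = 𝟙 Z := by
    constructor
    · intro h
      exact (h Z).1 (funext fun k => (hi k Z i).trans (Category.comp_id _).symm)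
    · intro h Y
      refine ⟨fun f f' hf => ?_, fun t => ⟨∑ j, p j ≫ t j, funext fun k => hi k Y t⟩⟩
      rw [← Category.id_comp f, ← Category.id_comp f', ← h, sum_comp, sum_comp]
      refine Finset.sum_congr rfl fun j _ => ?_
      rw [Category.assoc, Category.assoc, show i j ≫ f = i j ≫ f' from congrFun hf j]
  have hd : IsProductFamily p ↔ ∑ j, p j ≫ i j = 𝟙 Z := by
    constructor
    · intro h
      exact (h Z).1 (funext fun k => (hp k Z p).trans (Category.id_comp _).symm)
    · intro h Y
      refine ⟨fun f f' hf => ?_, fun t => ⟨∑ j, t j ≫ i j, funext fun k => hp k Y t⟩⟩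
      rw [← Category.comp_id f, ← Category.comp_id f', ← h, comp_sum, comp_sum]
      refine Finset.sum_congr rfl fun j _ => ?_
      rw [← Category.assoc, ← Category.assoc, show f ≫ p j = f' ≫ p j from congrFun hf j]
  rw [hc, hd]

end CategoryTheory

namespace Deriv.Prederivator

variable {D : Prederivator.{u, v, w}} {M : Type u} [Category.{u} M] {P Q : ObjectProperty M}

/-! ### Extension along inclusions of full subcategories -/

/-- The value of `X` at `b` is the colimit of its values on the objects over `b` that satisfy
`P`. -/
def ColimAt (D : Prederivator.{u, v, w}) (P : ObjectProperty M) (b : M) (X : D.diag M) : Prop :=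
  D.IsColim (overSquare P.ι b) X

/-- The value of `X` at `b` is the limit of its values on the objects under `b` that satisfy
`P`. -/
def LimAt (D : Prederivator.{u, v, w}) (P : ObjectProperty M) (b : M) (X : D.diag M) : Prop :=
  D.IsLim (underSquare P.ι b) X

/-- A diagram is left Kan extended from a full subcategory if and only if the colimit formula
holds at the remaining objects. -/
theorem IsDerivator.isLKan_ι_iff (hD : D.IsDerivator) (X : D.diag M) :
    D.IsLKan P.ι X ↔ ∀ b, ¬ P b → D.ColimAt P b X := by
  rw [hD.isLKan_iff]
  refine ⟨fun h b _ => h b, fun h b => ?_⟩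
  by_cases hb : P b
  · exact isColim_overSquare_obj P.ι ⟨b, hb⟩ X
  · exact h b hb

/-- A diagram is right Kan extended from a full subcategory if and only if the limit formula holds
at the remaining objects. -/
theorem IsDerivator.isRKan_ι_iff (hD : D.IsDerivator) (X : D.diag M) :
    D.IsRKan P.ι X ↔ ∀ b, ¬ P b → D.LimAt P b X := by
  rw [hD.isRKan_iff]
  refine ⟨fun h b _ => h b, fun h b => ?_⟩
  by_cases hb : P b
  · exact isLim_underSquare_obj P.ι ⟨b, hb⟩ X
  · exact h b hb

/-- For nested full subcategories `P ≤ Q` of `M`, left Kan extension from `P` to `Q` can be tested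
in `M`, since the slices over the objects of `Q` are the same. -/
theorem IsDerivator.isLKan_ιOfLE_iff (hD : D.IsDerivator) (h : P ≤ Q) (X : D.diag M) :
    D.IsLKan (ObjectProperty.ιOfLE h) ((D.res Q.ι).obj X) ↔
      ∀ b, Q b → ¬ P b → D.ColimAt P b X := by
  have key : ∀ b, D.IsColim (overSquare (ObjectProperty.ιOfLE h) b) ((D.res Q.ι).obj X) ↔
      D.ColimAt P b.obj X := by
    intro b
    let α : CostructuredArrow.proj P.ι b.obj ⋙ ObjectProperty.ιOfLE h ⟶ toOne _ ⋙ pt b :=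
      { app x := ObjectProperty.homMk x.hom
        naturality _ _ f := by
          ext
          exact (overSquare P.ι b.obj).naturality f }
    have hα : IsFinalCocone (ObjectProperty.ιOfLE h) α := by
      intro a g
      refine ⟨CostructuredArrow.mk (Y := a) g.hom, 𝟙 _, ?_, ?_⟩
      · ext
        exact Category.id_comp _
      · intro r η hη
        refine ⟨CostructuredArrow.homMk η (congrArg InducedCategory.Hom.hom hη),
          Category.id_comp _, fun y hy => ?_⟩
        exact CostructuredArrow.hom_ext _ _ ((Category.id_comp _).symm.trans hy)
    rw [isColim_overSquare_iff hα]
    exact isColim_res_iff α Q.ι (overSquare P.ι b.obj) (fun _ => rfl) X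
  rw [hD.isLKan_iff]
  constructor
  · exact fun h' b hb _ => (key ⟨b, hb⟩).1 (h' ⟨b, hb⟩)
  · rintro h' ⟨b, hQ⟩
    by_cases hb : P b
    · exact isColim_overSquare_obj (ObjectProperty.ιOfLE h) ⟨b, hb⟩ _
    · exact (key ⟨b, hQ⟩).2 (h' b hQ hb)

/-- For nested full subcategories `P ≤ Q` of `M`, right Kan extension from `P` to `Q` can be
tested in `M`, since the slices under the objects of `Q` are the same. -/
theorem IsDerivator.isRKan_ιOfLE_iff (hD : D.IsDerivator) (h : P ≤ Q) (X : D.diag M) :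
    D.IsRKan (ObjectProperty.ιOfLE h) ((D.res Q.ι).obj X) ↔
      ∀ b, Q b → ¬ P b → D.LimAt P b X := by
  have key : ∀ b, D.IsLim (underSquare (ObjectProperty.ιOfLE h) b) ((D.res Q.ι).obj X) ↔
      D.LimAt P b.obj X := by
    intro b
    let α : toOne _ ⋙ pt b ⟶ StructuredArrow.proj b.obj P.ι ⋙ ObjectProperty.ιOfLE h :=
      { app x := ObjectProperty.homMk x.hom
        naturality _ _ f := by
          ext
          exact (underSquare P.ι b.obj).naturality f }
    have hα : IsInitialCone (ObjectProperty.ιOfLE h) α := by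
      intro a g
      refine ⟨StructuredArrow.mk (Y := a) g.hom, 𝟙 _, ?_, ?_⟩
      · ext
        exact Category.comp_id _
      · intro r η hη
        refine ⟨StructuredArrow.homMk η (congrArg InducedCategory.Hom.hom hη),
          Category.comp_id _, fun y hy => ?_⟩
        exact StructuredArrow.hom_ext _ _ ((Category.comp_id _).symm.trans hy)
    rw [isLim_underSquare_iff hα]
    exact isLim_res_iff α Q.ι (underSquare P.ι b.obj) (fun _ => rfl) X
  rw [hD.isRKan_iff]
  constructor
  · exact fun h' b hb _ => (key ⟨b, hb⟩).1 (h' ⟨b, hb⟩)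
  · rintro h' ⟨b, hQ⟩
    by_cases hb : P b
    · exact isLim_underSquare_obj (ObjectProperty.ιOfLE h) ⟨b, hb⟩ _
    · exact (key ⟨b, hQ⟩).2 (h' b hQ hb)

theorem isColim_iff_of_iso {K : Type u} [Category.{u} K] {b : M} {q q' : K ⥤ M} (e : q ≅ q')
    (α : q ⟶ toOne K ⋙ pt b) (α' : q' ⟶ toOne K ⋙ pt b) (h : α = e.hom ≫ α') (X : D.diag M) :
    D.IsColim α X ↔ D.IsColim α' X := by
  refine Functor.isUniversalFrom_congr ((D.resIso e).app X) (Iso.refl _) ?_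
  subst h
  simp [coconeMap, resTrans_comp]

theorem isLim_iff_of_iso {K : Type u} [Category.{u} K] {b : M} {q q' : K ⥤ M} (e : q ≅ q')
    (α : toOne K ⋙ pt b ⟶ q) (α' : toOne K ⋙ pt b ⟶ q') (h : α' = α ≫ e.hom) (X : D.diag M) :
    D.IsLim α X ↔ D.IsLim α' X := by
  refine Functor.isUniversalTo_congr ((D.resIso e).app X) (Iso.refl _) ?_
  subst h
  simp [coneMap, resTrans_comp]

/-- If every arrow from an object of `P` to `b` factors uniquely through exactly one arrow of a
family, the colimit formula at `b` is a coproduct. -/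
theorem IsDerivator.colimAt_iff_isCoproductFamily (hD : D.IsDerivator) {J : Type u} {t : J → M}
    (ht : ∀ j, P (t j)) {b : M} (g : ∀ j, t j ⟶ b)
    (hg : ∀ a, P a → ∀ f : a ⟶ b, ∃! p : Σ j, (a ⟶ t j), p.2 ≫ g p.1 = f) (X : D.diag M) :
    D.ColimAt P b X ↔ IsCoproductFamily fun j => (D.underlying X).map (g j) := by
  rw [← hD.isColim_discCocone_iff]
  let q : Discrete J ⥤ P.FullSubcategory := Discrete.functor fun j => ⟨t j, ht j⟩
  let α : q ⋙ P.ι ⟶ toOne (Discrete J) ⋙ pt b := Discrete.natTrans fun j => g j.as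
  have hα : IsFinalCocone P.ι α := by
    intro a f
    obtain ⟨⟨j, η⟩, hη, hu⟩ := hg a.obj a.property f
    refine ⟨⟨j⟩, ObjectProperty.homMk η, hη, ?_⟩
    rintro ⟨j'⟩ η' hη'
    obtain ⟨rfl, h⟩ := Sigma.mk.inj_iff.1 (hu ⟨j', η'.hom⟩ hη')
    refine ⟨𝟙 _, ?_, fun _ _ => Subsingleton.elim _ _⟩
    ext
    exact (congrArg _ (congrArg InducedCategory.Hom.hom (q.map_id _))).trans
      ((Category.comp_id _).trans (eq_of_heq h).symm)
  refine (isColim_overSquare_iff hα X).trans ?_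
  exact isColim_iff_of_iso (q := q ⋙ P.ι) (q' := Discrete.functor t)
    (Discrete.natIso fun _ => Iso.refl _) α (discCocone g)
    (NatTrans.ext (funext fun _ => (Category.id_comp _).symm)) X

/-- If every arrow from `b` to an object of `P` factors uniquely through exactly one arrow of a
family, the limit formula at `b` is a product. -/
theorem IsDerivator.limAt_iff_isProductFamily (hD : D.IsDerivator) {J : Type u} {t : J → M}
    (ht : ∀ j, P (t j)) {b : M} (g : ∀ j, b ⟶ t j)
    (hg : ∀ a, P a → ∀ f : b ⟶ a, ∃! p : Σ j, (t j ⟶ a), g p.1 ≫ p.2 = f) (X : D.diag M) :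
    D.LimAt P b X ↔ IsProductFamily fun j => (D.underlying X).map (g j) := by
  rw [← hD.isLim_discCone_iff]
  let q : Discrete J ⥤ P.FullSubcategory := Discrete.functor fun j => ⟨t j, ht j⟩
  let α : toOne (Discrete J) ⋙ pt b ⟶ q ⋙ P.ι := Discrete.natTrans fun j => g j.as
  have hα : IsInitialCone P.ι α := by
    intro a f
    obtain ⟨⟨j, η⟩, hη, hu⟩ := hg a.obj a.property f
    refine ⟨⟨j⟩, ObjectProperty.homMk η, hη, ?_⟩
    rintro ⟨j'⟩ η' hη'
    obtain ⟨rfl, h⟩ := Sigma.mk.inj_iff.1 (hu ⟨j', η'.hom⟩ hη')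
    refine ⟨𝟙 _, ?_, fun _ _ => Subsingleton.elim _ _⟩
    ext
    exact (congrArg (· ≫ _) (congrArg InducedCategory.Hom.hom (q.map_id _))).trans
      ((Category.id_comp _).trans (eq_of_heq h).symm)
  refine (isLim_underSquare_iff hα X).trans ?_
  exact isLim_iff_of_iso (q := q ⋙ P.ι) (q' := Discrete.functor t)
    (Discrete.natIso fun _ => Iso.refl _) α (discCone g)
    (NatTrans.ext (funext fun _ => (Category.comp_id _).symm)) X

/-- If every arrow from an object of `P` to the final corner of a square factors through the rest
of the square in a universal way, the colimit formula says that the square is cocartesian. -/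
theorem IsDerivator.colimAt_iff_isCocartesian (hD : D.IsDerivator) (σ : Sq.{u} ⥤ M)
    (hσ : ∀ s, P ((inclUL ⋙ σ).obj s))
    (h : ∀ a, P a → ∀ f : a ⟶ σ.obj ⟨(1, 1)⟩, ∃ (r : SqUL.{u}) (η : a ⟶ (inclUL ⋙ σ).obj r),
      η ≫ (ulCocone σ).app r = f ∧ ∀ (r' : SqUL.{u}) (η' : a ⟶ (inclUL ⋙ σ).obj r'),
        η' ≫ (ulCocone σ).app r' = f → ∃ t : r ⟶ r', η ≫ (inclUL ⋙ σ).map t = η')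
    (X : D.diag M) :
    D.ColimAt P (σ.obj ⟨(1, 1)⟩) X ↔ D.IsCocartesian ((D.res σ).obj X) := by
  rw [← hD.isColim_ulCocone_iff]
  refine isColim_overSquare_iff (f := P.ι) (q := P.lift (inclUL ⋙ σ) hσ) (α := ulCocone σ) ?_ X
  intro a f
  obtain ⟨r, η, hη, hr⟩ := h a.obj a.property f
  refine ⟨r, ObjectProperty.homMk η, hη, fun r' η' hη' => ?_⟩
  obtain ⟨t, ht⟩ := hr r' η'.hom hη'
  exact ⟨t, ObjectProperty.hom_ext _ ht, fun _ _ => Subsingleton.elim _ _⟩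

/-- If every arrow from the initial corner of a square to an object of `P` factors through the rest
of the square in a universal way, the limit formula says that the square is cartesian. -/
theorem IsDerivator.limAt_iff_isCartesian (hD : D.IsDerivator) (σ : Sq.{u} ⥤ M)
    (hσ : ∀ s, P ((inclLR ⋙ σ).obj s))
    (h : ∀ a, P a → ∀ f : σ.obj ⟨(0, 0)⟩ ⟶ a, ∃ (r : SqLR.{u}) (η : (inclLR ⋙ σ).obj r ⟶ a),
      (lrCone σ).app r ≫ η = f ∧ ∀ (r' : SqLR.{u}) (η' : (inclLR ⋙ σ).obj r' ⟶ a),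
        (lrCone σ).app r' ≫ η' = f → ∃ t : r' ⟶ r, (inclLR ⋙ σ).map t ≫ η = η')
    (X : D.diag M) :
    D.LimAt P (σ.obj ⟨(0, 0)⟩) X ↔ D.IsCartesian ((D.res σ).obj X) := by
  rw [← hD.isLim_lrCone_iff]
  refine isLim_underSquare_iff (f := P.ι) (q := P.lift (inclLR ⋙ σ) hσ) (α := lrCone σ) ?_ X
  intro a f
  obtain ⟨r, η, hη, hr⟩ := h a.obj a.property f
  refine ⟨r, ObjectProperty.homMk η, hη, fun r' η' hη' => ?_⟩
  obtain ⟨t, ht⟩ := hr r' η'.hom hη'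
  exact ⟨t, ObjectProperty.hom_ext _ ht, fun _ _ => Subsingleton.elim _ _⟩

end Deriv.Prederivator

/-! ### Pairs of arrows -/

namespace CategoryTheory

universe v₁ u₁ w₁

variable {C : Type u₁} [Category.{v₁} C]

/-- A pair of objects, as a family. -/
def pairObj (x y : C) : ULift.{w₁} Bool → C
  | ⟨true⟩ => x
  | ⟨false⟩ => y

/-- A pair of arrows with common target, as a family. -/
def pairTo {x y b : C} (f : x ⟶ b) (g : y ⟶ b) : ∀ j : ULift.{w₁} Bool, pairObj x y j ⟶ b
  | ⟨true⟩ => f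
  | ⟨false⟩ => g

/-- A pair of arrows with common source, as a family. -/
def pairFrom {x y b : C} (f : b ⟶ x) (g : b ⟶ y) : ∀ j : ULift.{w₁} Bool, b ⟶ pairObj x y j
  | ⟨true⟩ => f
  | ⟨false⟩ => g

/-- If exactly one of `g` and `h` divides `f`, and in a unique way, then `f` factors uniquely
through exactly one arrow of the pair. -/
theorem existsUnique_pairTo {x y b a : C} {g : x ⟶ b} {h : y ⟶ b} {f : a ⟶ b}
    (H : ((∃! e : a ⟶ x, e ≫ g = f) ∧ ∀ e : a ⟶ y, e ≫ h ≠ f) ∨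
      ((∃! e : a ⟶ y, e ≫ h = f) ∧ ∀ e : a ⟶ x, e ≫ g ≠ f)) :
    ∃! p : Σ j : ULift.{w₁} Bool, (a ⟶ pairObj x y j), p.2 ≫ pairTo g h p.1 = f := by
  rcases H with ⟨⟨e, he, hu⟩, h'⟩ | ⟨⟨e, he, hu⟩, h'⟩
  · refine ⟨⟨⟨true⟩, e⟩, he, ?_⟩
    rintro ⟨⟨_ | _⟩, e'⟩ he'
    · exact (h' e' he').elim
    · rw [hu e' he']
  · refine ⟨⟨⟨false⟩, e⟩, he, ?_⟩
    rintro ⟨⟨_ | _⟩, e'⟩ he'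
    · rw [hu e' he']
    · exact (h' e' he').elim

/-- If exactly one of `g` and `h` divides `f`, and in a unique way, then `f` factors uniquely
through exactly one arrow of the pair. -/
theorem existsUnique_pairFrom {x y b a : C} {g : b ⟶ x} {h : b ⟶ y} {f : b ⟶ a}
    (H : ((∃! e : x ⟶ a, g ≫ e = f) ∧ ∀ e : y ⟶ a, h ≫ e ≠ f) ∨
      ((∃! e : y ⟶ a, h ≫ e = f) ∧ ∀ e : x ⟶ a, g ≫ e ≠ f)) :
    ∃! p : Σ j : ULift.{w₁} Bool, (pairObj x y j ⟶ a), pairFrom g h p.1 ≫ p.2 = f := by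
  rcases H with ⟨⟨e, he, hu⟩, h'⟩ | ⟨⟨e, he, hu⟩, h'⟩
  · refine ⟨⟨⟨true⟩, e⟩, he, ?_⟩
    rintro ⟨⟨_ | _⟩, e'⟩ he'
    · exact (h' e' he').elim
    · rw [hu e' he']
  · refine ⟨⟨⟨false⟩, e⟩, he, ?_⟩
    rintro ⟨⟨_ | _⟩, e'⟩ he'
    · rw [hu e' he']
    · exact (h' e' he').elim

theorem isCoproductFamily_pairTo_iff {x y b : C} (f : x ⟶ b) (g : y ⟶ b) :
    IsCoproductFamily (pairTo.{v₁, u₁, w₁} f g) ↔ Nonempty (IsColimit (BinaryCofan.mk f g)) := by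
  constructor
  · intro h
    refine ⟨BinaryCofan.IsColimit.mk _
      (fun s t => ((h _).2 (pairTo.{v₁, u₁, w₁} s t)).choose) ?_ ?_ ?_⟩
    · exact fun s t => congrFun ((h _).2 (pairTo.{v₁, u₁, w₁} s t)).choose_spec ⟨true⟩
    · exact fun s t => congrFun ((h _).2 (pairTo.{v₁, u₁, w₁} s t)).choose_spec ⟨false⟩
    · intro Y s t m h₁ h₂
      refine (h _).1 (Eq.trans (funext ?_) ((h _).2 (pairTo.{v₁, u₁, w₁} s t)).choose_spec.symm)
      rintro ⟨_ | _⟩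
      exacts [h₂, h₁]
  · rintro ⟨h⟩ Y
    constructor
    · intro s t hst
      exact BinaryCofan.IsColimit.hom_ext h (congrFun hst ⟨true⟩) (congrFun hst ⟨false⟩)
    · intro s
      obtain ⟨l, h₁, h₂⟩ := BinaryCofan.IsColimit.desc' h (s ⟨true⟩) (s ⟨false⟩)
      refine ⟨l, funext ?_⟩
      rintro ⟨_ | _⟩
      exacts [h₂, h₁]

theorem isProductFamily_pairFrom_iff {x y b : C} (f : b ⟶ x) (g : b ⟶ y) :
    IsProductFamily (pairFrom.{v₁, u₁, w₁} f g) ↔ Nonempty (IsLimit (BinaryFan.mk f g)) := by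
  constructor
  · intro h
    refine ⟨BinaryFan.IsLimit.mk _
      (fun s t => ((h _).2 (pairFrom.{v₁, u₁, w₁} s t)).choose) ?_ ?_ ?_⟩
    · exact fun s t => congrFun ((h _).2 (pairFrom.{v₁, u₁, w₁} s t)).choose_spec ⟨true⟩
    · exact fun s t => congrFun ((h _).2 (pairFrom.{v₁, u₁, w₁} s t)).choose_spec ⟨false⟩
    · intro Y s t m h₁ h₂
      refine (h _).1 (Eq.trans (funext ?_) ((h _).2 (pairFrom.{v₁, u₁, w₁} s t)).choose_spec.symm)
      rintro ⟨_ | _⟩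
      exacts [h₂, h₁]
  · rintro ⟨h⟩ Y
    constructor
    · intro s t hst
      exact BinaryFan.IsLimit.hom_ext h (congrFun hst ⟨true⟩) (congrFun hst ⟨false⟩)
    · intro s
      obtain ⟨l, h₁, h₂⟩ := BinaryFan.IsLimit.lift' h (s ⟨true⟩) (s ⟨false⟩)
      refine ⟨l, funext ?_⟩
      rintro ⟨_ | _⟩
      exacts [h₂, h₁]

theorem isCoproductFamily_map_pairTo_iff {E : Type*} [Category* E] (F : C ⥤ E) {x y b : C}
    (f : x ⟶ b) (g : y ⟶ b) : (IsCoproductFamily fun j : ULift.{w₁} Bool => F.map (pairTo f g j)) ↔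
      IsCoproductFamily (pairTo (F.map f) (F.map g) : ∀ _j : ULift.{w₁} Bool, _) := by
  let e : ∀ _j : ULift.{w₁} Bool, F.obj (pairObj x y _j) ≅ pairObj (F.obj x) (F.obj y) _j
    | ⟨true⟩ => Iso.refl _
    | ⟨false⟩ => Iso.refl _
  refine ⟨fun h => h.congr e (Iso.refl _) ?_, fun h => h.congr (fun j => (e j).symm)
    (Iso.refl _) ?_⟩
  all_goals
    rintro ⟨_ | _⟩ <;> exact (Category.comp_id _).trans (Category.id_comp _).symm

theorem isProductFamily_map_pairFrom_iff {E : Type*} [Category* E] (F : C ⥤ E) {x y b : C}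
    (f : b ⟶ x) (g : b ⟶ y) : (IsProductFamily fun j : ULift.{w₁} Bool => F.map (pairFrom f g j)) ↔
      IsProductFamily (pairFrom (F.map f) (F.map g) : ∀ _j : ULift.{w₁} Bool, _) := by
  let e : ∀ _j : ULift.{w₁} Bool, F.obj (pairObj x y _j) ≅ pairObj (F.obj x) (F.obj y) _j
    | ⟨true⟩ => Iso.refl _
    | ⟨false⟩ => Iso.refl _
  refine ⟨fun h => h.congr e (Iso.refl _) ?_, fun h => h.congr (fun j => (e j).symm)
    (Iso.refl _) ?_⟩
  all_goals
    rintro ⟨_ | _⟩ <;> exact (Category.comp_id _).trans (Category.id_comp _).symm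

/-- A coproduct that is also a product, with invertible diagonal and zero off-diagonal components,
is a biproduct. -/
theorem hasBinaryBiproduct_of_families [HasZeroMorphisms C] {x y x' y' b : C} {i : x ⟶ b}
    {j : y ⟶ b} {p : b ⟶ x'} {q : b ⟶ y'} (hc : IsCoproductFamily (pairTo.{v₁, u₁, w₁} i j))
    (hd : IsProductFamily (pairFrom.{v₁, u₁, w₁} p q)) (h₁ : IsIso (i ≫ p)) (h₂ : IsIso (j ≫ q))
    (h₃ : i ≫ q = 0) (h₄ : j ≫ p = 0) : HasBinaryBiproduct x y := by
  let B : BinaryBicone x y :=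
    { pt := b
      fst := p ≫ inv (i ≫ p)
      snd := q ≫ inv (j ≫ q)
      inl := i
      inr := j
      inl_fst := by rw [← Category.assoc, IsIso.hom_inv_id]
      inl_snd := by rw [← Category.assoc, h₃, zero_comp]
      inr_fst := by rw [← Category.assoc, h₄, zero_comp]
      inr_snd := by rw [← Category.assoc, IsIso.hom_inv_id] }
  have hd' : IsProductFamily (pairFrom.{v₁, u₁, w₁} (p ≫ inv (i ≫ p)) (q ≫ inv (j ≫ q))) := by
    refine hd.congr (fun k => match k with
      | ⟨true⟩ => (asIso (i ≫ p)).symm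
      | ⟨false⟩ => (asIso (j ≫ q)).symm) (Iso.refl _) ?_
    rintro ⟨_ | _⟩
    · exact (Category.id_comp _).symm
    · exact (Category.id_comp _).symm
  obtain ⟨hc⟩ := (isCoproductFamily_pairTo_iff i j).1 hc
  obtain ⟨hd⟩ := (isProductFamily_pairFrom_iff _ _).1 hd'
  exact HasBinaryBiproduct.mk ⟨B, ⟨hd, hc⟩⟩

end CategoryTheory

namespace Deriv.Prederivator

variable {D : Prederivator.{u, v, w}} {M : Type u} [Category.{u} M] {P Q : ObjectProperty M}

/-- The colimit formula over an empty slice says that the value is initial. -/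
theorem IsDerivator.colimAt_iff_isInitial (hD : D.IsDerivator) {b : M}
    (h : ∀ a, P a → ∀ _ : a ⟶ b, False) (X : D.diag M) :
    D.ColimAt P b X ↔ Nonempty (IsInitial ((D.underlying X).obj b)) :=
  (hD.colimAt_iff_isCoproductFamily (J := PEmpty) (t := PEmpty.elim) (fun j => j.elim)
    (fun j => j.elim) (fun a ha f => (h a ha f).elim) X).trans (isCoproductFamily_iff_isInitial _)

/-- The limit formula over an empty slice says that the value is terminal. -/
theorem IsDerivator.limAt_iff_isTerminal (hD : D.IsDerivator) {b : M}
    (h : ∀ a, P a → ∀ _ : b ⟶ a, False) (X : D.diag M) :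
    D.LimAt P b X ↔ Nonempty (IsTerminal ((D.underlying X).obj b)) :=
  (hD.limAt_iff_isProductFamily (J := PEmpty) (t := PEmpty.elim) (fun j => j.elim)
    (fun j => j.elim) (fun a ha f => (h a ha f).elim) X).trans (isProductFamily_iff_isTerminal _)

/-- Kan extension in stages: once the values on `Q` are right Kan extended from `P`, the limit
formulas over `P` and over `Q` agree for the remaining objects, jointly. -/
theorem IsDerivator.forall_limAt_iff (hD : D.IsDerivator) (hPQ : P ≤ Q) (X : D.diag M)
    (h : ∀ b, Q b → ¬ P b → D.LimAt P b X) :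
    (∀ b, ¬ Q b → D.LimAt P b X) ↔ ∀ b, ¬ Q b → D.LimAt Q b X := by
  have h₁ := ((hD.isRKan_ιOfLE_iff hPQ X).2 h).comp_iff
  rw [← hD.isRKan_ι_iff, ← h₁]
  refine Iff.trans ?_ (hD.isRKan_ι_iff (P := P) X).symm
  refine ⟨fun h' b hb => ?_, fun h' b hb => h' b fun hb' => hb (hPQ _ hb')⟩
  by_cases hQ : Q b
  · exact h b hQ hb
  · exact h' b hQ

/-- Kan extension in stages: once the values on `Q` are left Kan extended from `P`, the colimit
formulas over `P` and over `Q` agree for the remaining objects, jointly. -/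
theorem IsDerivator.forall_colimAt_iff (hD : D.IsDerivator) (hPQ : P ≤ Q) (X : D.diag M)
    (h : ∀ b, Q b → ¬ P b → D.ColimAt P b X) :
    (∀ b, ¬ Q b → D.ColimAt P b X) ↔ ∀ b, ¬ Q b → D.ColimAt Q b X := by
  have h₁ := ((hD.isLKan_ιOfLE_iff hPQ X).2 h).comp_iff
  rw [← hD.isLKan_ι_iff, ← h₁]
  refine Iff.trans ?_ (hD.isLKan_ι_iff (P := P) X).symm
  refine ⟨fun h' b hb => ?_, fun h' b hb => h' b fun hb' => hb (hPQ _ hb')⟩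
  by_cases hQ : Q b
  · exact h b hQ hb
  · exact h' b hQ

section Preorder

variable {T : Type u} [Preorder T] {P : ObjectProperty T}

/-- In a preorder, if every element of `P` below `b` lies below exactly one of `x` and `y`, the
colimit formula at `b` says that the value is the coproduct of the values at `x` and `y`. -/
theorem IsDerivator.colimAt_iff_pair (hD : D.IsDerivator) {x y b : T} (hx : P x) (hy : P y)
    (f : x ⟶ b) (g : y ⟶ b)
    (h : ∀ a, P a → a ≤ b → (a ≤ x ∨ a ≤ y) ∧ ¬ (a ≤ x ∧ a ≤ y)) (X : D.diag T) :
    D.ColimAt P b X ↔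
      IsCoproductFamily (pairTo.{v, w, u} ((D.underlying X).map f) ((D.underlying X).map g)) := by
  refine (hD.colimAt_iff_isCoproductFamily (J := ULift Bool) (t := pairObj x y) ?_
    (pairTo f g) ?_ X).trans (isCoproductFamily_map_pairTo_iff _ f g)
  · rintro ⟨_ | _⟩
    exacts [hy, hx]
  · intro a ha e
    apply existsUnique_pairTo
    obtain ⟨h₁ | h₁, h₂⟩ := h a ha (leOfHom e)
    · exact .inl ⟨⟨homOfLE h₁, Subsingleton.elim _ _, fun _ _ => Subsingleton.elim _ _⟩,
        fun e' _ => h₂ ⟨h₁, leOfHom e'⟩⟩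
    · exact .inr ⟨⟨homOfLE h₁, Subsingleton.elim _ _, fun _ _ => Subsingleton.elim _ _⟩,
        fun e' _ => h₂ ⟨leOfHom e', h₁⟩⟩

/-- In a preorder, if every element of `P` above `b` lies above exactly one of `x` and `y`, the
limit formula at `b` says that the value is the product of the values at `x` and `y`. -/
theorem IsDerivator.limAt_iff_pair (hD : D.IsDerivator) {x y b : T} (hx : P x) (hy : P y)
    (f : b ⟶ x) (g : b ⟶ y)
    (h : ∀ a, P a → b ≤ a → (x ≤ a ∨ y ≤ a) ∧ ¬ (x ≤ a ∧ y ≤ a)) (X : D.diag T) :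
    D.LimAt P b X ↔
      IsProductFamily (pairFrom.{v, w, u} ((D.underlying X).map f) ((D.underlying X).map g)) := by
  refine (hD.limAt_iff_isProductFamily (J := ULift Bool) (t := pairObj x y) ?_
    (pairFrom f g) ?_ X).trans (isProductFamily_map_pairFrom_iff _ f g)
  · rintro ⟨_ | _⟩
    exacts [hy, hx]
  · intro a ha e
    apply existsUnique_pairFrom
    obtain ⟨h₁ | h₁, h₂⟩ := h a ha (leOfHom e)
    · exact .inl ⟨⟨homOfLE h₁, Subsingleton.elim _ _, fun _ _ => Subsingleton.elim _ _⟩,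
        fun e' _ => h₂ ⟨h₁, leOfHom e'⟩⟩
    · exact .inr ⟨⟨homOfLE h₁, Subsingleton.elim _ _, fun _ _ => Subsingleton.elim _ _⟩,
        fun e' _ => h₂ ⟨leOfHom e', h₁⟩⟩

end Preorder

end Deriv.Prederivator

/-! ### Products from cartesian squares -/

namespace Deriv.Prederivator

variable {D : Prederivator.{u, v, w}}

/-- The limit over an empty slice is terminal. -/
theorem IsDerivator.isLim_underSquare_iff_isTerminal (hD : D.IsDerivator) {A : Type u}
    [Category.{u} A] {B : Type u} [Category.{u} B] (f : A ⥤ B) (b : B)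
    (h : ∀ a, ∀ _ : b ⟶ f.obj a, False) (X : D.diag B) :
    D.IsLim (underSquare f b) X ↔ Nonempty (IsTerminal ((D.underlying X).obj b)) := by
  let q : Discrete PEmpty.{u + 1} ⥤ A := Discrete.functor PEmpty.elim
  let t : PEmpty.{u + 1} → B := PEmpty.elim
  let α : toOne _ ⋙ pt b ⟶ q ⋙ f := Discrete.natTrans fun j => j.as.elim
  have hα : IsInitialCone f α := fun a g => (h a g).elim
  refine (isLim_underSquare_iff hα X).trans ((isLim_iff_of_iso (q := q ⋙ f)
    (q' := Discrete.functor t) (Discrete.natIso fun j => j.as.elim) α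
      (discCone fun j => j.elim) (by ext ⟨j⟩; exact j.elim) X).trans ?_)
  exact (hD.isLim_discCone_iff _ X).trans (isProductFamily_iff_isTerminal _)

/-- A square with terminal final corner is cartesian if and only if its initial corner is the
product of the two intermediate ones. -/
theorem IsDerivator.isCartesian_iff_isProductFamily (hD : D.IsDerivator) (X : D.diag Sq.{u})
    (hX : IsTerminal ((D.underlying X).obj ⟨(1, 1)⟩))
    (f : (⟨(0, 0)⟩ : Sq.{u}) ⟶ ⟨(1, 0)⟩) (g : (⟨(0, 0)⟩ : Sq.{u}) ⟶ ⟨(0, 1)⟩) :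
    D.IsCartesian X ↔
      IsProductFamily (pairFrom.{v, w, u} ((D.underlying X).map f) ((D.underlying X).map g)) := by
  let P : ObjectProperty Sq.{u} := fun s => s.down = (1, 0) ∨ s.down = (0, 1)
  let Q : ObjectProperty Sq.{u} := fun s => s.down ≠ (0, 0)
  have hPQ : P ≤ Q := fun s => (by decide :
    ∀ p : Fin 2 × Fin 2, p = (1, 0) ∨ p = (0, 1) → p ≠ (0, 0)) s.down
  have hQ : ∀ b, ¬ Q b → b = ⟨(0, 0)⟩ := fun b hb => ULift.ext _ _ (not_not.1 hb)
  have h₁ : ∀ b, Q b → ¬ P b → D.LimAt P b X := by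
    intro b hb hb'
    have hb : b = ⟨(1, 1)⟩ := ULift.ext _ _ ((by decide : ∀ p : Fin 2 × Fin 2, p ≠ (0, 0) →
      ¬ (p = (1, 0) ∨ p = (0, 1)) → p = (1, 1)) b.down hb hb')
    subst hb
    refine (hD.limAt_iff_isTerminal (fun a ha e => ?_) X).2 ⟨hX⟩
    exact (by decide : ∀ p : Fin 2 × Fin 2, p = (1, 0) ∨ p = (0, 1) → ¬ (1, 1) ≤ p) a.down ha
      (show (⟨(1, 1)⟩ : Sq.{u}) ≤ a from leOfHom e)
  have h₂ := hD.forall_limAt_iff hPQ X h₁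
  have h₃ : D.LimAt P ⟨(0, 0)⟩ X ↔ D.LimAt Q ⟨(0, 0)⟩ X :=
    ⟨fun h => h₂.1 (fun b hb => by rw [hQ b hb]; exact h) _ (fun h => h rfl),
      fun h => h₂.2 (fun b hb => by rw [hQ b hb]; exact h) _ (fun h => h rfl)⟩
  have h₄ : D.LimAt Q ⟨(0, 0)⟩ X ↔ D.IsCartesian ((D.res (𝟭 _)).obj X) := by
    refine hD.limAt_iff_isCartesian (P := Q) (𝟭 Sq) (fun s => s.2) (fun a ha e => ?_) X
    exact ⟨⟨a, ha⟩, 𝟙 _, Subsingleton.elim _ _, fun r η _ => ⟨homOfLE (leOfHom η),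
      Subsingleton.elim _ _⟩⟩
  rw [res_id] at h₄
  refine h₄.symm.trans (h₃.symm.trans ?_)
  exact hD.limAt_iff_pair (.inl rfl) (.inr rfl) f g (fun a ha _ => (by decide :
    ∀ p : Fin 2 × Fin 2, p = (1, 0) ∨ p = (0, 1) →
      ((1, 0) ≤ p ∨ (0, 1) ≤ p) ∧ ¬ ((1, 0) ≤ p ∧ (0, 1) ≤ p)) a.down ha) X

/-! ### Biproducts -/

/-- The poset `{0, 1, 2} × {0, 1, 2}` without its least element. -/
abbrev Grid : Type u := {x : ULift.{u} (Fin 3 × Fin 3) // x.down ≠ (0, 0)}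

/-- An element of the grid. -/
abbrev gridMk (p : Fin 3 × Fin 3) (h : p ≠ (0, 0)) : Grid.{u} := ⟨⟨p⟩, h⟩

/-- The two outer edges of the grid. -/
def gridEdges : ObjectProperty Grid.{u} := fun x =>
  x.1.down = (0, 1) ∨ x.1.down = (0, 2) ∨ x.1.down = (1, 0) ∨ x.1.down = (2, 0)

/-- The grid without its greatest element. -/
def gridLower : ObjectProperty Grid.{u} := fun x => x.1.down ≠ (2, 2)

/-- The square of the four greatest elements of the grid. -/
def gridSquare : Sq.{u} ⥤ Grid.{u} :=
  Monotone.functor (f := fun s => gridMk (s.down.1.succ, s.down.2.succ)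
    (fun h => Fin.succ_ne_zero _ (congrArg Prod.fst h)))
    (fun _ _ h => ⟨Fin.succ_le_succ_iff.2 h.1, Fin.succ_le_succ_iff.2 h.2⟩)

/-- A pair of objects as a diagram on the grid edges. -/
def gridPoints : Discrete (ULift.{u} Bool) ⥤ gridEdges.{u}.FullSubcategory :=
  Discrete.functor (pairObj ⟨gridMk (0, 1) (by decide), .inl rfl⟩
    ⟨gridMk (1, 0) (by decide), .inr (.inr (.inl rfl))⟩)

instance : gridPoints.{u}.Faithful := ⟨fun _ => Subsingleton.elim _ _⟩

instance : gridPoints.{u}.Full := ⟨by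
  rintro ⟨⟨_ | _⟩⟩ ⟨⟨_ | _⟩⟩ g
  · exact ⟨𝟙 _, rfl⟩
  · exact absurd (leOfHom g.hom) (by decide : ¬ ((1, 0) : Fin 3 × Fin 3) ≤ (0, 1))
  · exact absurd (leOfHom g.hom) (by decide : ¬ ((0, 1) : Fin 3 × Fin 3) ≤ (1, 0))
  · exact ⟨𝟙 _, rfl⟩⟩

/-- Any two objects are the values of a coherent diagram on the grid edges whose other values are
terminal. -/
theorem IsDerivator.exists_gridEdges (hD : D.IsDerivator) (W₁ W₂ : D.diag One.{u}) :
    ∃ Y : D.diag gridEdges.{u}.FullSubcategory,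
      Nonempty ((D.underlying Y).obj ⟨gridMk (0, 1) (by decide), .inl rfl⟩ ≅ W₁) ∧
      Nonempty ((D.underlying Y).obj ⟨gridMk (1, 0) (by decide), .inr (.inr (.inl rfl))⟩ ≅ W₂) ∧
      Nonempty (IsTerminal ((D.underlying Y).obj
        ⟨gridMk (0, 2) (by decide), .inr (.inl rfl)⟩)) ∧
      Nonempty (IsTerminal ((D.underlying Y).obj
        ⟨gridMk (2, 0) (by decide), .inr (.inr (.inr rfl))⟩)) := by
  have := hD.isEquivalence_discrete (ULift.{u} Bool)
  let F := Functor.pi' fun j : ULift.{u} Bool => D.res (pt (Discrete.mk j))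
  let V := F.objPreimage (pairObj W₁ W₂)
  obtain ⟨Y, hY, ⟨e'⟩⟩ := hD.exists_isRKan gridPoints V
  have h₁ (j : ULift.{u} Bool) :
      Nonempty ((D.underlying Y).obj (gridPoints.obj ⟨j⟩) ≅ pairObj W₁ W₂ j) :=
    ⟨(underlyingRes D gridPoints Y).symm.app ⟨j⟩ ≪≫ (underlyingMapIso D e').app ⟨j⟩ ≪≫
      Pi.isoApp (F.objObjPreimageIso (pairObj W₁ W₂)) j⟩
  have h₂ := (hD.isRKan_iff _ _).1 hY
  refine ⟨Y, h₁ ⟨true⟩, h₁ ⟨false⟩, (hD.isLim_underSquare_iff_isTerminal _ _ ?_ _).1 (h₂ _),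
    (hD.isLim_underSquare_iff_isTerminal _ _ ?_ _).1 (h₂ _)⟩
  · rintro ⟨⟨_ | _⟩⟩ g
    · exact absurd (leOfHom g.hom) (by decide : ¬ ((0, 2) : Fin 3 × Fin 3) ≤ (1, 0))
    · exact absurd (leOfHom g.hom) (by decide : ¬ ((0, 2) : Fin 3 × Fin 3) ≤ (0, 1))
  · rintro ⟨⟨_ | _⟩⟩ g
    · exact absurd (leOfHom g.hom) (by decide : ¬ ((2, 0) : Fin 3 × Fin 3) ≤ (1, 0))
    · exact absurd (leOfHom g.hom) (by decide : ¬ ((2, 0) : Fin 3 × Fin 3) ≤ (0, 1))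

end Deriv.Prederivator

namespace Deriv.StableDerivator

open Prederivator

variable (D : StableDerivator.{u, v, w})

theorem isZero_of_isTerminal {X : D.toPrederivator.diag One.{u}} (h : Nonempty (IsTerminal X)) :
    IsZero X := by
  have := D.hasZeroObject
  open ZeroObject in
  exact (isZero_zero _).of_iso (h.some.uniqueUpToIso (isZero_zero _).isTerminal)

theorem isZero_of_isInitial {X : D.toPrederivator.diag One.{u}} (h : Nonempty (IsInitial X)) :
    IsZero X := by
  have := D.hasZeroObject
  open ZeroObject in
  exact (isZero_zero _).of_iso (h.some.uniqueUpToIso (isZero_zero _).isInitial)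

/-- The underlying category of a stable derivator has biproducts: in the diagram on the grid
generated by the two objects placed at `(0, 1)` and `(1, 0)` and zero objects at `(0, 2)` and
`(2, 0)`, the value at `(1, 1)` is the coproduct by construction, and it is the product since the
square of the four greatest elements is cocartesian, hence cartesian, and its other values are
the two objects and zero. -/
theorem hasBinaryBiproducts [HasZeroMorphisms (D.toPrederivator.diag One.{u})] :
    HasBinaryBiproducts (D.toPrederivator.diag One.{u}) := by
  refine ⟨fun W₁ W₂ => ?_⟩
  have hD := D.isDerivator
  obtain ⟨Y, ⟨e₁⟩, ⟨e₂⟩, h₁, h₂⟩ := hD.exists_gridEdges W₁ W₂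
  obtain ⟨X, hX, ⟨e⟩⟩ := hD.exists_isLKan gridEdges.ι Y
  let U := D.toPrederivator.underlying X
  have eY (x : gridEdges.{u}.FullSubcategory) : U.obj x.obj ≅
      (D.toPrederivator.underlying Y).obj x :=
    (underlyingRes _ gridEdges.ι X).symm.app x ≪≫ (underlyingMapIso _ e).app x
  have hz₁ := (D.isZero_of_isTerminal h₁).of_iso (eY _)
  have hz₂ := (D.isZero_of_isTerminal h₂).of_iso (eY _)
  have hX' := (hD.isLKan_ι_iff X).1 hX
  let g01 : Grid.{u} := gridMk (0, 1) (by decide)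
  let g02 : Grid.{u} := gridMk (0, 2) (by decide)
  let g10 : Grid.{u} := gridMk (1, 0) (by decide)
  let g20 : Grid.{u} := gridMk (2, 0) (by decide)
  let g11 : Grid.{u} := gridMk (1, 1) (by decide)
  let g12 : Grid.{u} := gridMk (1, 2) (by decide)
  let g21 : Grid.{u} := gridMk (2, 1) (by decide)
  let g22 : Grid.{u} := gridMk (2, 2) (by decide)
  have P01 : gridEdges g01 := .inl rfl
  have P02 : gridEdges g02 := .inr (.inl rfl)
  have P10 : gridEdges g10 := .inr (.inr (.inl rfl))
  have P20 : gridEdges g20 := .inr (.inr (.inr rfl))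
  have hom {p q : Fin 3 × Fin 3} (hp hq) (h : p ≤ q) : gridMk.{u} p hp ⟶ gridMk q hq :=
    homOfLE h
  have npe {p : Fin 3 × Fin 3} {hp} (h : ¬ (p = (0, 1) ∨ p = (0, 2) ∨ p = (1, 0) ∨ p = (2, 0))) :
      ¬ gridEdges (gridMk.{u} p hp) := h
  let i₁ : g01 ⟶ g11 := hom _ _ (by decide)
  let i₂ : g10 ⟶ g11 := hom _ _ (by decide)
  let q₁ : g11 ⟶ g21 := hom _ _ (by decide)
  let q₂ : g11 ⟶ g12 := hom _ _ (by decide)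
  -- Each of the values at `(1, 1)`, `(2, 1)`, `(1, 2)`, `(2, 2)` is a coproduct of two edge values.
  have c11 := (hD.colimAt_iff_pair P01 P10 i₁ i₂ (fun a => (by decide : ∀ p : Fin 3 × Fin 3,
    (p = (0, 1) ∨ p = (0, 2) ∨ p = (1, 0) ∨ p = (2, 0)) → p ≤ (1, 1) →
      (p ≤ (0, 1) ∨ p ≤ (1, 0)) ∧ ¬ (p ≤ (0, 1) ∧ p ≤ (1, 0))) a.1.down) X).1
    (hX' g11 (npe (by decide)))
  have c21 := (hD.colimAt_iff_pair P01 P20 (i₁ ≫ q₁) (hom _ _ (by decide) : g20 ⟶ g21)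
    (fun a => (by decide : ∀ p : Fin 3 × Fin 3,
    (p = (0, 1) ∨ p = (0, 2) ∨ p = (1, 0) ∨ p = (2, 0)) → p ≤ (2, 1) →
      (p ≤ (0, 1) ∨ p ≤ (2, 0)) ∧ ¬ (p ≤ (0, 1) ∧ p ≤ (2, 0))) a.1.down) X).1
    (hX' g21 (npe (by decide)))
  have c12 := (hD.colimAt_iff_pair P10 P02 (i₂ ≫ q₂) (hom _ _ (by decide) : g02 ⟶ g12)
    (fun a => (by decide : ∀ p : Fin 3 × Fin 3,
    (p = (0, 1) ∨ p = (0, 2) ∨ p = (1, 0) ∨ p = (2, 0)) → p ≤ (1, 2) →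
      (p ≤ (1, 0) ∨ p ≤ (0, 2)) ∧ ¬ (p ≤ (1, 0) ∧ p ≤ (0, 2))) a.1.down) X).1
    (hX' g12 (npe (by decide)))
  have c22 := (hD.colimAt_iff_pair P02 P20 (hom _ _ (by decide) : g02 ⟶ g22)
    (hom _ _ (by decide) : g20 ⟶ g22) (fun a => (by decide : ∀ p : Fin 3 × Fin 3,
    (p = (0, 1) ∨ p = (0, 2) ∨ p = (1, 0) ∨ p = (2, 0)) → p ≤ (2, 2) →
      (p ≤ (0, 2) ∨ p ≤ (2, 0)) ∧ ¬ (p ≤ (0, 2) ∧ p ≤ (2, 0))) a.1.down) X).1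
    (hX' g22 (npe (by decide)))
  have iso₁ : IsIso (U.map (i₁ ≫ q₁)) := by
    refine (isCoproductFamily_iff_isIso _ ⟨true⟩ ?_).1 c21
    rintro ⟨_ | _⟩ hj
    exacts [⟨hz₂.isInitial⟩, (hj rfl).elim]
  have iso₂ : IsIso (U.map (i₂ ≫ q₂)) := by
    refine (isCoproductFamily_iff_isIso _ ⟨true⟩ ?_).1 c12
    rintro ⟨_ | _⟩ hj
    exacts [⟨hz₁.isInitial⟩, (hj rfl).elim]
  have iso₃ : IsIso (U.map (hom _ _ (by decide) : g02 ⟶ g22)) := by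
    refine (isCoproductFamily_iff_isIso _ ⟨true⟩ ?_).1 c22
    rintro ⟨_ | _⟩ hj
    exacts [⟨hz₂.isInitial⟩, (hj rfl).elim]
  have hz₃ : IsZero (U.obj g22) := hz₁.of_iso (@asIso _ _ _ _ _ iso₃).symm
  -- Extending from the edges in two stages shows that the value at `(2, 2)` is a pushout.
  have le : gridEdges.{u} ≤ gridLower := fun a => (by decide : ∀ p : Fin 3 × Fin 3,
    (p = (0, 1) ∨ p = (0, 2) ∨ p = (1, 0) ∨ p = (2, 0)) → p ≠ (2, 2)) a.1.down
  have c := (hD.forall_colimAt_iff le X (fun b _ hb => hX' b hb)).1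
    (fun b hb => hX' b fun hb' => hb (le _ hb')) g22 (fun h => h rfl)
  have c' : D.toPrederivator.IsCocartesian ((D.toPrederivator.res gridSquare).obj X) := by
    refine (hD.colimAt_iff_isCocartesian (P := gridLower) gridSquare ?_ ?_ X).1 c
    · exact fun s h => (by decide : ∀ p : Fin 2 × Fin 2, p ≠ (1, 1) →
        (p.1.succ, p.2.succ) ≠ ((2, 2) : Fin 3 × Fin 3)) s.1.down s.2 h
    · intro a ha f
      obtain ⟨r, hr, h₁, h₂⟩ := (by decide : ∀ p : Fin 3 × Fin 3, p ≠ (2, 2) →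
        ∃ r : Fin 2 × Fin 2, r ≠ (1, 1) ∧ p ≤ (r.1.succ, r.2.succ) ∧
          ∀ r' : Fin 2 × Fin 2, p ≤ (r'.1.succ, r'.2.succ) → r ≤ r') a.1.down ha
      exact ⟨⟨⟨r⟩, hr⟩, homOfLE (show a ≤ gridMk (r.1.succ, r.2.succ) _ from h₁),
        Subsingleton.elim _ _, fun r' η _ => ⟨homOfLE (show r ≤ r'.1.down from
          h₂ _ (show a ≤ gridSquare.obj r'.1 from leOfHom η)), Subsingleton.elim _ _⟩⟩
  rw [← D.cartesian_iff] at c'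
  let eσ := underlyingRes D.toPrederivator gridSquare X
  have hd := (hD.isCartesian_iff_isProductFamily _ (hz₃.of_iso (eσ.app ⟨(1, 1)⟩)).isTerminal
    (homOfLE ⟨by decide, by decide⟩) (homOfLE ⟨by decide, by decide⟩)).1 c'
  have hd' : IsProductFamily (pairFrom.{v, w, u} (U.map q₁) (U.map q₂)) := by
    refine hd.congr (fun j => match j with
      | ⟨true⟩ => eσ.app ⟨(1, 0)⟩
      | ⟨false⟩ => eσ.app ⟨(0, 1)⟩) (eσ.app ⟨(0, 0)⟩) ?_
    rintro ⟨_ | _⟩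
    · exact eσ.hom.naturality _
    · exact eσ.hom.naturality _
  have z₁ : U.map (i₁ ≫ q₂) = 0 := by
    -- The off-diagonal entry factors through the zero object at `(0, 2)`.
    have : i₁ ≫ q₂ = (hom _ _ (by decide) : g01 ⟶ g02) ≫ (hom _ _ (by decide) : g02 ⟶ g12) :=
      Subsingleton.elim _ _
    rw [this, U.map_comp]
    exact (congrArg (· ≫ _) (hz₁.eq_zero_of_tgt _)).trans zero_comp
  have z₂ : U.map (i₂ ≫ q₁) = 0 := by
    -- The off-diagonal entry factors through the zero object at `(2, 0)`.
    have : i₂ ≫ q₁ = (hom _ _ (by decide) : g10 ⟶ g20) ≫ (hom _ _ (by decide) : g20 ⟶ g21) :=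
      Subsingleton.elim _ _
    rw [this, U.map_comp]
    exact (congrArg (· ≫ _) (hz₂.eq_zero_of_tgt _)).trans zero_comp
  rw [U.map_comp] at iso₁ iso₂ z₁ z₂
  have hb := hasBinaryBiproduct_of_families c11 hd' iso₁ iso₂ z₁ z₂
  exact HasBinaryBiproduct.mk ⟨_, (BinaryBiproduct.isBilimit _ _).ofIso
    (eY ⟨g01, P01⟩ ≪≫ e₁) (eY ⟨g10, P10⟩ ≪≫ e₂)⟩

end Deriv.StableDerivator

namespace Deriv.Prederivator

/-! ### Exact morphisms -/

variable {D E : Prederivator.{u, v, w}} {A : Type u} [Category.{u} A] {B : Type u} [Category.{u} B]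

/-- If there is exactly one arrow from `b` to each object of a discrete family, the limit over the
slice is the product of the family. -/
theorem IsDerivator.isLim_underSquare_discrete_iff (hD : D.IsDerivator) {J : Type u} {t : J → B}
    {b : B} (g : ∀ j, b ⟶ t j) (hg : ∀ j (f : b ⟶ t j), f = g j) (X : D.diag B) :
    D.IsLim (underSquare (Discrete.functor t) b) X ↔
      IsProductFamily fun j => (D.underlying X).map (g j) := by
  rw [← hD.isLim_discCone_iff]
  refine isLim_underSquare_iff (K := Discrete J) (q := 𝟭 _) (f := Discrete.functor t)
    (α := discCone g) ?_ X
  intro a f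
  refine ⟨a, 𝟙 a, ?_, fun r η _ => ⟨η, Subsingleton.elim _ _, fun _ _ => Subsingleton.elim _ _⟩⟩
  exact (congrArg _ ((Discrete.functor t).map_id a)).trans
    ((Category.comp_id _).trans (hg a.as f).symm)

/-- The naturality isomorphism of a morphism of prederivators. -/
def appResIso (F : D ⟶ E) (f : A ⥤ B) : D.res f ⋙ appF F A ≅ appF F B ⋙ E.res f :=
  Cat.Hom.toNatIso (Pseudofunctor.StrongTrans.naturality (F := D.ps) (G := E.ps) F f.toCatHom.op)

theorem appResIso_naturality (F : D ⟶ E) {f g : A ⥤ B} (α : f ⟶ g) (X : D.diag B) :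
    (appF F A).map ((D.resTrans α).app X) ≫ (appResIso F g).hom.app X =
      (appResIso F f).hom.app X ≫ (E.resTrans α).app ((appF F B).obj X) :=
  congrArg (fun t => t.toNatTrans.app X) (Pseudofunctor.StrongTrans.naturality_naturality
    (F := D.ps) (G := E.ps) F (Bicategory.Opposite.op2 α.toCatHom₂))

/-- The underlying diagram of the image of a coherent diagram. -/
def underlyingApp (F : D ⟶ E) (X : D.diag A) :
    D.underlying X ⋙ appF F One.{u} ≅ E.underlying ((appF F A).obj X) :=
  NatIso.ofComponents (fun a => (appResIso F (pt a)).app X)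
    (fun f => appResIso_naturality F (ptMap f) X)

/-- Any two objects are the intermediate corners of a cartesian square with terminal final corner,
namely the right Kan extension of the pair along the inclusion of these corners. -/
theorem IsDerivator.exists_isCartesian (hD : D.IsDerivator) (W₁ W₂ : D.diag One.{u}) :
    ∃ X : D.diag Sq.{u}, D.IsCartesian X ∧
      Nonempty (IsTerminal ((D.underlying X).obj ⟨(1, 1)⟩)) ∧
      Nonempty ((D.underlying X).obj ⟨(1, 0)⟩ ≅ W₁) ∧
      Nonempty ((D.underlying X).obj ⟨(0, 1)⟩ ≅ W₂) := by
  have := hD.isEquivalence_discrete (ULift.{u} Bool)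
  let F := Functor.pi' fun j : ULift.{u} Bool => D.res (pt (Discrete.mk j))
  let V := F.objPreimage (pairObj W₁ W₂)
  let f : Discrete (ULift.{u} Bool) ⥤ Sq.{u} := Discrete.functor (pairObj ⟨(1, 0)⟩ ⟨(0, 1)⟩)
  have : f.Faithful := ⟨fun _ => Subsingleton.elim _ _⟩
  have : f.Full := ⟨by
    rintro ⟨⟨_ | _⟩⟩ ⟨⟨_ | _⟩⟩ g
    · exact ⟨𝟙 _, rfl⟩
    · exact absurd g.down.down (by decide : ¬ ((0, 1) : Fin 2 × Fin 2) ≤ (1, 0))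
    · exact absurd g.down.down (by decide : ¬ ((1, 0) : Fin 2 × Fin 2) ≤ (0, 1))
    · exact ⟨𝟙 _, rfl⟩⟩
  obtain ⟨X, hX, ⟨e⟩⟩ := hD.exists_isRKan f V
  have h₁ (j : ULift.{u} Bool) :
      Nonempty ((D.underlying X).obj (f.obj ⟨j⟩) ≅ pairObj W₁ W₂ j) :=
    ⟨(underlyingRes D f X).symm.app ⟨j⟩ ≪≫ (underlyingMapIso D e).app ⟨j⟩ ≪≫
      Pi.isoApp (F.objObjPreimageIso (pairObj W₁ W₂)) j⟩
  have h₂ := (hD.isRKan_iff _ _).1 hX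
  have h₃ : Nonempty (IsTerminal ((D.underlying X).obj ⟨(1, 1)⟩)) := by
    refine (hD.isLim_underSquare_iff_isTerminal _ _ ?_ _).1 (h₂ _)
    rintro ⟨⟨_ | _⟩⟩ g
    · exact absurd g.down.down (by decide : ¬ ((1, 1) : Fin 2 × Fin 2) ≤ (0, 1))
    · exact absurd g.down.down (by decide : ¬ ((1, 1) : Fin 2 × Fin 2) ≤ (1, 0))
  let g₁ : (⟨(0, 0)⟩ : Sq.{u}) ⟶ ⟨(1, 0)⟩ := homOfLE ⟨by decide, by decide⟩
  let g₂ : (⟨(0, 0)⟩ : Sq.{u}) ⟶ ⟨(0, 1)⟩ := homOfLE ⟨by decide, by decide⟩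
  refine ⟨X, (hD.isCartesian_iff_isProductFamily X h₃.some g₁ g₂).2 ?_, h₃, h₁ ⟨true⟩, h₁ ⟨false⟩⟩
  exact (isProductFamily_map_pairFrom_iff _ g₁ g₂).1 ((hD.isLim_underSquare_discrete_iff
    (pairFrom g₁ g₂) (fun _ _ => Subsingleton.elim _ _) X).1 (h₂ _))

theorem isCartesian_of_iso {X Y : D.diag Sq.{u}} (e : X ≅ Y) (h : D.IsCartesian X) :
    D.IsCartesian Y := by
  obtain ⟨R, adj, h⟩ := h
  exact ⟨R, adj, h.ofIso e⟩

/-- Left exact morphisms of derivators preserve binary products of the underlying categories. -/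
theorem IsLeftExact.preservesLimit_pair {F : D ⟶ E} (hF : IsLeftExact F)
    (hD : D.IsDerivator) (hE : E.IsDerivator) (W₁ W₂ : D.diag One.{u}) :
    PreservesLimit (pair W₁ W₂) (appF F One.{u}) := by
  obtain ⟨X, hX, hT, ⟨e₁⟩, ⟨e₂⟩⟩ := hD.exists_isCartesian W₁ W₂
  let g₁ : (⟨(0, 0)⟩ : Sq.{u}) ⟶ ⟨(1, 0)⟩ := homOfLE ⟨by decide, by decide⟩
  let g₂ : (⟨(0, 0)⟩ : Sq.{u}) ⟶ ⟨(0, 1)⟩ := homOfLE ⟨by decide, by decide⟩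
  let eF := underlyingApp F X
  have hT' : IsTerminal ((E.underlying ((appF F Sq.{u}).obj X)).obj ⟨(1, 1)⟩) :=
    (hF.terminal _ hT).some.ofIso (eF.app _)
  have h₁ := (hD.isCartesian_iff_isProductFamily X hT.some g₁ g₂).1 hX
  have h₂ := (hE.isCartesian_iff_isProductFamily _ hT' g₁ g₂).1 (hF.cartesian X hX)
  have h₁' : IsProductFamily (pairFrom.{v, w, u} ((D.underlying X).map g₁ ≫ e₁.hom)
      ((D.underlying X).map g₂ ≫ e₂.hom)) := by
    refine h₁.congr (fun j => match j with
      | ⟨true⟩ => e₁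
      | ⟨false⟩ => e₂) (Iso.refl _) ?_
    rintro ⟨_ | _⟩ <;> exact (Category.id_comp _).symm
  have h₂' : IsProductFamily (pairFrom.{v, w, u}
      ((appF F One).map ((D.underlying X).map g₁ ≫ e₁.hom))
      ((appF F One).map ((D.underlying X).map g₂ ≫ e₂.hom))) := by
    refine h₂.congr (fun j => match j with
      | ⟨true⟩ => (eF.app _).symm ≪≫ (appF F One).mapIso e₁
      | ⟨false⟩ => (eF.app _).symm ≪≫ (appF F One).mapIso e₂) (eF.app _).symm ?_
    have key {s : Sq.{u}} {W : D.diag One.{u}} (g : (⟨(0, 0)⟩ : Sq.{u}) ⟶ s)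
        (e : (D.underlying X).obj s ≅ W) :
        (E.underlying ((appF F Sq.{u}).obj X)).map g ≫ eF.inv.app s ≫ (appF F One).map e.hom =
          eF.inv.app _ ≫ (appF F One).map ((D.underlying X).map g ≫ e.hom) := by
      rw [CategoryTheory.Functor.map_comp]
      exact eF.inv.naturality_assoc g _
    rintro ⟨_ | _⟩
    · exact key g₂ e₂
    · exact key g₁ e₁
  obtain ⟨h₃⟩ := (isProductFamily_pairFrom_iff _ _).1 h₁'
  obtain ⟨h₄⟩ := (isProductFamily_pairFrom_iff _ _).1 h₂'
  exact preservesLimit_of_preserves_limit_cone h₃ ((isLimitMapConeBinaryFanEquiv _ _ _).symm h₄)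

end Deriv.Prederivator

namespace Deriv.StableDerivator

open Prederivator

/-- Exact morphisms of stable derivators preserve finite products of the underlying categories. -/
theorem isProductFamily_map {D E : StableDerivator.{u, v, w}} (F : D ⟶ E) {J : Type*} [Finite J]
    {X : J → D.toPrederivator.diag One.{u}} {Z : D.toPrederivator.diag One.{u}}
    {p : ∀ j, Z ⟶ X j} (h : IsProductFamily p) :
    IsProductFamily fun j => (appF F.hom One.{u}).map (p j) := by
  let F₁ := appF F.hom One.{u}
  have hF := F.exact.2
  have := D.hasZeroObject
  have : HasZeroMorphisms (D.toPrederivator.diag One.{u}) := HasZeroObject.zeroMorphismsOfZeroObject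
  have := D.hasBinaryBiproducts
  have : HasTerminal (D.toPrederivator.diag One.{u}) := HasZeroObject.hasTerminal
  have : HasFiniteProducts (D.toPrederivator.diag One.{u}) :=
    hasFiniteProducts_of_has_binary_and_terminal
  have : PreservesLimitsOfShape (Discrete WalkingPair) F₁ := by
    refine ⟨fun {K} => ?_⟩
    have := hF.preservesLimit_pair D.isDerivator E.isDerivator (K.obj ⟨.left⟩) (K.obj ⟨.right⟩)
    exact preservesLimit_of_iso_diagram _ (diagramIsoPair K).symm
  have : PreservesLimit (Functor.empty.{0} (D.toPrederivator.diag One.{u})) F₁ :=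
    preservesLimit_of_preserves_limit_cone terminalIsTerminal
      ((isLimitMapConeEmptyConeEquiv F₁ _).symm (hF.terminal _ ⟨terminalIsTerminal⟩).some)
  have : PreservesLimitsOfShape (Discrete PEmpty.{1}) F₁ :=
    preservesLimitsOfShape_pempty_of_preservesTerminal F₁
  have := PreservesFiniteProducts.of_preserves_binary_and_terminal F₁
  obtain ⟨h⟩ := (isProductFamily_iff_isLimit p).1 h
  exact (isProductFamily_iff_isLimit _).2 ⟨isLimitFanMkObjOfIsLimit F₁ _ p h⟩

/-- In the underlying category of a stable derivator, a finite family of summands and a finite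
family of factors whose matrix is diagonal with invertible diagonal entries satisfy the universal
property of a coproduct and of a product, respectively, at the same time. -/
theorem isCoproductFamily_iff_isProductFamily (D : StableDerivator.{u, v, w}) {J : Type*}
    [Finite J] {X X' : J → D.toPrederivator.diag One.{u}} {Z : D.toPrederivator.diag One.{u}}
    (i : ∀ j, X j ⟶ Z) (p : ∀ j, Z ⟶ X' j) (h₁ : ∀ j, IsIso (i j ≫ p j))
    (h₀ : ∀ j k, j ≠ k → ∃ (O : D.toPrederivator.diag One.{u}) (f : X j ⟶ O) (g : O ⟶ X' k),
      IsZero O ∧ i j ≫ p k = f ≫ g) : IsCoproductFamily i ↔ IsProductFamily p := by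
  have := D.hasZeroObject
  have : HasZeroMorphisms (D.toPrederivator.diag One.{u}) := HasZeroObject.zeroMorphismsOfZeroObject
  have := D.hasBinaryBiproducts
  rw [CategoryTheory.isCoproductFamily_iff_isProductFamily i
    (fun j => p j ≫ CategoryTheory.inv (i j ≫ p j))]
  · refine ⟨fun h => h.congr (fun j => asIso (i j ≫ p j)) (Iso.refl _) fun j => ?_,
      fun h => h.congr (fun j => (asIso (i j ≫ p j)).symm) (Iso.refl _) fun j => ?_⟩
    · rw [asIso_hom, Category.assoc, IsIso.inv_hom_id, Iso.refl_hom, Category.comp_id,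
        Category.id_comp]
    · exact (Category.id_comp _).symm
  · intro j
    rw [← Category.assoc, IsIso.hom_inv_id]
  · intro j k hjk
    obtain ⟨O, f, g, hO, h⟩ := h₀ j k hjk
    rw [← Category.assoc, h, hO.eq_zero_of_tgt f, zero_comp, zero_comp]

end Deriv.StableDerivator

namespace Deriv

/-! ### The bridge category -/

variable {C : Type u} [Category.{u} C] {n : ℕ}

/-- The objects of the bridge category of a list `y` of objects of `C`: two copies `lo c` and `hi c`
of each object of `C`, an object `o`, and a square `sq p`. -/
inductive Bridge (y : Fin n → C) : Type u
  | lo (c : C) : Bridge y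
  | hi (c : C) : Bridge y
  | o : Bridge y
  | sq (p : Fin 2 × Fin 2) : Bridge y

namespace Bridge

variable {y : Fin n → C}

/-- The arrows of the bridge category. The corner `sq (0, 1)` plays the role of the sum of the
objects `y i`: an arrow `lo c ⟶ sq (0, 1)` is an arrow from `c` to one summand, and an arrow
`sq (0, 1) ⟶ hi c` is an arrow to `c` from one factor; the arrows between `lo c` and the other
corners are the ones that factor through `sq (0, 1)`, and similarly for `hi c`. An arrow
`lo c ⟶ hi c'` is an arrow of `C` or the zero arrow, which factors through `o`. -/
inductive Hom : Bridge y → Bridge y → Type u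
  | lo {c d : C} (f : c ⟶ d) : Hom (.lo c) (.lo d)
  | hi {c d : C} (f : c ⟶ d) : Hom (.hi c) (.hi d)
  | loHi {c d : C} (f : c ⟶ d) : Hom (.lo c) (.hi d)
  | zero (c d : C) : Hom (.lo c) (.hi d)
  | loO (c : C) : Hom (.lo c) .o
  | oHi (c : C) : Hom .o (.hi c)
  | oO : Hom .o .o
  | loSq {c : C} (i : Fin n) (f : c ⟶ y i) (p : Fin 2 × Fin 2) (h : (0, 1) ≤ p) :
      Hom (.lo c) (.sq p)
  | sqHi (p : Fin 2 × Fin 2) (h : p ≤ (0, 1)) (i : Fin n) {c : C} (f : y i ⟶ c) :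
      Hom (.sq p) (.hi c)
  | sq {p q : Fin 2 × Fin 2} (h : p ≤ q) : Hom (.sq p) (.sq q)

namespace Hom

/-- The composite `lo c ⟶ sq (0, 1) ⟶ hi d` is the entry of a product of a row and a column: it is
zero unless the two arrows involve the same index. -/
def pairing {c d : C} (i : Fin n) (f : c ⟶ y i) (j : Fin n) (g : y j ⟶ d) :
    Hom (.lo c : Bridge y) (.hi d) :=
  if h : i = j then .loHi (f ≫ eqToHom (by rw [h]) ≫ g) else .zero c d

/-- The identity arrows. -/
def id : ∀ a : Bridge y, Hom a a
  | .lo c => .lo (𝟙 c)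
  | .hi c => .hi (𝟙 c)
  | .o => .oO
  | .sq _ => .sq le_rfl

/-- Composition of arrows. -/
def comp : ∀ {a b c : Bridge y}, Hom a b → Hom b c → Hom a c
  | _, _, _, .lo f, .lo g => .lo (f ≫ g)
  | _, _, _, .lo f, .loHi g => .loHi (f ≫ g)
  | _, _, _, .lo _, .zero _ _ => .zero _ _
  | _, _, _, .lo _, .loO _ => .loO _
  | _, _, _, .lo f, .loSq i g p h => .loSq i (f ≫ g) p h
  | _, _, _, .hi f, .hi g => .hi (f ≫ g)
  | _, _, _, .loHi f, .hi g => .loHi (f ≫ g)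
  | _, _, _, .zero _ _, .hi _ => .zero _ _
  | _, _, _, .loO _, .oHi _ => .zero _ _
  | _, _, _, .loO _, .oO => .loO _
  | _, _, _, .oHi _, .hi _ => .oHi _
  | _, _, _, .oO, .oHi _ => .oHi _
  | _, _, _, .oO, .oO => .oO
  | _, _, _, .loSq i f _ _, .sqHi _ _ j g => pairing i f j g
  | _, _, _, .loSq i f _ h, .sq h' => .loSq i f _ (h.trans h')
  | _, _, _, .sqHi p h i f, .hi g => .sqHi p h i (f ≫ g)
  | _, _, _, .sq h, .sqHi _ h' i f => .sqHi _ (h.trans h') i f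
  | _, _, _, .sq h, .sq h' => .sq (h.trans h')

theorem lo_comp_pairing {b c d : C} (e : b ⟶ c) (i : Fin n) (f : c ⟶ y i) (j : Fin n)
    (g : y j ⟶ d) : (Hom.lo e).comp (pairing i f j g) = pairing i (e ≫ f) j g := by
  unfold pairing
  split <;> simp [comp]

theorem pairing_comp_hi {b c d : C} (e : d ⟶ b) (i : Fin n) (f : c ⟶ y i) (j : Fin n)
    (g : y j ⟶ d) : (pairing i f j g).comp (.hi e) = pairing i f j (g ≫ e) := by
  unfold pairing
  split <;> simp [comp]

theorem id_comp {a b : Bridge y} (f : Hom a b) : (id a).comp f = f := by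
  cases f <;> simp [comp, id]

theorem comp_id {a b : Bridge y} (f : Hom a b) : f.comp (id b) = f := by
  cases f <;> simp [comp, id]

theorem assoc {a b c d : Bridge y} (f : Hom a b) (g : Hom b c) (h : Hom c d) :
    (f.comp g).comp h = f.comp (g.comp h) := by
  cases f <;> cases g <;> cases h <;> first
    | rfl
    | exact (lo_comp_pairing _ _ _ _ _).symm
    | exact pairing_comp_hi _ _ _ _ _
    | exact congrArg _ (Category.assoc _ _ _)
    | simp only [comp, Category.assoc]

end Hom

instance : Category.{u} (Bridge y) where
  Hom := Hom
  id := Hom.id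
  comp := Hom.comp
  id_comp := Hom.id_comp
  comp_id := Hom.comp_id
  assoc := Hom.assoc

/-- The square in the bridge category. -/
def square (y : Fin n → C) : Sq.{u} ⥤ Bridge y where
  obj s := .sq s.down
  map f := .sq f.down.down
  map_id _ := rfl
  map_comp _ _ := rfl

/-- The arrow `lo c ⟶ hi c` given by the identity of `c`. -/
def diagonal (y : Fin n → C) (c : C) : (.lo c : Bridge y) ⟶ .hi c := Hom.loHi (𝟙 c)

/-- The summand inclusions of `sq (0, 1)`. -/
def incl (y : Fin n → C) (i : ULift.{u} (Fin n)) : (.lo (y i.down) : Bridge y) ⟶ .sq (0, 1) :=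
  Hom.loSq i.down (𝟙 _) _ le_rfl

/-- The projections of `sq (0, 1)`. -/
def proj (y : Fin n → C) (i : ULift.{u} (Fin n)) : (.sq (0, 1) : Bridge y) ⟶ .hi (y i.down) :=
  Hom.sqHi _ le_rfl i.down (𝟙 _)

theorem incl_comp_proj_self (i : ULift.{u} (Fin n)) : incl y i ≫ proj y i = diagonal y _ := by
  change Hom.pairing _ _ _ _ = _
  simp [Hom.pairing, diagonal]

theorem incl_comp_proj_of_ne {i j : ULift.{u} (Fin n)} (h : i ≠ j) :
    incl y i ≫ proj y j = (Hom.loO _ : (.lo (y i.down) : Bridge y) ⟶ .o) ≫ (Hom.oHi _ : _ ⟶ _) :=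
  dif_neg fun h' => h (ULift.ext _ _ h')

end Bridge
end Deriv

namespace Deriv

/-! ### Bridge diagrams -/

variable {C : Type u} [Category.{u} C] {n : ℕ}

open Bridge in
/-- The coherent diagrams on the bridge category that are determined by their restriction to either
end: the values at `o` and `sq (1, 0)` vanish, the two copies of `C` agree, the value at `sq (0, 1)`
is the product of the values at `y i`, and the square is cartesian. -/
structure Prederivator.IsBridge {D : Prederivator.{u, v, w}} {y : Fin n → C}
    (X : D.diag (Bridge y)) : Prop where
  o : Nonempty (IsTerminal ((D.underlying X).obj .o))
  corner : Nonempty (IsTerminal ((D.underlying X).obj (.sq (1, 0))))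
  diagonal (c : C) : IsIso ((D.underlying X).map (diagonal y c))
  sum : IsProductFamily fun i => (D.underlying X).map (proj y i)
  square : D.IsCartesian ((D.res (square y)).obj X)

variable {y : Fin n → C}

theorem _root_.CategoryTheory.IsProductFamily.of_natIso {A : Type*} [Category* A] {B : Type*}
    [Category* B] {F G : A ⥤ B} (e : F ≅ G) {J : Type*} {X : J → A} {Z : A} {p : ∀ j, Z ⟶ X j}
    (h : IsProductFamily fun j => F.map (p j)) : IsProductFamily fun j => G.map (p j) :=
  h.congr (fun j => e.app (X j)) (e.app Z) fun j => e.hom.naturality (p j)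

theorem Prederivator.IsBridge.of_iso {D : Prederivator.{u, v, w}} {X Y : D.diag (Bridge y)}
    (h : IsBridge X) (e : X ≅ Y) : IsBridge Y where
  o := ⟨h.o.some.ofIso ((underlyingMapIso D e).app _)⟩
  corner := ⟨h.corner.some.ofIso ((underlyingMapIso D e).app _)⟩
  diagonal c := (NatIso.isIso_map_iff (underlyingMapIso D e) _).1 (h.diagonal c)
  sum := h.sum.of_natIso (underlyingMapIso D e)
  square := isCartesian_of_iso ((D.res _).mapIso e) h.square

open Prederivator in
/-- Exact morphisms preserve bridge diagrams. -/
theorem StableDerivator.isBridge_map {D E : StableDerivator.{u, v, w}} (F : D ⟶ E)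
    {X : D.toPrederivator.diag (Bridge y)} (h : IsBridge X) :
    IsBridge ((appF F.hom (Bridge y)).obj X) where
  o := ⟨(F.exact.2.terminal _ h.o).some.ofIso ((underlyingApp F.hom X).app _)⟩
  corner := ⟨(F.exact.2.terminal _ h.corner).some.ofIso ((underlyingApp F.hom X).app _)⟩
  diagonal c := by
    have := h.diagonal c
    exact (NatIso.isIso_map_iff (underlyingApp F.hom X) _).1
      (inferInstanceAs (IsIso ((appF F.hom One).map _)))
  sum := IsProductFamily.of_natIso (underlyingApp F.hom X) (D.isProductFamily_map F h.sum)
  square := isCartesian_of_iso ((appResIso F.hom _).app X) (F.exact.2.cartesian _ h.square)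

open Prederivator in
/-- The diagrams with parameters in `A` that are pointwise bridge diagrams. -/
def bridgeProperty (y : Fin n → C) :
    FamilyProperty (stablePow.{u, v, w} (Cat.of (Bridge y))) where
  prop D :=
    { prop A := fun X : D.toPrederivator.diag (Bridge y × A.unop) =>
        ∀ a, IsBridge ((D.toPrederivator.res (Prod.sectL (Bridge y) a)).obj X)
      map {A A'} f X h a := by
        have h' := h (f.unop.toFunctor.obj a)
        have : Prod.sectL (Bridge y) (f.unop.toFunctor.obj a) =
            Prod.sectL (Bridge y) a ⋙ (𝟭 (Bridge y)).prod f.unop.toFunctor :=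
          CategoryTheory.Functor.ext (fun _ => rfl) fun _ _ g => by
            refine Eq.trans ?_ ((Category.id_comp _).trans (Category.comp_id _)).symm
            exact Prod.ext rfl (f.unop.toFunctor.map_id a).symm
        rw [this, res_comp] at h'
        exact h' }
  map {D E} F A X h a :=
    (StableDerivator.isBridge_map F (h a)).of_iso
      ((appResIso F.hom (Prod.sectL (Bridge y) a)).app X)

end Deriv

namespace Deriv

variable {C : Type u} [Category.{u} C] {n : ℕ}

/-! ### The two ends of the bridge category -/

namespace Bridge

variable (y : Fin n → C)

/-- The copy of `C` with a sink attached: the objects `lo c` and the final corner. -/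
def sinkEnd : ObjectProperty (Bridge y)
  | .lo _ => True
  | .hi _ => False
  | .o => False
  | .sq p => p = (1, 1)

/-- The sink end together with `o`. -/
def sinkEndO : ObjectProperty (Bridge y)
  | .lo _ => True
  | .hi _ => False
  | .o => True
  | .sq p => p = (1, 1)

/-- All objects but the initial corner. -/
def sinkEndSum : ObjectProperty (Bridge y)
  | .lo _ => True
  | .hi _ => True
  | .o => True
  | .sq p => p ≠ (0, 0)

/-- The copy of `C` with a source attached: the objects `hi c` and the initial corner. -/
def sourceEnd : ObjectProperty (Bridge y)
  | .lo _ => False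
  | .hi _ => True
  | .o => False
  | .sq p => p = (0, 0)

/-- The source end together with `o`. -/
def sourceEndO : ObjectProperty (Bridge y)
  | .lo _ => False
  | .hi _ => True
  | .o => True
  | .sq p => p = (0, 0)

/-- All objects but the final corner. -/
def sourceEndSum : ObjectProperty (Bridge y)
  | .lo _ => True
  | .hi _ => True
  | .o => True
  | .sq p => p ≠ (1, 1)

theorem sinkEnd_le : sinkEnd y ≤ sinkEndO y := by
  rintro (_ | _ | _ | p) h
  exacts [trivial, h.elim, trivial, h]

theorem sinkEndO_le : sinkEndO y ≤ sinkEndSum y := by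
  rintro (_ | _ | _ | p) h
  exacts [trivial, trivial, trivial, fun h' => absurd (h.symm.trans h') (by decide)]

theorem sourceEnd_le : sourceEnd y ≤ sourceEndO y := by
  rintro (_ | _ | _ | p) h
  exacts [h.elim, trivial, trivial, h]

theorem sourceEndO_le : sourceEndO y ≤ sourceEndSum y := by
  rintro (_ | _ | _ | p) h
  exacts [trivial, trivial, trivial, fun h' => absurd (h.symm.trans h') (by decide)]

end Bridge

namespace Prederivator

open Bridge

variable {D : Prederivator.{u, v, w}} {y : Fin n → C}

/-- There are no arrows from `o` to the sink end. -/
theorem IsDerivator.limAt_sinkEnd_o (hD : D.IsDerivator) (X : D.diag (Bridge y)) :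
    D.LimAt (sinkEnd y) .o X ↔ Nonempty (IsTerminal ((D.underlying X).obj .o)) := by
  refine hD.limAt_iff_isTerminal (fun a ha f => ?_) X
  change Hom _ _ at f
  cases f <;> exact ha

/-- There are no arrows from the source end to `o`. -/
theorem IsDerivator.colimAt_sourceEnd_o (hD : D.IsDerivator) (X : D.diag (Bridge y)) :
    D.ColimAt (sourceEnd y) .o X ↔ Nonempty (IsInitial ((D.underlying X).obj .o)) := by
  refine hD.colimAt_iff_isInitial (fun a ha f => ?_) X
  change Hom _ _ at f
  cases f <;> exact ha

/-- There are no arrows from the sink end or `o` to the corner `sq (1, 0)`. -/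
theorem IsDerivator.colimAt_sinkEndO_corner (hD : D.IsDerivator) (X : D.diag (Bridge y)) :
    D.ColimAt (sinkEndO y) (.sq (1, 0)) X ↔
      Nonempty (IsInitial ((D.underlying X).obj (.sq (1, 0)))) := by
  refine hD.colimAt_iff_isInitial (fun a ha f => ?_) X
  change Hom _ _ at f
  cases f with
  | loSq i f p h => exact absurd h (by decide)
  | sq h =>
    cases ha
    exact absurd h (by decide)

/-- There are no arrows from the corner `sq (1, 0)` to the source end or `o`. -/
theorem IsDerivator.limAt_sourceEndO_corner (hD : D.IsDerivator) (X : D.diag (Bridge y)) :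
    D.LimAt (sourceEndO y) (.sq (1, 0)) X ↔
      Nonempty (IsTerminal ((D.underlying X).obj (.sq (1, 0)))) := by
  refine hD.limAt_iff_isTerminal (fun a ha f => ?_) X
  change Hom _ _ at f
  cases f with
  | sqHi p h i f => exact absurd h (by decide)
  | sq h =>
    cases ha
    exact absurd h (by decide)

/-- Every arrow `lo c ⟶ sq (0, 1)` factors uniquely through exactly one summand inclusion. -/
theorem IsDerivator.colimAt_sinkEndO_sum (hD : D.IsDerivator) (X : D.diag (Bridge y)) :
    D.ColimAt (sinkEndO y) (.sq (0, 1)) X ↔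
      IsCoproductFamily fun i => (D.underlying X).map (incl y i) := by
  refine hD.colimAt_iff_isCoproductFamily (fun _ => trivial) (incl y) (fun a ha f => ?_) X
  change Hom _ _ at f
  cases f with
  | loSq i f p h =>
    refine ⟨⟨⟨i⟩, Hom.lo f⟩, congrArg (Hom.loSq i · _ h) (Category.comp_id f), ?_⟩
    rintro ⟨⟨j⟩, g⟩ hg
    change Hom _ _ at g
    cases g with
    | lo g =>
      obtain ⟨rfl, h⟩ := Hom.loSq.inj hg
      rw [← eq_of_heq h, Category.comp_id]
  | sq h =>
    cases ha
    exact absurd h (by decide)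

/-- Every arrow `sq (0, 1) ⟶ hi c` factors uniquely through exactly one projection. -/
theorem IsDerivator.limAt_sourceEndO_sum (hD : D.IsDerivator) (X : D.diag (Bridge y)) :
    D.LimAt (sourceEndO y) (.sq (0, 1)) X ↔
      IsProductFamily fun i => (D.underlying X).map (proj y i) := by
  refine hD.limAt_iff_isProductFamily (fun _ => trivial) (proj y) (fun a ha f => ?_) X
  change Hom _ _ at f
  cases f with
  | sqHi p h i f =>
    refine ⟨⟨⟨i⟩, Hom.hi f⟩, congrArg (Hom.sqHi _ h i) (Category.id_comp f), ?_⟩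
    rintro ⟨⟨j⟩, g⟩ hg
    change Hom _ _ at g
    cases g with
    | hi g =>
      obtain ⟨rfl, h⟩ := Hom.sqHi.inj hg
      rw [← eq_of_heq h, Category.id_comp]
  | sq h =>
    cases ha
    exact absurd h (by decide)

/-- An arrow from the sink end or `o` to `hi c` factors uniquely through exactly one of `lo c` and
`o`, so the value at `hi c` is the coproduct of those at `lo c` and `o`, of which the latter
vanishes. -/
theorem IsDerivator.colimAt_sinkEndO_hi (hD : D.IsDerivator) (X : D.diag (Bridge y)) (c : C)
    (hX : IsInitial ((D.underlying X).obj .o)) :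
    D.ColimAt (sinkEndO y) (.hi c) X ↔ IsIso ((D.underlying X).map (diagonal y c)) := by
  let t : ULift.{u} Bool → Bridge y := pairObj (.lo c) .o
  let g : ∀ j, t j ⟶ .hi c := pairTo (diagonal y c) (Hom.oHi c : _ ⟶ _)
  refine (hD.colimAt_iff_isCoproductFamily (t := t) ?_ g ?_ X).trans
    (isCoproductFamily_iff_isIso (fun j => (D.underlying X).map (g j)) ⟨true⟩ ?_)
  · rintro ⟨_ | _⟩ <;> trivial
  · intro a ha f
    refine existsUnique_pairTo (x := .lo c) (y := .o) (f := f) (g := diagonal y c)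
      (h := (Hom.oHi c : (.o : Bridge y) ⟶ _)) ?_
    change Hom _ _ at f
    cases f with
    | hi f => exact ha.elim
    | loHi f =>
      refine .inl ⟨⟨Hom.lo f, congrArg Hom.loHi (Category.comp_id f), fun e he => ?_⟩,
        fun e he => ?_⟩
      · change Hom _ _ at e
        cases e with
        | lo e => rw [← Hom.loHi.inj he, Category.comp_id]
      · change Hom _ _ at e
        cases e
        cases he
    | zero d =>
      refine .inr ⟨⟨Hom.loO d, rfl, fun e _ => ?_⟩, fun e he => ?_⟩
      · change Hom _ _ at e
        cases e
        rfl
      · change Hom _ _ at e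
        cases e
        cases he
    | oHi =>
      refine .inr ⟨⟨Hom.oO, rfl, fun e _ => ?_⟩, fun e he => ?_⟩
      · change Hom _ _ at e
        cases e
        rfl
      · change Hom _ _ at e
        cases e
    | sqHi p h i f =>
      cases ha
      exact absurd h (by decide)
  · rintro ⟨_ | _⟩ hj
    exacts [⟨hX⟩, (hj rfl).elim]

/-- An arrow from `lo c` to the source end or `o` factors uniquely through exactly one of `hi c`
and `o`, so the value at `lo c` is the product of those at `hi c` and `o`, of which the latter
vanishes. -/
theorem IsDerivator.limAt_sourceEndO_lo (hD : D.IsDerivator) (X : D.diag (Bridge y)) (c : C)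
    (hX : IsTerminal ((D.underlying X).obj .o)) :
    D.LimAt (sourceEndO y) (.lo c) X ↔ IsIso ((D.underlying X).map (diagonal y c)) := by
  let t : ULift.{u} Bool → Bridge y := pairObj (.hi c) .o
  let g : ∀ j, .lo c ⟶ t j := pairFrom (diagonal y c) (Hom.loO c : _ ⟶ _)
  refine (hD.limAt_iff_isProductFamily (t := t) ?_ g ?_ X).trans
    (isProductFamily_iff_isIso (fun j => (D.underlying X).map (g j)) ⟨true⟩ ?_)
  · rintro ⟨_ | _⟩ <;> trivial
  · intro a ha f
    refine existsUnique_pairFrom (x := .hi c) (y := .o) (f := f) (g := diagonal y c)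
      (h := (Hom.loO c : _ ⟶ (.o : Bridge y))) ?_
    change Hom _ _ at f
    cases f with
    | lo f => exact ha.elim
    | loHi f =>
      refine .inl ⟨⟨Hom.hi f, congrArg Hom.loHi (Category.id_comp f), fun e he => ?_⟩,
        fun e he => ?_⟩
      · change Hom _ _ at e
        cases e with
        | hi e => rw [← Hom.loHi.inj he, Category.id_comp]
      · change Hom _ _ at e
        cases e
        cases he
    | zero _ d =>
      refine .inr ⟨⟨Hom.oHi d, rfl, fun e _ => ?_⟩, fun e he => ?_⟩
      · change Hom _ _ at e
        cases e
        rfl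
      · change Hom _ _ at e
        cases e
        cases he
    | loO =>
      refine .inr ⟨⟨Hom.oO, rfl, fun e _ => ?_⟩, fun e he => ?_⟩
      · change Hom _ _ at e
        cases e
        rfl
      · change Hom _ _ at e
        cases e
    | loSq i f p h =>
      cases ha
      exact absurd h (by decide)
  · rintro ⟨_ | _⟩ hj
    exacts [⟨hX⟩, (hj rfl).elim]

/-- Every arrow out of `sq (0, 0)` factors through the rest of the square, the arrows to `hi c`
universally through `sq (0, 1)`. -/
theorem IsDerivator.limAt_sinkEndSum (hD : D.IsDerivator) (X : D.diag (Bridge y)) :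
    D.LimAt (sinkEndSum y) (.sq (0, 0)) X ↔ D.IsCartesian ((D.res (square y)).obj X) := by
  refine hD.limAt_iff_isCartesian (square y) (fun s => s.2) (fun a ha f => ?_) X
  change Hom _ _ at f
  cases f with
  | sq h =>
    rename_i p
    refine ⟨⟨⟨p⟩, ha⟩, 𝟙 _, rfl, fun r η _ => ?_⟩
    change Hom _ _ at η
    cases η with
    | sq h' => exact ⟨homOfLE h', rfl⟩
  | sqHi p h i f =>
    refine ⟨⟨⟨(0, 1)⟩, by decide⟩, Hom.sqHi _ le_rfl i f, rfl, ?_⟩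
    rintro r η hη
    obtain ⟨⟨r⟩, hr⟩ := r
    change Hom _ _ at η
    cases η with
    | sqHi p h j g =>
      refine ⟨homOfLE h, ?_⟩
      obtain ⟨rfl, h⟩ := Hom.sqHi.inj hη
      rw [← eq_of_heq h]
      rfl

/-- Every arrow into `sq (1, 1)` factors through the rest of the square, the arrows from `lo c`
universally through `sq (0, 1)`. -/
theorem IsDerivator.colimAt_sourceEndSum (hD : D.IsDerivator) (X : D.diag (Bridge y)) :
    D.ColimAt (sourceEndSum y) (.sq (1, 1)) X ↔ D.IsCocartesian ((D.res (square y)).obj X) := by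
  refine hD.colimAt_iff_isCocartesian (square y) (fun s => s.2) (fun a ha f => ?_) X
  change Hom _ _ at f
  cases f with
  | sq h =>
    rename_i p
    refine ⟨⟨⟨p⟩, ha⟩, 𝟙 _, rfl, fun r η _ => ?_⟩
    change Hom _ _ at η
    cases η with
    | sq h' => exact ⟨homOfLE h', rfl⟩
  | loSq i f p h =>
    refine ⟨⟨⟨(0, 1)⟩, by decide⟩, Hom.loSq i f _ le_rfl, rfl, ?_⟩
    rintro r η hη
    obtain ⟨⟨r⟩, hr⟩ := r
    change Hom _ _ at η
    cases η with
    | loSq j g p h =>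
      refine ⟨homOfLE h, ?_⟩
      obtain ⟨rfl, h⟩ := Hom.loSq.inj hη
      rw [← eq_of_heq h]
      rfl

end Prederivator

end Deriv

namespace Deriv

/-! ### Restriction of bridge diagrams to the ends -/

section

variable {C : Type u} [Category.{u} C] {n : ℕ} {y : Fin n → C}

namespace StableDerivator

open Prederivator Bridge

variable (D : StableDerivator.{u, v, w})

/-- For bridge diagrams the value at `sq (0, 1)` is both the coproduct and the product of the values
at the objects `y i`. -/
theorem isCoproductFamily_incl_iff (X : D.toPrederivator.diag (Bridge y))
    (hX : IsZero ((D.toPrederivator.underlying X).obj .o))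
    (h : ∀ c, IsIso ((D.toPrederivator.underlying X).map (diagonal y c))) :
    (IsCoproductFamily fun i => (D.toPrederivator.underlying X).map (incl y i)) ↔
      IsProductFamily fun i => (D.toPrederivator.underlying X).map (proj y i) := by
  refine D.isCoproductFamily_iff_isProductFamily _ _ (fun i => ?_) fun i j hij => ?_
  · rw [← CategoryTheory.Functor.map_comp, incl_comp_proj_self]
    exact h _
  · rw [← CategoryTheory.Functor.map_comp, incl_comp_proj_of_ne hij,
      CategoryTheory.Functor.map_comp]
    exact ⟨_, _, _, hX, rfl⟩

/-- Bridge diagrams are the diagrams that are obtained from their restriction to the sink end by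
adding the value at `o`, the values at the objects `hi c` and at the intermediate corners, and the
value at the initial corner, by alternating right and left Kan extension. -/
theorem isBridge_iff_sink (X : D.toPrederivator.diag (Bridge y)) : IsBridge X ↔
    (∀ b, ¬ sinkEndSum y b → D.LimAt (sinkEndSum y) b X) ∧
    (∀ b, sinkEndSum y b → ¬ sinkEndO y b → D.ColimAt (sinkEndO y) b X) ∧
    ∀ b, sinkEndO y b → ¬ sinkEnd y b → D.LimAt (sinkEnd y) b X := by
  have hD := D.isDerivator
  constructor
  · intro h
    have ho := D.isZero_of_isTerminal h.o
    refine ⟨?_, ?_, ?_⟩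
    · rintro (_ | _ | _ | p) hb
      · exact (hb trivial).elim
      · exact (hb trivial).elim
      · exact (hb trivial).elim
      · obtain rfl : p = (0, 0) := not_not.1 hb
        exact (hD.limAt_sinkEndSum X).2 h.square
    · rintro (_ | c | _ | p) hb hb'
      · exact (hb' trivial).elim
      · exact (hD.colimAt_sinkEndO_hi X c ho.isInitial).2 (h.diagonal c)
      · exact (hb' trivial).elim
      · obtain rfl | rfl : p = (0, 1) ∨ p = (1, 0) := (by decide : ∀ p : Fin 2 × Fin 2,
          p ≠ (0, 0) → ¬ p = (1, 1) → p = (0, 1) ∨ p = (1, 0)) p hb hb'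
        · exact (hD.colimAt_sinkEndO_sum X).2
            ((D.isCoproductFamily_incl_iff X ho h.diagonal).2 h.sum)
        · exact (hD.colimAt_sinkEndO_corner X).2 ⟨(D.isZero_of_isTerminal h.corner).isInitial⟩
    · rintro (_ | _ | _ | p) hb hb'
      · exact (hb' trivial).elim
      · exact hb.elim
      · exact (hD.limAt_sinkEnd_o X).2 h.o
      · exact (hb' hb).elim
  · rintro ⟨h₁, h₂, h₃⟩
    have ho := (hD.limAt_sinkEnd_o X).1 (h₃ _ trivial id)
    have ho' := D.isZero_of_isTerminal ho
    have hd c := (hD.colimAt_sinkEndO_hi X c ho'.isInitial).1 (h₂ (.hi c) trivial id)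
    refine ⟨ho, ⟨(D.isZero_of_isInitial ((hD.colimAt_sinkEndO_corner X).1
      (h₂ _ ?_ ?_))).isTerminal⟩, hd, (D.isCoproductFamily_incl_iff X ho' hd).1
        ((hD.colimAt_sinkEndO_sum X).1 (h₂ _ ?_ ?_)),
      (hD.limAt_sinkEndSum X).1 (h₁ _ fun h => h rfl)⟩
    · exact (by decide : ((1, 0) : Fin 2 × Fin 2) ≠ (0, 0))
    · exact (by decide : ((1, 0) : Fin 2 × Fin 2) ≠ (1, 1))
    · exact (by decide : ((0, 1) : Fin 2 × Fin 2) ≠ (0, 0))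
    · exact (by decide : ((0, 1) : Fin 2 × Fin 2) ≠ (1, 1))

/-- Bridge diagrams are the diagrams that are obtained from their restriction to the source end by
adding the value at `o`, the values at the objects `lo c` and at the intermediate corners, and the
value at the final corner, by alternating left and right Kan extension. -/
theorem isBridge_iff_source (X : D.toPrederivator.diag (Bridge y)) : IsBridge X ↔
    (∀ b, ¬ sourceEndSum y b → D.ColimAt (sourceEndSum y) b X) ∧
    (∀ b, sourceEndSum y b → ¬ sourceEndO y b → D.LimAt (sourceEndO y) b X) ∧
    ∀ b, sourceEndO y b → ¬ sourceEnd y b → D.ColimAt (sourceEnd y) b X := by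
  have hD := D.isDerivator
  constructor
  · intro h
    refine ⟨?_, ?_, ?_⟩
    · rintro (_ | _ | _ | p) hb
      · exact (hb trivial).elim
      · exact (hb trivial).elim
      · exact (hb trivial).elim
      · obtain rfl : p = (1, 1) := not_not.1 hb
        exact (hD.colimAt_sourceEndSum X).2 ((D.cartesian_iff _).1 h.square)
    · rintro (c | _ | _ | p) hb hb'
      · exact (hD.limAt_sourceEndO_lo X c h.o.some).2 (h.diagonal c)
      · exact (hb' trivial).elim
      · exact (hb' trivial).elim
      · obtain rfl | rfl : p = (0, 1) ∨ p = (1, 0) := (by decide : ∀ p : Fin 2 × Fin 2,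
          p ≠ (1, 1) → ¬ p = (0, 0) → p = (0, 1) ∨ p = (1, 0)) p hb hb'
        · exact (hD.limAt_sourceEndO_sum X).2 h.sum
        · exact (hD.limAt_sourceEndO_corner X).2 h.corner
    · rintro (_ | _ | _ | p) hb hb'
      · exact hb.elim
      · exact (hb' trivial).elim
      · exact (hD.colimAt_sourceEnd_o X).2 ⟨(D.isZero_of_isTerminal h.o).isInitial⟩
      · exact (hb' hb).elim
  · rintro ⟨h₁, h₂, h₃⟩
    have ho := D.isZero_of_isInitial ((hD.colimAt_sourceEnd_o X).1 (h₃ _ trivial id))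
    refine ⟨⟨ho.isTerminal⟩, (hD.limAt_sourceEndO_corner X).1 (h₂ _ ?_ ?_),
      fun c => (hD.limAt_sourceEndO_lo X c ho.isTerminal).1 (h₂ (.lo c) trivial id),
      (hD.limAt_sourceEndO_sum X).1 (h₂ _ ?_ ?_),
      (D.cartesian_iff _).2 ((hD.colimAt_sourceEndSum X).1 (h₁ _ fun h => h rfl))⟩
    · exact (by decide : ((1, 0) : Fin 2 × Fin 2) ≠ (1, 1))
    · exact (by decide : ((1, 0) : Fin 2 × Fin 2) ≠ (0, 0))
    · exact (by decide : ((0, 1) : Fin 2 × Fin 2) ≠ (1, 1))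
    · exact (by decide : ((0, 1) : Fin 2 × Fin 2) ≠ (0, 0))

end StableDerivator

end

/-- If `F` restricts to a fully faithful and essentially surjective functor from `P` to `Q`, and `G`
to an equivalence on `Q`, then `F ⋙ G` restricts to an equivalence on `P`. -/
theorem _root_.CategoryTheory.ObjectProperty.isEquivalence_ι_comp {C₁ C₂ C₃ : Type*}
    [Category* C₁] [Category* C₂] [Category* C₃] {P : ObjectProperty C₁} {Q : ObjectProperty C₂}
    (F : C₁ ⥤ C₂) (G : C₂ ⥤ C₃) (hG : (Q.ι ⋙ G).IsEquivalence) (h : ∀ X, P X → Q (F.obj X))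
    (hF : ∀ X Y, P X → P Y → Function.Bijective (F.map : (X ⟶ Y) → _))
    (hQ : ∀ W, Q W → ∃ X, P X ∧ Nonempty (F.obj X ≅ W)) : (P.ι ⋙ F ⋙ G).IsEquivalence := by
  let F' : P.FullSubcategory ⥤ Q.FullSubcategory := Q.lift (P.ι ⋙ F) fun X => h _ X.2
  have : F'.Faithful := ⟨fun {X Y} f g hfg => by
    ext
    exact (hF _ _ X.2 Y.2).1 (congrArg (fun t : F'.obj X ⟶ F'.obj Y => t.hom) hfg)⟩
  have : F'.Full := ⟨fun {X Y} f => by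
    obtain ⟨g, hg⟩ := (hF _ _ X.2 Y.2).2 f.hom
    exact ⟨ObjectProperty.homMk g, ObjectProperty.hom_ext _ hg⟩⟩
  have : F'.EssSurj := ⟨fun W => by
    obtain ⟨X, hX, ⟨e⟩⟩ := hQ W.obj W.2
    exact ⟨⟨X, hX⟩, ⟨Q.isoMk e⟩⟩⟩
  have : F'.IsEquivalence := { }
  exact inferInstanceAs (F' ⋙ (Q.ι ⋙ G)).IsEquivalence

namespace Prederivator

variable {D : Prederivator.{u, v, w}} {A B : Type u} [Category.{u} A] [Category.{u} B]

/-- If the diagrams in `P` are the left Kan extensions along `f` of the diagrams in `Q`, then a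
functor that is an equivalence on `Q` gives one on `P` by restricting along `f` first. This is one
step in a chain of extensions. -/
theorem IsDerivator.isEquivalence_ι_comp_of_isLKan (hD : D.IsDerivator) (f : A ⥤ B) [f.Full]
    [f.Faithful] {P : ObjectProperty (D.diag B)} {Q : ObjectProperty (D.diag A)}
    [Q.IsClosedUnderIsomorphisms] (h : ∀ X, P X ↔ D.IsLKan f X ∧ Q ((D.res f).obj X))
    {E : Type*} [Category* E] (G : D.diag A ⥤ E) (hG : (Q.ι ⋙ G).IsEquivalence) :
    (P.ι ⋙ D.res f ⋙ G).IsEquivalence := by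
  refine ObjectProperty.isEquivalence_ι_comp _ _ hG (fun X hX => ((h X).1 hX).2)
    (fun X Y hX _ => ((h X).1 hX).1 Y) fun W hW => ?_
  obtain ⟨X, hX, ⟨e⟩⟩ := hD.exists_isLKan f W
  exact ⟨X, (h X).2 ⟨hX, Q.prop_of_iso e.symm hW⟩, ⟨e⟩⟩

/-- If the diagrams in `P` are the right Kan extensions along `f` of the diagrams in `Q`, then a
functor that is an equivalence on `Q` gives one on `P` by restricting along `f` first. -/
theorem IsDerivator.isEquivalence_ι_comp_of_isRKan (hD : D.IsDerivator) (f : A ⥤ B) [f.Full]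
    [f.Faithful] {P : ObjectProperty (D.diag B)} {Q : ObjectProperty (D.diag A)}
    [Q.IsClosedUnderIsomorphisms] (h : ∀ X, P X ↔ D.IsRKan f X ∧ Q ((D.res f).obj X))
    {E : Type*} [Category* E] (G : D.diag A ⥤ E) (hG : (Q.ι ⋙ G).IsEquivalence) :
    (P.ι ⋙ D.res f ⋙ G).IsEquivalence := by
  refine ObjectProperty.isEquivalence_ι_comp _ _ hG (fun X hX => ((h X).1 hX).2)
    (fun X Y _ hY => ((h Y).1 hY).1 X) fun W hW => ?_
  obtain ⟨X, hX, ⟨e⟩⟩ := hD.exists_isRKan f W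
  exact ⟨X, (h X).2 ⟨hX, Q.prop_of_iso e.symm hW⟩, ⟨e⟩⟩

end Prederivator

instance {A B I : Type u} [Category.{u} A] [Category.{u} B] [Category.{u} I] (f : A ⥤ B)
    [f.Faithful] : (f.prod (𝟭 I)).Faithful :=
  ⟨fun h => Prod.ext (f.map_injective (congrArg Prod.fst h)) (congrArg (fun t => t.2) h)⟩

instance {A B I : Type u} [Category.{u} A] [Category.{u} B] [Category.{u} I] (f : A ⥤ B)
    [f.Full] : (f.prod (𝟭 I)).Full :=
  ⟨fun g => ⟨Prod.mkHom (f.preimage g.1) g.2, Prod.ext (f.map_preimage _) rfl⟩⟩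

theorem Prederivator.res_comp_obj {D : Prederivator.{u, v, w}} {A B C : Type u} [Category.{u} A]
    [Category.{u} B] [Category.{u} C] (f : A ⥤ B) (g : B ⥤ C) (X : D.diag C) :
    (D.res (f ⋙ g)).obj X = (D.res f).obj ((D.res g).obj X) :=
  congrArg (fun t => t.obj X) (D.res_comp f g)

/-- Restriction along `f × I` is pointwise restriction along `f`. -/
theorem Prederivator.res_prod_res_sectL {D : Prederivator.{u, v, w}} {A B I : Type u}
    [Category.{u} A] [Category.{u} B] [Category.{u} I] (f : A ⥤ B) (X : D.diag (B × I)) (i : I) :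
    (D.res (Prod.sectL A i)).obj ((D.res (f.prod (𝟭 I))).obj X) =
      (D.res f).obj ((D.res (Prod.sectL B i)).obj X) :=
  congrArg (fun t => t.obj X) ((D.res_comp (Prod.sectL A i) (f.prod (𝟭 I))).symm.trans
    (D.res_comp f (Prod.sectL B i)))

section

variable {C : Type u} [Category.{u} C] {n : ℕ} {y : Fin n → C}

open Bridge Prederivator

variable (y) in
/-- Bridge diagrams are determined by their restriction to the sink end. -/
theorem isEquivalence_bridge_sink (D : StableDerivator.{u, v, w}) (A : Type u) [Category.{u} A] :
    (((bridgeProperty.{u, v, w} y).prop D |>.prop (op (Cat.of A))).ι ⋙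
      D.toPrederivator.res ((sinkEnd y).ι.prod (𝟭 A))).IsEquivalence := by
  have hD := D.isDerivator
  let f₀ := (ObjectProperty.ιOfLE (sinkEnd_le y)).prod (𝟭 A)
  let f₁ := (ObjectProperty.ιOfLE (sinkEndO_le y)).prod (𝟭 A)
  let f₂ := (sinkEndSum y).ι.prod (𝟭 A)
  -- The diagrams reached after adding `o`, and after adding all objects but the initial corner.
  let Q₀ : ObjectProperty (D.toPrederivator.diag ((sinkEndO y).FullSubcategory × A)) :=
    fun X => D.toPrederivator.IsRKan f₀ X
  let Q₁ : ObjectProperty (D.toPrederivator.diag ((sinkEndSum y).FullSubcategory × A)) :=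
    fun X => D.toPrederivator.IsLKan f₁ X ∧
      D.toPrederivator.IsRKan f₀ ((D.toPrederivator.res f₁).obj X)
  have : Q₀.IsClosedUnderIsomorphisms := ⟨fun e h => h.of_iso e⟩
  have : Q₁.IsClosedUnderIsomorphisms :=
    ⟨fun e h => ⟨h.1.of_iso e, h.2.of_iso ((D.toPrederivator.res f₁).mapIso e)⟩⟩
  have h₀ : (Q₀.ι ⋙ D.toPrederivator.res f₀).IsEquivalence :=
    hD.isEquivalence_ι_comp_of_isRKan f₀ (Q := ⊤) (fun X => (and_iff_left trivial).symm) (𝟭 _)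
      (ObjectProperty.topEquivalence _).isEquivalence_functor
  have h₁ := hD.isEquivalence_ι_comp_of_isLKan f₁ (P := Q₁) (fun X => Iff.rfl) _ h₀
  have h₂ := hD.isEquivalence_ι_comp_of_isRKan f₂
    (P := (bridgeProperty.{u, v, w} y).prop D |>.prop (op (Cat.of A))) (Q := Q₁) (fun X => ?_) _ h₁
  · rwa [← res_comp, ← res_comp] at h₂
  · refine (forall_congr' fun a => D.isBridge_iff_sink _).trans ?_
    simp only [forall_and, ← hD.isRKan_ι_iff, ← hD.isLKan_ιOfLE_iff (sinkEndO_le y),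
      ← hD.isRKan_ιOfLE_iff (sinkEnd_le y)]
    refine and_congr (hD.isRKan_prod_iff (sinkEndSum y).ι X).symm (and_congr ?_ ?_)
    · refine Iff.trans ?_ (hD.isLKan_prod_iff (ObjectProperty.ιOfLE (sinkEndO_le y)) _).symm
      exact forall_congr' fun a => iff_of_eq (congrArg _ (res_prod_res_sectL _ X a).symm)
    · refine Iff.trans ?_ (hD.isRKan_prod_iff (ObjectProperty.ιOfLE (sinkEnd_le y)) _).symm
      refine forall_congr' fun a => iff_of_eq (congrArg _ ?_)
      refine (res_comp_obj (ObjectProperty.ιOfLE (sinkEndO_le y)) (sinkEndSum y).ι _).trans ?_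
      refine Eq.trans ?_ (res_prod_res_sectL (ObjectProperty.ιOfLE (sinkEndO_le y)) _ a).symm
      exact congrArg _ (res_prod_res_sectL (sinkEndSum y).ι X a).symm

variable (y) in
/-- Bridge diagrams are determined by their restriction to the source end. -/
theorem isEquivalence_bridge_source (D : StableDerivator.{u, v, w}) (A : Type u) [Category.{u} A] :
    (((bridgeProperty.{u, v, w} y).prop D |>.prop (op (Cat.of A))).ι ⋙
      D.toPrederivator.res ((sourceEnd y).ι.prod (𝟭 A))).IsEquivalence := by
  have hD := D.isDerivator
  let f₀ := (ObjectProperty.ιOfLE (sourceEnd_le y)).prod (𝟭 A)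
  let f₁ := (ObjectProperty.ιOfLE (sourceEndO_le y)).prod (𝟭 A)
  let f₂ := (sourceEndSum y).ι.prod (𝟭 A)
  -- The diagrams reached after adding `o`, and after adding all objects but the final corner.
  let Q₀ : ObjectProperty (D.toPrederivator.diag ((sourceEndO y).FullSubcategory × A)) :=
    fun X => D.toPrederivator.IsLKan f₀ X
  let Q₁ : ObjectProperty (D.toPrederivator.diag ((sourceEndSum y).FullSubcategory × A)) :=
    fun X => D.toPrederivator.IsRKan f₁ X ∧
      D.toPrederivator.IsLKan f₀ ((D.toPrederivator.res f₁).obj X)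
  have : Q₀.IsClosedUnderIsomorphisms := ⟨fun e h => h.of_iso e⟩
  have : Q₁.IsClosedUnderIsomorphisms :=
    ⟨fun e h => ⟨h.1.of_iso e, h.2.of_iso ((D.toPrederivator.res f₁).mapIso e)⟩⟩
  have h₀ : (Q₀.ι ⋙ D.toPrederivator.res f₀).IsEquivalence :=
    hD.isEquivalence_ι_comp_of_isLKan f₀ (Q := ⊤) (fun X => (and_iff_left trivial).symm) (𝟭 _)
      (ObjectProperty.topEquivalence _).isEquivalence_functor
  have h₁ := hD.isEquivalence_ι_comp_of_isRKan f₁ (P := Q₁) (fun X => Iff.rfl) _ h₀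
  have h₂ := hD.isEquivalence_ι_comp_of_isLKan f₂
    (P := (bridgeProperty.{u, v, w} y).prop D |>.prop (op (Cat.of A))) (Q := Q₁) (fun X => ?_) _ h₁
  · rwa [← res_comp, ← res_comp] at h₂
  · refine (forall_congr' fun a => D.isBridge_iff_source _).trans ?_
    simp only [forall_and, ← hD.isLKan_ι_iff, ← hD.isRKan_ιOfLE_iff (sourceEndO_le y),
      ← hD.isLKan_ιOfLE_iff (sourceEnd_le y)]
    refine and_congr (hD.isLKan_prod_iff (sourceEndSum y).ι X).symm (and_congr ?_ ?_)
    · refine Iff.trans ?_ (hD.isRKan_prod_iff (ObjectProperty.ιOfLE (sourceEndO_le y)) _).symm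
      exact forall_congr' fun a => iff_of_eq (congrArg _ (res_prod_res_sectL _ X a).symm)
    · refine Iff.trans ?_ (hD.isLKan_prod_iff (ObjectProperty.ιOfLE (sourceEnd_le y)) _).symm
      refine forall_congr' fun a => iff_of_eq (congrArg _ ?_)
      refine (res_comp_obj (ObjectProperty.ιOfLE (sourceEndO_le y)) (sourceEndSum y).ι _).trans ?_
      refine Eq.trans ?_ (res_prod_res_sectL (ObjectProperty.ιOfLE (sourceEndO_le y)) _ a).symm
      exact congrArg _ (res_prod_res_sectL (sourceEndSum y).ι X a).symm

end

end Deriv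

namespace Deriv

/-! ### The ends of the bridge category as pushouts -/

namespace Bridge

variable {C : Cat.{u, u}} {n : ℕ} (y : Fin n → C)

/-- The inclusion of `C` into the sink end. -/
def loFunctor : C ⥤ (sinkEnd y).FullSubcategory where
  obj c := ⟨.lo c, trivial⟩
  map f := ObjectProperty.homMk (Hom.lo f)
  map_id _ := rfl
  map_comp _ _ := rfl

/-- The final corner, as an object of the sink end. -/
def sinkVertex : (sinkEnd y).FullSubcategory := ⟨.sq (1, 1), rfl⟩

/-- The arrows of the sink. -/
def toVertex (i : Fin n) : (loFunctor y).obj (y i) ⟶ sinkVertex y :=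
  ObjectProperty.homMk (Hom.loSq i (𝟙 _) _ (by decide))

/-- The sink in the sink end. -/
def sinkFunctor : sink.{u} n ⥤ (sinkEnd y).FullSubcategory :=
  WithTerminal.lift ((listFunctor y).toFunctor ⋙ loFunctor y) (fun i => toVertex y i.as.down) (by
    rintro ⟨⟨i⟩⟩ ⟨⟨j⟩⟩ ⟨⟨h⟩⟩
    obtain rfl : i = j := congrArg ULift.down h
    exact (congrArg (· ≫ _) (CategoryTheory.Functor.map_id _ _)).trans (Category.id_comp _))

variable {y} {E : Type u} [Category.{u} E] (F : C ⥤ E) (G : sink.{u} n ⥤ E)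
  (w : (listFunctor y).toFunctor ⋙ F = WithTerminal.incl ⋙ G)

/-- The functor out of the sink end induced by compatible functors on `C` and on the sink. -/
def sinkDesc : (sinkEnd y).FullSubcategory ⥤ E where
  obj
    | ⟨.lo c, _⟩ => F.obj c
    | ⟨.sq _, _⟩ => G.obj .star
  map {a b} f := match a, b, f with
    | ⟨_, _⟩, ⟨_, _⟩, ⟨.lo f⟩ => F.map f
    | ⟨_, _⟩, ⟨_, _⟩, ⟨.loSq i f _ _⟩ => F.map f ≫
        eqToHom (Functor.congr_obj w ⟨⟨i⟩⟩) ≫ G.map (WithTerminal.homFrom _)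
    | ⟨_, _⟩, ⟨_, _⟩, ⟨.sq _⟩ => 𝟙 _
  map_id := by
    rintro ⟨_ | _ | _ | _, h⟩
    · exact F.map_id _
    · exact h.elim
    · exact h.elim
    · rfl
  map_comp := by
    rintro ⟨a, ha⟩ ⟨b, hb⟩ ⟨c, hc⟩ ⟨f⟩ ⟨g⟩
    change Hom a b at f
    change Hom b c at g
    cases f <;> cases g <;> first
      | exact F.map_comp _ _
      | exact (Category.comp_id _).symm
      | exact (Category.id_comp _).symm
      | exact ha.elim
      | exact hb.elim
      | exact hc.elim
      | exact (congrArg (· ≫ _) (F.map_comp _ _)).trans (Category.assoc _ _ _)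

theorem sinkFunctor_comp_sinkDesc : sinkFunctor y ⋙ sinkDesc F G w = G := by
  refine CategoryTheory.Functor.ext ?_ ?_
  · rintro (⟨⟨⟨i⟩⟩⟩ | _)
    · exact Functor.congr_obj w ⟨⟨i⟩⟩
    · rfl
  · rintro (⟨⟨⟨i⟩⟩⟩ | _) (⟨⟨⟨j⟩⟩⟩ | _) f
    · obtain ⟨⟨h⟩⟩ := f
      obtain rfl : i = j := congrArg ULift.down h
      have h₁ := (sinkFunctor y ⋙ sinkDesc F G w).map_id (.of ⟨⟨i⟩⟩)
      have h₂ := G.map_id (.of ⟨⟨i⟩⟩)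
      refine h₁.trans ?_
      refine Eq.trans ?_ (congrArg (fun t => _ ≫ t ≫ _) h₂.symm)
      simp
    · refine (congrArg (· ≫ _) (F.map_id _)).trans ((Category.id_comp _).trans ?_)
      refine congrArg _ ((congrArg G.map (WithTerminal.starTerminal.hom_ext _ f)).trans
        (Category.comp_id _).symm)
    · exact f.elim
    · have h₁ := (sinkFunctor y ⋙ sinkDesc F G w).map_id .star
      have h₂ := G.map_id .star
      obtain rfl : f = 𝟙 _ := WithTerminal.starTerminal.hom_ext _ _
      refine h₁.trans ?_
      refine Eq.trans ?_ (congrArg (fun t => _ ≫ t ≫ _) h₂.symm)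
      simp

/-- A functor out of the sink end is determined by its restrictions to `C` and to the sink. -/
theorem sinkDesc_comp (m : (sinkEnd y).FullSubcategory ⥤ E) :
    sinkDesc (loFunctor y ⋙ m) (sinkFunctor y ⋙ m) rfl = m := by
  refine CategoryTheory.Functor.ext ?_ ?_
  · rintro ⟨_ | _ | _ | p, h⟩
    · rfl
    · exact h.elim
    · exact h.elim
    · cases h
      rfl
  · rintro ⟨a, ha⟩ ⟨b, hb⟩ ⟨f⟩
    change Hom a b at f
    cases f with
    | lo f => exact ((Category.id_comp _).trans (Category.comp_id _)).symm
    | loSq i f p h =>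
      cases hb
      refine Eq.trans ?_ ((Category.id_comp _).trans (Category.comp_id _)).symm
      refine (congrArg _ (Category.id_comp _)).trans
        ((m.map_comp _ _).symm.trans (congrArg m.map ?_))
      ext
      exact congrArg (Hom.loSq i · _ h) (Category.comp_id f)
    | sq h =>
      cases ha
      cases hb
      refine Eq.trans ?_ ((Category.id_comp _).trans (Category.comp_id _)).symm
      exact (m.map_id _).symm
    | hi => exact ha.elim
    | loHi => exact hb.elim
    | zero => exact hb.elim
    | loO => exact hb.elim
    | oHi => exact hb.elim
    | oO => exact hb.elim
    | sqHi => exact hb.elim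

variable (y) in
/-- The sink end is `C` with a sink attached to the objects `y i`, that is, the pushout of `C` and
the sink over the discrete category on `n` objects. -/
theorem isPushout_sinkEnd : IsPushout (listFunctor y) (toSink.{u} n)
    (loFunctor y).toCatHom (sinkFunctor y).toCatHom := by
  refine ⟨⟨rfl⟩, ⟨PushoutCocone.IsColimit.mk _ (fun s => (sinkDesc s.inl.toFunctor s.inr.toFunctor
    (congrArg Cat.Hom.toFunctor s.condition)).toCatHom) (fun s => rfl) (fun s => ?_)
    fun s m h₁ h₂ => ?_⟩⟩
  · exact congrArg Functor.toCatHom (sinkFunctor_comp_sinkDesc _ _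
      (congrArg Cat.Hom.toFunctor s.condition))
  · have h₃ := congrArg Cat.Hom.toFunctor h₁
    have h₄ := congrArg Cat.Hom.toFunctor h₂
    refine (congrArg Functor.toCatHom (sinkDesc_comp m.toFunctor)).symm.trans ?_
    refine congrArg Functor.toCatHom ?_
    -- The induced functor depends only on the two restrictions, which agree by `h₃` and `h₄`.
    congr 1

variable (y)

/-- The inclusion of `C` into the source end. -/
def hiFunctor : C ⥤ (sourceEnd y).FullSubcategory where
  obj c := ⟨.hi c, trivial⟩
  map f := ObjectProperty.homMk (Hom.hi f)
  map_id _ := rfl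
  map_comp _ _ := rfl

/-- The initial corner, as an object of the source end. -/
def sourceVertex : (sourceEnd y).FullSubcategory := ⟨.sq (0, 0), rfl⟩

/-- The arrows of the source. -/
def ofVertex (i : Fin n) : sourceVertex y ⟶ (hiFunctor y).obj (y i) :=
  ObjectProperty.homMk (Hom.sqHi _ (by decide) i (𝟙 _))

/-- The source in the source end. -/
def sourceFunctor : source.{u} n ⥤ (sourceEnd y).FullSubcategory :=
  WithInitial.lift ((listFunctor y).toFunctor ⋙ hiFunctor y) (fun i => ofVertex y i.as.down) (by
    rintro ⟨⟨i⟩⟩ ⟨⟨j⟩⟩ ⟨⟨h⟩⟩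
    obtain rfl : i = j := congrArg ULift.down h
    exact (congrArg (_ ≫ ·) (CategoryTheory.Functor.map_id _ _)).trans (Category.comp_id _))

variable {y} (F : C ⥤ E) (G : source.{u} n ⥤ E)
  (w : (listFunctor y).toFunctor ⋙ F = WithInitial.incl ⋙ G)

/-- The functor out of the source end induced by compatible functors on `C` and on the source. -/
def sourceDesc : (sourceEnd y).FullSubcategory ⥤ E where
  obj
    | ⟨.hi c, _⟩ => F.obj c
    | ⟨.sq _, _⟩ => G.obj .star
  map {a b} f := match a, b, f with
    | ⟨_, _⟩, ⟨_, _⟩, ⟨.hi f⟩ => F.map f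
    | ⟨_, _⟩, ⟨_, _⟩, ⟨.sqHi _ _ i f⟩ => G.map (WithInitial.homTo _) ≫
        eqToHom (Functor.congr_obj w ⟨⟨i⟩⟩).symm ≫ F.map f
    | ⟨_, _⟩, ⟨_, _⟩, ⟨.sq _⟩ => 𝟙 _
  map_id := by
    rintro ⟨_ | _ | _ | _, h⟩
    · exact h.elim
    · exact F.map_id _
    · exact h.elim
    · rfl
  map_comp := by
    rintro ⟨a, ha⟩ ⟨b, hb⟩ ⟨c, hc⟩ ⟨f⟩ ⟨g⟩
    change Hom a b at f
    change Hom b c at g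
    cases f <;> cases g <;> first
      | exact F.map_comp _ _
      | exact (Category.comp_id _).symm
      | exact (Category.id_comp _).symm
      | exact ha.elim
      | exact hb.elim
      | exact hc.elim
      | exact (congrArg (fun t => _ ≫ _ ≫ t) (F.map_comp _ _)).trans (by
          simp only [Category.assoc])

theorem sourceFunctor_comp_sourceDesc : sourceFunctor y ⋙ sourceDesc F G w = G := by
  refine CategoryTheory.Functor.ext ?_ ?_
  · rintro (⟨⟨⟨i⟩⟩⟩ | _)
    · exact Functor.congr_obj w ⟨⟨i⟩⟩
    · rfl
  · rintro (⟨⟨⟨i⟩⟩⟩ | _) (⟨⟨⟨j⟩⟩⟩ | _) f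
    · obtain ⟨⟨h⟩⟩ := f
      obtain rfl : i = j := congrArg ULift.down h
      have h₁ := (sourceFunctor y ⋙ sourceDesc F G w).map_id (.of ⟨⟨i⟩⟩)
      have h₂ := G.map_id (.of ⟨⟨i⟩⟩)
      refine h₁.trans ?_
      refine Eq.trans ?_ (congrArg (fun t => _ ≫ t ≫ _) h₂.symm)
      simp
    · exact f.elim
    · refine (congrArg (fun t => _ ≫ _ ≫ t) (F.map_id _)).trans ?_
      refine Eq.trans ?_ (Category.id_comp _).symm
      refine (congrArg (_ ≫ ·) (Category.comp_id _)).trans ?_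
      exact congrArg (· ≫ _) (congrArg G.map (WithInitial.starInitial.hom_ext _ f))
    · have h₁ := (sourceFunctor y ⋙ sourceDesc F G w).map_id .star
      have h₂ := G.map_id .star
      obtain rfl : f = 𝟙 _ := WithInitial.starInitial.hom_ext _ _
      refine h₁.trans ?_
      refine Eq.trans ?_ (congrArg (fun t => _ ≫ t ≫ _) h₂.symm)
      simp

/-- A functor out of the source end is determined by its restrictions to `C` and to the source. -/
theorem sourceDesc_comp (m : (sourceEnd y).FullSubcategory ⥤ E) :
    sourceDesc (hiFunctor y ⋙ m) (sourceFunctor y ⋙ m) rfl = m := by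
  refine CategoryTheory.Functor.ext ?_ ?_
  · rintro ⟨_ | _ | _ | p, h⟩
    · exact h.elim
    · rfl
    · exact h.elim
    · cases h
      rfl
  · rintro ⟨a, ha⟩ ⟨b, hb⟩ ⟨f⟩
    change Hom a b at f
    cases f with
    | hi f => exact ((Category.id_comp _).trans (Category.comp_id _)).symm
    | sqHi p h i f =>
      cases ha
      refine Eq.trans ?_ ((Category.id_comp _).trans (Category.comp_id _)).symm
      refine (congrArg _ (Category.id_comp _)).trans
        ((m.map_comp _ _).symm.trans (congrArg m.map ?_))
      ext
      exact congrArg (Hom.sqHi _ h i) (Category.id_comp f)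
    | sq h =>
      cases ha
      cases hb
      refine Eq.trans ?_ ((Category.id_comp _).trans (Category.comp_id _)).symm
      exact (m.map_id _).symm
    | lo => exact ha.elim
    | loHi => exact ha.elim
    | zero => exact ha.elim
    | loO => exact ha.elim
    | oHi => exact ha.elim
    | oO => exact ha.elim
    | loSq => exact ha.elim

variable (y) in
/-- The source end is `C` with a source attached to the objects `y i`, that is, the pushout of `C`
and the source over the discrete category on `n` objects. -/
theorem isPushout_sourceEnd : IsPushout (listFunctor y) (toSource.{u} n)
    (hiFunctor y).toCatHom (sourceFunctor y).toCatHom := by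
  refine ⟨⟨rfl⟩, ⟨PushoutCocone.IsColimit.mk _ (fun s => (sourceDesc s.inl.toFunctor s.inr.toFunctor
    (congrArg Cat.Hom.toFunctor s.condition)).toCatHom) (fun s => rfl) (fun s => ?_)
    fun s m h₁ h₂ => ?_⟩⟩
  · exact congrArg Functor.toCatHom (sourceFunctor_comp_sourceDesc _ _
      (congrArg Cat.Hom.toFunctor s.condition))
  · have h₃ := congrArg Cat.Hom.toFunctor h₁
    have h₄ := congrArg Cat.Hom.toFunctor h₂
    refine (congrArg Functor.toCatHom (sourceDesc_comp m.toFunctor)).symm.trans ?_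
    refine congrArg Functor.toCatHom ?_
    -- The induced functor depends only on the two restrictions, which agree by `h₃` and `h₄`.
    congr 1

end Bridge

/-- Restriction along `a` is an equivalence on a class of diagrams if restriction along an inclusion
equivalent to `a` is. -/
theorem Prederivator.isEquivalence_comp_res_prod {D : Prederivator.{u, v, w}} {A B B' M : Type u}
    [Category.{u} A] [Category.{u} B] [Category.{u} B'] [Category.{u} M] (e : B' ≌ B) (f : B ⥤ M)
    {E : Type*} [Category* E] (G : E ⥤ D.diag (M × A))
    (h : (G ⋙ D.res (f.prod (𝟭 A))).IsEquivalence) :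
    (G ⋙ D.res ((e.functor ⋙ f).prod (𝟭 A))).IsEquivalence := by
  have : (e.functor.prod (𝟭 A)).IsEquivalence :=
    (e.prod (CategoryTheory.Equivalence.refl (C := A))).isEquivalence_functor
  have := D.isEquivalence_res (e.functor.prod (𝟭 A))
  have h₁ : D.res ((e.functor ⋙ f).prod (𝟭 A)) =
    D.res (f.prod (𝟭 A)) ⋙ D.res (e.functor.prod (𝟭 A)) :=
    D.res_comp (e.functor.prod (𝟭 A)) (f.prod (𝟭 A))
  rw [h₁]
  exact inferInstanceAs ((G ⋙ D.res (f.prod (𝟭 A))) ⋙ D.res (e.functor.prod (𝟭 A))).IsEquivalence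

end Deriv

end

/-! ### Strong stable equivalence of the two pushouts -/

theorem mainTheorem1 (C : Cat.{u, u}) (n : ℕ) (y : Fin n → C)
    (Cminus Cplus : Cat.{u, u})
    (iminus : C ⟶ Cminus) (jminus : Deriv.source.{u} n ⟶ Cminus)
    (hminus : IsPushout (Deriv.listFunctor y) (Deriv.toSource.{u} n) iminus jminus)
    (iplus : C ⟶ Cplus) (jplus : Deriv.sink.{u} n ⟶ Cplus)
    (hplus : IsPushout (Deriv.listFunctor y) (Deriv.toSink.{u} n) iplus jplus) :
    Deriv.StronglyStablyEquivalent.{u, v, w} Cminus Cplus := by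
  let e := Cat.equivOfIso (hminus.isoIsPushout _ _ (Deriv.Bridge.isPushout_sourceEnd y))
  let e' := Cat.equivOfIso (hplus.isoIsPushout _ _ (Deriv.Bridge.isPushout_sinkEnd y))
  exact Deriv.stronglyStablyEquivalent_of_restriction (Deriv.bridgeProperty y)
    (e.functor ⋙ (Deriv.Bridge.sourceEnd y).ι) (e'.functor ⋙ (Deriv.Bridge.sinkEnd y).ι)
    (fun D A _ => Deriv.Prederivator.isEquivalence_comp_res_prod e _ _
      (Deriv.isEquivalence_bridge_source y D A))
    (fun D A _ => Deriv.Prederivator.isEquivalence_comp_res_prod e' _ _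
      (Deriv.isEquivalence_bridge_sink y D A))
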